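/- Let $Z$ be a compact (Hausdorff) $1$-manifold without boundary and let $E\to Z$ be a vector bundle with structure group $\mathrm{SU}(3)$, that is, a complex rank $3$ vector bundle with a Hermitian metric $h$ and a complex volume form $\Omega$ of unit length on its fibres, everything being continuous. Let $J$ be the complex structure of $E$, $\omega=\mathrm{Im}\,h$ and $\langle\cdot,\cdot\rangle=\mathrm{Re}\,h$. A real rank $3$ subbundle $V\subset E$ is *special Lagrangian* if $\omega$ and $\mathrm{Im}\,\Omega$ vanish on $V$. A pair $(V,V')$ of special Lagrangian subbundles is *graphical* if $V\cap V'=0$ and $J(V)\cap V'=0$. It is *close* if moreover there is a subbundle $F$ of the pullback of $E$ to $Z\times[0,1]$ with $F|_{Z\times\{0\}}=V$ and $F|_{Z\times\{1\}}=V'$ such that $(V,F|_{Z\times\{t\}})$ is a graphical pair for all $t\in(0,1]$. Two close graphical pairs $(V,V')$, $(W,W')$ are *homotopic* if there are subbundles $F,F'$ of the pullback of $E$ to $Z\times[0,1]$, restricting to $V,V'$ at $t=0$ and to $W,W'$ at $t=1$, such that $(F|_{Z\times\{t\}},F'|_{Z\times\{t\}})$ is a close graphical pair for all $t\in[0,1]$.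 *Reordering* a pair means interchanging $V$ and $V'$ over some of the connected components of $Z$. Let $\mathcal{CGP}(E)$ be the set of close graphical pairs modulo the equivalence relation generated by homotopy and reordering. For a graphical pair, $V'$ is pointwise the graph of a linear map $A:V\to V^\perp=J(V)$; let $B_{V,V'}(u,v)=\langle Ju,Av\rangle$, a bilinear form on $V$ (so $V'=\{v+JSv\}$, where $B_{V,V'}(u,v)=\langle u,Sv\rangle$). Call a close graphical pair *normalized* if at every point $B_{V,V'}$ has one negative and two positive eigenvalues, counted with multiplicity. Let $L_{V,V'}$ be, at each point, the negative eigenspace of $B_{V,V'}$ if $B_{V,V'}$ has one negative and two positive eigenvalues there, and the negative eigenspace of $B_{V',V}$ otherwise. Then: 1. Every close graphical pair has a reordering that is a normalized close graphical pair. 2. For every close graphical pair, $L_{V,V'}$ is a real line subbundle of $E$; hence there is a map $$\eta_{V,V'}:\pi_0(Z)\to\mathbb{Z}_2,\qquad \eta_{V,V'}(\Gamma)=w_1(L_{V,V'}|_\Gamma)\in H^1(\Gamma;\mathbb{Z}_2)\cong\mathbb{Z}_2 .$$ 3. Two normalized close graphical pairs $(V,V')$, $(W,W')$ are homotopic if and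 only if $\eta_{V,V'}=\eta_{W,W'}$. 4. The map $$\eta:\mathcal{CGP}(E)\to\mathrm{Hom}(\pi_0(Z),\mathbb{Z}_2),\qquad [(V,V')]\mapsto\eta_{V,V'},$$ is well defined and bijective, where $\mathrm{Hom}(\pi_0(Z),\mathbb{Z}_2)$ is the set of all maps $\pi_0(Z)\to\mathbb{Z}_2$. -/

import Mathlib

open Bundle Topology unitInterval
open scoped InnerProductSpace

namespace SLPairs

/-! ### Linear algebra in a complex inner product space -/

section Fibre

attribute [local instance] InnerProductSpace.complexToReal

variable {W : Type*} [NormedAddCommGroup W] [InnerProductSpace ℂ W]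

/-- The complex structure `J`, as a real-linear map. -/
noncomputable def J : W →ₗ[ℝ] W := (Complex.I • (LinearMap.id : W →ₗ[ℂ] W)).restrictScalars ℝ

/-- A real subspace `V` is special Lagrangian for the complex volume form `Ω` if the
symplectic form `Im h` and `Im Ω` vanish on `V`.  (The condition `dim V = 3` is imposed
separately, by considering rank three subbundles only.) -/
def IsSpecialLagrangian (Ω : W [⋀^Fin 3]→ₗ[ℂ] ℂ) (V : Submodule ℝ W) : Prop :=
  (∀ u ∈ V, ∀ v ∈ V, (inner ℂ u v).im = 0) ∧
    ∀ x : Fin 3 → W, (∀ i, x i ∈ V) → (Ω x).im = 0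

/-- `V'` is the graph `{v + A v | v ∈ V}` of the linear map `A : V → Vᗮ`. -/
def IsGraphMap (V V' : Submodule ℝ W) (A : V →ₗ[ℝ] Vᗮ) : Prop :=
  ∀ w : W, w ∈ V' ↔ ∃ v : V, w = (v : W) + (A v : W)

/-- A subspace is the graph of at most one linear map `V → Vᗮ`. -/
theorem IsGraphMap.unique {V V' : Submodule ℝ W} {A A' : V →ₗ[ℝ] Vᗮ}
    (h : IsGraphMap V V' A) (h' : IsGraphMap V V' A') : A = A' := by
  ext v
  obtain ⟨v', hv'⟩ := (h' _).1 ((h _).2 ⟨v, rfl⟩)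
  have h1 : (v : W) - (v' : W) = (A' v' : W) - (A v : W) := by
    rw [sub_eq_sub_iff_add_eq_add, hv', add_comm]
  have h2 : (v : W) - (v' : W) ∈ V ⊓ Vᗮ :=
    ⟨V.sub_mem v.2 v'.2, h1 ▸ Vᗮ.sub_mem (A' v').2 (A v).2⟩
  rw [V.inf_orthogonal_eq_bot, Submodule.mem_bot] at h2
  have h3 : v = v' := Subtype.ext (sub_eq_zero.1 h2)
  subst h3
  exact (sub_eq_zero.1 (h1.symm.trans h2)).symm

open Classical in
/-- The linear map `V → Vᗮ` whose graph is `V'` (zero if there is none). -/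
noncomputable def graphMap (V V' : Submodule ℝ W) : V →ₗ[ℝ] Vᗮ :=
  if h : ∃ A, IsGraphMap V V' A then h.choose else 0

/-- The bilinear form `B_{V,V'}` on `V`: the linear map `V → Vᗮ` whose graph is `V'`, followed by
the identification `Vᗮ ≅ V*`, `w ↦ ⟪J ·, w⟫`.  Thus `V' = {v + J S v | v ∈ V}`, where `S` is the
endomorphism of `V` with `B_{V,V'}(u, v) = ⟪u, S v⟫`. -/
noncomputable def bform (V V' : Submodule ℝ W) : LinearMap.BilinForm ℝ V :=
  (innerₗ W).compl₁₂ (J ∘ₗ V.subtype) (Vᗮ.subtype ∘ₗ graphMap V V')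

/-- `u` is an eigenvector (or zero) of `B_{V,V'}`, with eigenvalue `c`, with respect to the
inner product of `V`. -/
def IsEigen (V V' : Submodule ℝ W) (c : ℝ) (u : V) : Prop :=
  ∀ v : V, bform V V' u v = c * ⟪u, v⟫_ℝ

/-- Counted with multiplicity, `B_{V,V'}` has one negative eigenvalue and two positive ones. -/
def OneNegTwoPos (V V' : Submodule ℝ W) : Prop :=
  ∃ (b : OrthonormalBasis (Fin 3) ℝ V) (c : Fin 3 → ℝ),
    (∀ i, IsEigen V V' (c i) (b i)) ∧ c 0 < 0 ∧ 0 < c 1 ∧ 0 < c 2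

/-- The subspace of `V` spanned by the eigenvectors of `B_{V,V'}` with negative eigenvalue. -/
noncomputable def negEigenspace (V V' : Submodule ℝ W) : Submodule ℝ W :=
  Submodule.span ℝ {w | ∃ u : V, (u : W) = w ∧ ∃ c < 0, IsEigen V V' c u}

open Classical in
/-- The negative eigenspace, after reordering the pair if necessary. -/
noncomputable def distinguishedLine (V V' : Submodule ℝ W) : Submodule ℝ W :=
  if OneNegTwoPos V V' then negEigenspace V V' else negEigenspace V' V

end Fibre

/-! ### Bundles -/

section Bundle

variable {Z : Type*} [TopologicalSpace Z] (E : Z → Type*)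
  [TopologicalSpace (TotalSpace (EuclideanSpace ℂ (Fin 3)) E)]
  [∀ z, NormedAddCommGroup (E z)] [∀ z, InnerProductSpace ℂ (E z)]

/-- The data that make a complex rank three bundle `E` with Hermitian inner products on its fibres
into a bundle with structure group `SU(3)`: a complex volume form `Ω` on each fibre, such that
near each point there is a continuous frame which is unitary and on which `Ω` equals `1`.
In particular the Hermitian metric and `Ω` are continuous. -/
structure SU3Structure where
  vol : ∀ z, E z [⋀^Fin 3]→ₗ[ℂ] ℂ
  exists_frame : ∀ z₀ : Z, ∃ U ∈ 𝓝 z₀, ∃ e : Fin 3 → ∀ z, E z,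
    (∀ i, ContinuousOn (fun z => (⟨z, e i z⟩ : TotalSpace (EuclideanSpace ℂ (Fin 3)) E)) U) ∧
      ∀ z ∈ U, Orthonormal ℂ (fun i => e i z) ∧ vol z (fun i => e i z) = 1

variable {E}

/-- A family of real subspaces `V b ⊆ E (f b)` is a subbundle of rank `k` of the pullback `f* E` if
it is locally spanned by `k` linearly independent continuous sections. -/
def IsSubbundle {B : Type*} [TopologicalSpace B] (f : B → Z) (k : ℕ)
    (V : ∀ b, Submodule ℝ (E (f b))) : Prop :=
  ∀ b₀ : B, ∃ U ∈ 𝓝 b₀, ∃ s : Fin k → ∀ b, E (f b),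
    (∀ i, ContinuousOn
      (fun b => (⟨f b, s i b⟩ : TotalSpace (EuclideanSpace ℂ (Fin 3)) E)) U) ∧
      ∀ b ∈ U, LinearIndependent ℝ (fun i => s i b) ∧
        V b = Submodule.span ℝ (Set.range fun i => s i b)

/-- Special Lagrangian subbundles of `E`. -/
def IsSLSubbundle (Ω : SU3Structure E) (V : ∀ z, Submodule ℝ (E z)) : Prop :=
  IsSubbundle (fun z : Z => z) 3 V ∧ ∀ z, IsSpecialLagrangian (Ω.vol z) (V z)

/-- `F ⊆ π₁* E → Z × [0,1]` is a homotopy between the rank three subbundles `V` and `W`. -/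
def IsHomotopy (F : ∀ p : Z × I, Submodule ℝ (E p.1)) (V W : ∀ z, Submodule ℝ (E z)) : Prop :=
  IsSubbundle (fun p : Z × I => p.1) 3 F ∧ (∀ z, F (z, 0) = V z) ∧ ∀ z, F (z, 1) = W z

/-- Graphical pairs: transverse pairs `(V, V')` of special Lagrangian subbundles such that `J(V)`
and `V'` are transverse too. -/
def IsGraphicalPair (Ω : SU3Structure E) (V V' : ∀ z, Submodule ℝ (E z)) : Prop :=
  IsSLSubbundle Ω V ∧ IsSLSubbundle Ω V' ∧ (∀ z, V z ⊓ V' z = ⊥) ∧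
    ∀ z, (V z).map J ⊓ V' z = ⊥

/-- Close graphical pairs. -/
def IsCloseGraphicalPair (Ω : SU3Structure E) (V V' : ∀ z, Submodule ℝ (E z)) : Prop :=
  IsGraphicalPair Ω V V' ∧ ∃ F : ∀ p : Z × I, Submodule ℝ (E p.1),
    IsHomotopy F V V' ∧ ∀ t : I, 0 < t → IsGraphicalPair Ω V (fun z => F (z, t))

/-- The type of close graphical pairs of transverse special Lagrangian subbundles of `E`. -/
structure CloseGraphicalPair (Ω : SU3Structure E) where
  fst : ∀ z, Submodule ℝ (E z)
  snd : ∀ z, Submodule ℝ (E z)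
  isClose : IsCloseGraphicalPair Ω fst snd

namespace CloseGraphicalPair

variable {Ω : SU3Structure E}

/-- Homotopy through close graphical pairs. -/
def Homotopic (P Q : CloseGraphicalPair Ω) : Prop :=
  ∃ F F' : ∀ p : Z × I, Submodule ℝ (E p.1),
    IsHomotopy F P.fst Q.fst ∧ IsHomotopy F' P.snd Q.snd ∧
      ∀ t : I, IsCloseGraphicalPair Ω (fun z => F (z, t)) (fun z => F' (z, t))

/-- `Q` arises from `P` by interchanging the two subbundles over an open and closed set (that is,
over some of the connected components of the base, if these are finite in number). -/
def IsReordering (P Q : CloseGraphicalPair Ω) : Prop :=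
  ∃ S : Set Z, IsClopen S ∧ (∀ z ∈ S, Q.fst z = P.snd z ∧ Q.snd z = P.fst z) ∧
    ∀ z ∉ S, Q.fst z = P.fst z ∧ Q.snd z = P.snd z

/-- The form `B_{V,V'}` has one negative and two positive eigenvalues at every point. -/
def IsNormalized (P : CloseGraphicalPair Ω) : Prop :=
  ∀ z, OneNegTwoPos (P.fst z) (P.snd z)

/-- The line bundle of a close graphical pair: the negative eigenspace of `B_{V,V'}`, the pair
being reordered where necessary. -/
noncomputable def line (P : CloseGraphicalPair Ω) (z : Z) : Submodule ℝ (E z) :=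
  distinguishedLine (P.fst z) (P.snd z)

end CloseGraphicalPair

/-- The set of homotopy classes of close graphical pairs of transverse special Lagrangian
subbundles of `E`, where pairs are considered up to reordering (over components of the base). -/
def CGP (Ω : SU3Structure E) : Type _ :=
  Quot fun P Q : CloseGraphicalPair Ω => P.Homotopic Q ∨ P.IsReordering Q

/-- The monodromy of the real line bundle `L` around the loop `γ` is negative: parallel transport
of a nonzero vector of `L` around `γ` gives a negative multiple of that vector. -/
def ReversesOrientation (L : ∀ z, Submodule ℝ (E z)) {z : Z} (γ : Path z z) : Prop :=
  ∃ s : ∀ t : I, E (γ t),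
    Continuous (fun t => (⟨γ t, s t⟩ : TotalSpace (EuclideanSpace ℂ (Fin 3)) E)) ∧
      (∀ t, s t ∈ L (γ t) ∧ s t ≠ 0) ∧
        ∃ c : ℝ, c < 0 ∧
          (⟨γ 1, s 1⟩ : TotalSpace (EuclideanSpace ℂ (Fin 3)) E) = ⟨γ 0, c • s 0⟩

open Classical in
/-- The first Stiefel-Whitney class of a real line bundle `L`, as a function of loops
(that is, as an element of `H¹(Z; ℤ₂) = Hom(π₁ Z, ℤ₂)` on each component). -/
noncomputable def w1 (L : ∀ z, Submodule ℝ (E z)) {z : Z} (γ : Path z z) : ZMod 2 :=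
  if ReversesOrientation L γ then 1 else 0

open Classical in
/-- The class `w₁(L|_Γ) ∈ H¹(Γ; ℤ₂)` as an element of `ℤ₂`, for a closed one-dimensional
component `Γ`: there is only one isomorphism of `H¹(Γ; ℤ₂)` with `ℤ₂`, and it sends
a class to `1` if and only if that class does not vanish on all loops in `Γ`. -/
noncomputable def w1Component (L : ∀ z, Submodule ℝ (E z)) (Γ : ZerothHomotopy Z) : ZMod 2 :=
  if ∃ (z : Z) (γ : Path z z), (Quotient.mk _ z : ZerothHomotopy Z) = Γ ∧ w1 L γ ≠ 0
  then 1 else 0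

/-- The invariant `η_{V,V'} : π₀(Z) → ℤ₂`, `Γ ↦ w₁(L_{V,V'}|_Γ)`. -/
noncomputable def CloseGraphicalPair.eta {Ω : SU3Structure E} (P : CloseGraphicalPair Ω) :
    ZerothHomotopy Z → ZMod 2 :=
  fun Γ => w1Component P.line Γ

end Bundle

end SLPairs

open SLPairs

/-!
Over a closed one-manifold `Z` the bundle `E` is trivial, and all assertions become statements about
`SU(3)` and about real symmetric `3 × 3` matrices.

*Triviality.*  Every component of `Z` is a circle (`exists_circleParams`), so, `SU(3)` being
connected, there is a global frame (`SU3Structure.exists_global_frame`).  In such a frame `e`, the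
special Lagrangian subspaces are the subspaces `u ℝ³` with `u ∈ SU(3)`, and `u ℝ³` is encoded by
the symmetric matrix `u uᵀ` (`isSLFamily_iff`).

*Linear algebra.*  Let `S` be the matrix of `B_{V,V'}` in an orthonormal basis of `V`.  The space
`V'`, the graph of `J S` over `V`, is special Lagrangian if and only if `S` is symmetric and
`det (1 + i S)` is real, and `V ∩ V' = 0` means `det S ≠ 0`.  If the pair is close, then
`det (1 + i S) > 0`, because this number never vanishes and equals `1` when `V'` is replaced by `V`
(`IsCloseGraphicalPair.exists_posGraph`).  So the arguments of `1 + i c`, for the eigenvalues `c` of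
`S`, are in `(-π/2, π/2)`, not zero, and have sum `0`; the signs of the eigenvalues are `(-,+,+)` or
`(-,-,+)`, and the sign of `det S`, which is locally constant, tells which.  Interchanging `V` and
`V'` replaces `S` by a conjugate of `-S` (`exists_reversed_frame`) and thus interchanges the two
cases (`exists_reordering`).  The negative eigenvalue is simple, so its eigenline is continuous
(`exists_continuousOn_eigenvector`).

*Deformations.*  Conversely, a pair of special Lagrangian subbundles for which `S` satisfies these
conditions with signs `(-,+,+)` is close.  Let `T` be the restriction of `S` to the complement of
the negative eigenline.  Then `0 < det T < 1`, and the negative eigenvalue is determined by `T`.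
Scaling `T` to zero connects `V'` with `V` through such pairs
(`isCloseGraphicalPair_of_adapted`), and a similar path makes `T` equal to half the identity
(`exists_standardization`).  Both paths are equivariant under orthogonal changes of basis.  Therefore
every normalized pair is homotopic to one that is determined by a field of adapted frames, that is, of
unitary frames of volume one that are bases of `V` and start with a negative eigenvector.

*Homotopy classes.*  Adapted frames are unique up to the group `S(O(1) × O(2))`, which has two
components.  Along a circle an adapted frame can be chosen such that it closes up to the identity or
to `diag (-1, -1, 1)` (`exists_circle_lift`), and the second case occurs exactly if the negative
eigenline is not orientable (`CloseGraphicalPair.eta_eq_of_lift`).  As `SU(3)` is simply connected,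
lifts that close up in the same way are homotopic (`exists_homotopy_of_twist`), so that `η`
distinguishes all homotopy classes of normalized pairs; as `SU(3)` is connected, all values of
`η` occur (`CloseGraphicalPair.exists_eta_eq`).

*Invariance.*  Along a homotopy the eigenlines at nearby times are not orthogonal, and orthogonal
projection identifies them; hence `η` is a homotopy invariant
(`reversesOrientation_homotopy`).  Reordering does not change the line.
-/

namespace SLPairs

open Matrix

/-! ### Simple connectivity of a union of two open sets -/

section VanKampen

variable {X : Type*} [TopologicalSpace X]

theorem homotopic_of_mem_isSimplyConnected {U : Set X} (hU : IsSimplyConnected U) {x y : X}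
    (α β : Path x y) (hα : ∀ t, α t ∈ U) (hβ : ∀ t, β t ∈ U) : α.Homotopic β := by
  have := hU.simplyConnectedSpace
  have hx : x ∈ U := by simpa using hα 0
  have hy : y ∈ U := by simpa using hα 1
  let α' : Path (⟨x, hx⟩ : U) ⟨y, hy⟩ :=
    { toFun := fun t => ⟨α t, hα t⟩, source' := by simp, target' := by simp }
  let β' : Path (⟨x, hx⟩ : U) ⟨y, hy⟩ :=
    { toFun := fun t => ⟨β t, hβ t⟩, source' := by simp, target' := by simp }
  exact (SimplyConnectedSpace.paths_homotopic α' β').map ⟨Subtype.val, continuous_subtype_val⟩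

/-- The easy part of van Kampen's theorem.  Every point `y` is assigned the homotopy class `c y` of
a path from a base point in `U ∩ V` to `y` that stays in `U` or in `V`; this does not depend on
choices, and every path `γ` from `y` to `y'` satisfies `c y * [γ] = c y'`, because this holds for
paths inside `U` and for paths inside `V`. -/
theorem simplyConnectedSpace_of_union {U V : Set X} (hUo : IsOpen U) (hVo : IsOpen V)
    (hUV : U ∪ V = Set.univ) (hU : IsSimplyConnected U) (hV : IsSimplyConnected V)
    (hI : IsPathConnected (U ∩ V)) : SimplyConnectedSpace X := by
  classical
  obtain ⟨x₀, hx₀, hx₀j⟩ := hI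
  -- paths from the base point that stay in `U`, or in `V`, are homotopic to a common path
  have hc : ∀ y : X, ∃ c : Path.Homotopic.Quotient x₀ y,
      (∀ α : Path x₀ y, (∀ t, α t ∈ U) → .mk α = c) ∧
      (∀ α : Path x₀ y, (∀ t, α t ∈ V) → .mk α = c) := by
    intro y
    have key : ∀ β : Path x₀ y, (∀ t, β t ∈ U ∩ V) → (∀ α : Path x₀ y, (∀ t, α t ∈ U) →
        Path.Homotopic.Quotient.mk α = .mk β) ∧ (∀ α : Path x₀ y, (∀ t, α t ∈ V) →
        Path.Homotopic.Quotient.mk α = .mk β) := fun β hβ =>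
      ⟨fun α hα => Path.Homotopic.Quotient.eq.2
        (homotopic_of_mem_isSimplyConnected hU α β hα fun t => (hβ t).1),
       fun α hα => Path.Homotopic.Quotient.eq.2
        (homotopic_of_mem_isSimplyConnected hV α β hα fun t => (hβ t).2)⟩
    by_cases hyU : y ∈ U
    · by_cases hyV : y ∈ V
      · obtain ⟨β, hβ⟩ := hx₀j ⟨hyU, hyV⟩
        exact ⟨.mk β, key β hβ⟩
      · obtain ⟨β, hβ⟩ := hU.isPathConnected.joinedIn _ hx₀.1 _ hyU
        exact ⟨.mk β, fun α hα => Path.Homotopic.Quotient.eq.2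
          (homotopic_of_mem_isSimplyConnected hU α β hα hβ),
          fun α hα => absurd (by simpa using hα 1) hyV⟩
    · have hyV : y ∈ V := by
        have : y ∈ U ∪ V := hUV ▸ Set.mem_univ y
        exact this.resolve_left hyU
      obtain ⟨β, hβ⟩ := hV.isPathConnected.joinedIn _ hx₀.2 _ hyV
      exact ⟨.mk β, fun α hα => absurd (by simpa using hα 1) hyU,
        fun α hα => Path.Homotopic.Quotient.eq.2
          (homotopic_of_mem_isSimplyConnected hV α β hα hβ)⟩
  choose c hcU hcV using hc
  have htrans : ∀ {W : Set X} {y y' : X} (α : Path x₀ y) (γ : Path y y'), (∀ t, α t ∈ W) →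
      (∀ t, γ t ∈ W) → ∀ t, (α.trans γ) t ∈ W := by
    intro W y y' α γ hα hγ t
    rw [Path.trans_apply]
    split_ifs
    · exact hα _
    · exact hγ _
  -- `c y * [γ] = c y'` for paths inside one of the two sets: prepend a path that stays in this set
  have step : ∀ {y y' : X} (γ : Path y y'), ((∀ t, γ t ∈ U) ∨ ∀ t, γ t ∈ V) →
      (c y).trans (.mk γ) = c y' := by
    rintro y y' γ (h | h)
    · obtain ⟨α, hα⟩ := hU.isPathConnected.joinedIn _ hx₀.1 _ (by simpa using h 0 : y ∈ U)
      rw [← hcU y α hα, ← hcU y' (α.trans γ) (htrans α γ hα h), Path.Homotopic.Quotient.mk_trans]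
    · obtain ⟨α, hα⟩ := hV.isPathConnected.joinedIn _ hx₀.2 _ (by simpa using h 0 : y ∈ V)
      rw [← hcV y α hα, ← hcV y' (α.trans γ) (htrans α γ hα h), Path.Homotopic.Quotient.mk_trans]
  -- the general case, by cutting `γ` into pieces that lie inside one of the two sets
  have all : ∀ {y y' : X} (γ : Path y y'), (c y).trans (.mk γ) = c y' := by
    intro y y' γ
    obtain ⟨t, ht0, htm, ⟨m, hm⟩, ht⟩ := exists_monotone_Icc_subset_open_cover_unitInterval
      (c := fun i : Bool => γ ⁻¹' (if i then U else V))
      (fun i => by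
        cases i
        exacts [hVo.preimage γ.continuous, hUo.preimage γ.continuous])
      (fun s _ => by
        have : γ s ∈ U ∪ V := hUV ▸ Set.mem_univ _
        rcases this with h | h
        · exact Set.mem_iUnion.2 ⟨true, h⟩
        · exact Set.mem_iUnion.2 ⟨false, h⟩)
    have ind : ∀ n, (c (γ 0)).trans (.mk (γ.subpath 0 (t n))) = c (γ (t n)) := by
      intro n
      induction n with
      | zero =>
        have h0 : ∀ s, γ.subpath 0 (t 0) s = γ 0 := fun s => by
          change γ (Set.Icc.convexComb 0 (t 0) s) = γ 0
          rw [ht0]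
          simp
        refine step _ ?_
        have : γ 0 ∈ U ∪ V := hUV ▸ Set.mem_univ _
        rcases this with h | h
        · exact Or.inl fun s => by rw [h0 s]; exact h
        · exact Or.inr fun s => by rw [h0 s]; exact h
      | succ n ih =>
        have h1 := Path.Homotopic.Quotient.eq.2
          ⟨Path.Homotopy.subpathTransSubpath γ 0 (t n) (t (n + 1))⟩
        rw [← h1, Path.Homotopic.Quotient.mk_trans, ← Path.Homotopic.Quotient.trans_assoc, ih]
        refine step _ ?_
        obtain ⟨i, hi⟩ := ht n
        have hr : ∀ s, γ.subpath (t n) (t (n + 1)) s ∈ (if i then U else V) := by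
          intro s
          have : γ.subpath (t n) (t (n + 1)) s ∈ γ '' Set.Icc (t n) (t (n + 1)) := by
            rw [← Path.range_subpath_of_le _ _ _ (htm n.le_succ)]
            exact ⟨s, rfl⟩
          obtain ⟨r, hr, hr'⟩ := this
          rw [← hr']
          exact hi hr
        cases i
        · right; simpa using hr
        · left; simpa using hr
    have := ind m
    rw [hm m le_rfl, Path.subpath_zero_one] at this
    obtain ⟨h0, h1⟩ : γ 0 = y ∧ γ 1 = y' := ⟨γ.source, γ.target⟩
    -- `γ 0 = y` does not hold by definition, so the end points of `γ` are transported
    have gen : ∀ (a b : X) (ha : a = y) (hb : b = y'),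
        (c a).trans (.mk (γ.cast ha hb)) = c b → (c y).trans (.mk γ) = c y' := by
      rintro a b rfl rfl h
      exact h
    exact gen _ _ h0 h1 this
  rw [simply_connected_iff_paths_homotopic']
  refine ⟨⟨⟨x₀⟩, fun y y' => ?_⟩, fun {y y'} p q => ?_⟩
  · have hj : ∀ y, Joined x₀ y := fun y => ⟨(c y).out⟩
    exact (hj y).symm.trans (hj y')
  · rw [← Path.Homotopic.Quotient.eq]
    have h := (all p).trans (all q).symm
    have h2 := congrArg (fun z => (c y).symm.trans z) h
    simpa [← Path.Homotopic.Quotient.trans_assoc] using h2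

end VanKampen

/-! ### Simple connectivity of spheres -/

section Sphere

variable {V : Type*} [NormedAddCommGroup V] [InnerProductSpace ℝ V]

theorem isSimplyConnected_sphere_compl_singleton (v : Metric.sphere (0 : V) 1) :
    IsSimplyConnected ({v}ᶜ : Set (Metric.sphere (0 : V) 1)) := by
  have hv : ‖(v : V)‖ = 1 := by simp
  have h := (isOpenEmbedding_stereographic_symm hv).isEmbedding.isSimplyConnected_image
    (s := Set.univ)
  rw [Set.image_univ, range_stereographic_symm hv] at h
  refine h.2 ?_
  have : ContractibleSpace (Set.univ : Set (ℝ ∙ (v : V))ᗮ) :=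
    (Homeomorph.Set.univ (ℝ ∙ (v : V))ᗮ).contractibleSpace
  exact SimplyConnectedSpace.ofContractible _

theorem isPathConnected_sphere_compl_pair (hV : 2 < Module.finrank ℝ V)
    (v : Metric.sphere (0 : V) 1) :
    IsPathConnected ({v}ᶜ ∩ {-v}ᶜ : Set (Metric.sphere (0 : V) 1)) := by
  have hv : ‖(v : V)‖ = 1 := by simp
  have : FiniteDimensional ℝ V := FiniteDimensional.of_finrank_pos (by omega)
  have hd : Module.finrank ℝ (ℝ ∙ (v : V)) + Module.finrank ℝ (ℝ ∙ (v : V))ᗮ =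
      Module.finrank ℝ V := Submodule.finrank_add_finrank_orthogonal _
  rw [finrank_span_singleton (by intro h; simp [h] at hv)] at hd
  have hr : 1 < Module.rank ℝ (ℝ ∙ (v : V))ᗮ := by
    rw [← Module.finrank_eq_rank]
    exact_mod_cast (by omega : 1 < Module.finrank ℝ (ℝ ∙ (v : V))ᗮ)
  have h := (isPathConnected_compl_singleton_of_one_lt_rank hr 0).image
    (isOpenEmbedding_stereographic_symm hv).continuous
  convert h using 1
  -- stereographic coordinates centred at `v` send the antipode `-v` to the origin
  have h0 : (stereographic hv).symm 0 = -v := by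
    rw [← stereographic_apply_neg v]
    refine (stereographic hv).left_inv ?_
    rw [stereographic_source]
    intro h
    have h' : -(v : V) = v := congrArg Subtype.val h
    rw [neg_eq_iff_add_eq_zero, ← two_smul ℝ, smul_eq_zero] at h'
    have : (v : V) = 0 := by simpa using h'
    simp [this] at hv
  rw [Set.image_compl_eq_range_sdiff_image (isOpenEmbedding_stereographic_symm hv).injective,
    Set.image_singleton, h0, range_stereographic_symm hv]
  rfl

theorem simplyConnectedSpace_sphere (hV : 2 < Module.finrank ℝ V) :
    SimplyConnectedSpace (Metric.sphere (0 : V) 1) := by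
  have : FiniteDimensional ℝ V := FiniteDimensional.of_finrank_pos (by omega)
  have : Nontrivial V := Module.nontrivial_of_finrank_pos (R := ℝ) (by omega)
  obtain ⟨v, hv⟩ := NormedSpace.sphere_nonempty (E := V) (x := 0) (r := 1) |>.2 zero_le_one
  refine simplyConnectedSpace_of_union (U := {⟨v, hv⟩}ᶜ) (V := {-⟨v, hv⟩}ᶜ)
    isOpen_compl_singleton isOpen_compl_singleton ?_
    (isSimplyConnected_sphere_compl_singleton _) (isSimplyConnected_sphere_compl_singleton _)
    (isPathConnected_sphere_compl_pair hV _)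
  rw [← Set.compl_inter, ← Set.compl_empty, compl_inj_iff, Set.eq_empty_iff_forall_notMem]
  rintro x ⟨h1, h2⟩
  rw [Set.mem_singleton_iff] at h1 h2
  have h' : v = -v := congrArg Subtype.val (h1.symm.trans h2)
  rw [← add_eq_zero_iff_eq_neg, ← two_smul ℝ, smul_eq_zero] at h'
  have h0 : v = 0 := by simpa using h'
  simp [h0] at hv

end Sphere

/-! ### Simple connectivity of `SU(3)` -/

/-- The group `SU(3)`. -/
abbrev SU3 : Type := specialUnitaryGroup (Fin 3) ℂ

/-- Complex `3 × 3` matrices. -/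
abbrev M3 : Type := Matrix (Fin 3) (Fin 3) ℂ

instance : IsTopologicalGroup SU3 where
  continuous_inv := by
    refine Continuous.subtype_mk (f := fun A : SU3 => star (A : M3)) ?_ _
    exact continuous_subtype_val.star

theorem SU3.star_mul_self (A : SU3) : star (A : M3) * A = 1 := A.2.1.1

theorem SU3.mul_star_self (A : SU3) : (A : M3) * star (A : M3) = 1 :=
  A.2.1.2

theorem SU3.coe_inv (A : SU3) : ((A⁻¹ : SU3) : M3) = star (A : M3) :=
  rfl

theorem SU3.det_eq (A : SU3) : (A : M3).det = 1 := A.2.2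

/-- A unitary matrix is made special unitary by rescaling its second column. -/
def fixDet (A : M3) : M3 :=
  A * diagonal ![1, star A.det, 1]

theorem fixDet_mem {A : M3} (h : A * star A = 1) :
    fixDet A ∈ specialUnitaryGroup (Fin 3) ℂ := by
  have hd : A.det * star A.det = 1 := by
    have := congrArg det h
    rwa [det_mul, det_one, star_eq_conjTranspose, det_conjTranspose] at this
  refine ⟨?_, ?_⟩
  · refine mem_unitaryGroup_iff.2 ?_
    rw [fixDet, star_mul, mul_assoc, ← mul_assoc (diagonal _)]
    have : diagonal ![1, star A.det, 1] * star (diagonal ![1, star A.det, 1]) = 1 := by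
      rw [star_eq_conjTranspose, diagonal_conjTranspose, diagonal_mul_diagonal, ← diagonal_one]
      congr 1
      ext i
      fin_cases i <;> simp
      simpa [mul_comm] using hd
    rw [this, one_mul, h]
  · change (fixDet A).det = 1
    rw [fixDet, det_mul, det_diagonal, Fin.prod_univ_three]
    simpa using hd

/-- For a unit vector `v` with `v 0 ≠ -1`, the unitary matrix
`-1 + x xᴴ / ⟪x, e₀⟫`, `x = v + e₀`, whose first column is `v`. -/
noncomputable def reflMat (v : Fin 3 → ℂ) : M3 :=
  (star (1 + v 0))⁻¹ • vecMulVec (v + Pi.single 0 1) (star (v + Pi.single 0 1)) - 1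

theorem reflMat_mul_star {v : Fin 3 → ℂ} (hv : v ⬝ᵥ star v = 1) (h0 : 1 + v 0 ≠ 0) :
    reflMat v * star (reflMat v) = 1 := by
  set x := v + Pi.single 0 1 with hx
  have hxx : star x ⬝ᵥ x = (1 + v 0) + star (1 + v 0) := by
    have h1 : star v ⬝ᵥ v = 1 := by rw [dotProduct_comm]; exact hv
    simp only [hx, star_add, add_dotProduct, dotProduct_add, h1]
    simp
    ring
  have hP : vecMulVec x (star x) * vecMulVec x (star x) =
      ((1 + v 0) + star (1 + v 0)) • vecMulVec x (star x) := by
    rw [vecMulVec_mul_vecMulVec, hxx, vecMulVec_smul]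
  have hPs : star (vecMulVec x (star x)) = vecMulVec x (star x) := by
    rw [star_eq_conjTranspose, conjTranspose_vecMulVec, star_star]
  have h0' : star (1 + v 0) ≠ 0 := star_ne_zero.2 h0
  rw [reflMat, star_sub, star_one, star_smul, hPs, sub_mul, mul_sub, smul_mul_smul_comm, hP,
    one_mul, mul_one, smul_smul, star_inv₀, star_star]
  have hs : (star (1 + v 0))⁻¹ * (1 + v 0)⁻¹ * ((1 + v 0) + star (1 + v 0)) =
      (star (1 + v 0))⁻¹ + (1 + v 0)⁻¹ := by
    field_simp
  rw [hs]
  module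

theorem reflMat_apply_zero {v : Fin 3 → ℂ} (h0 : 1 + v 0 ≠ 0) (i : Fin 3) :
    reflMat v i 0 = v i := by
  have h0' : star (1 + v 0) ≠ 0 := star_ne_zero.2 h0
  have : star (v 0 + 1) = star (1 + v 0) := by rw [add_comm]
  simp only [reflMat, Matrix.sub_apply, Matrix.smul_apply, vecMulVec_apply, Pi.add_apply, Pi.star_apply,
    Pi.single_eq_same, this, smul_eq_mul]
  rw [mul_comm (v i + _), inv_mul_cancel_left₀ h0', one_apply, Pi.single_apply]
  ring

theorem continuousOn_fixDet_reflMat :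
    ContinuousOn (fun v : Fin 3 → ℂ => fixDet (reflMat v)) {v | 1 + v 0 ≠ 0} := by
  have h : ContinuousOn reflMat {v | 1 + v 0 ≠ 0} := by
    unfold reflMat
    refine (ContinuousOn.smul (ContinuousOn.inv₀ (by fun_prop) fun v hv => star_ne_zero.2 hv)
      (Continuous.continuousOn ?_)).sub continuousOn_const
    refine continuous_matrix fun i j => ?_
    simp only [vecMulVec_apply, Pi.add_apply, Pi.star_apply]
    fun_prop
  have hc : Continuous fixDet := by
    unfold fixDet
    refine continuous_id.mul (Continuous.matrix_diagonal ?_)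
    refine continuous_pi fun i => ?_
    fin_cases i
    · exact continuous_const
    · exact (Continuous.matrix_det continuous_id).star
    · exact continuous_const
  exact hc.comp_continuousOn h

theorem fixDet_apply_zero (A : M3) (i : Fin 3) : fixDet A i 0 = A i 0 := by
  simp [fixDet, mul_diagonal]

/-- A matrix in `SU(3)` with a given first column `v`, for unit vectors `v ≠ -e₀`. -/
theorem exists_section_firstCol : ∃ R : (Fin 3 → ℂ) → SU3,
    ContinuousOn R {v | v ⬝ᵥ star v = 1 ∧ 1 + v 0 ≠ 0} ∧
    (∀ v, v ⬝ᵥ star v = 1 → 1 + v 0 ≠ 0 → ∀ i, (R v : M3) i 0 = v i) ∧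
    ∀ v, v ⬝ᵥ star v = 1 → 1 + v 0 ≠ 0 → (R v : M3) = fixDet (reflMat v) := by
  classical
  have hm : ∀ v : Fin 3 → ℂ, v ⬝ᵥ star v = 1 → 1 + v 0 ≠ 0 →
      fixDet (reflMat v) ∈ specialUnitaryGroup (Fin 3) ℂ := fun v h h0 =>
    fixDet_mem (reflMat_mul_star h h0)
  let R : (Fin 3 → ℂ) → SU3 := fun v =>
    if h : v ⬝ᵥ star v = 1 ∧ 1 + v 0 ≠ 0 then ⟨fixDet (reflMat v), hm v h.1 h.2⟩ else 1
  have hR : ∀ v, v ⬝ᵥ star v = 1 → 1 + v 0 ≠ 0 →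
      (R v : M3) = fixDet (reflMat v) := fun v h h0 => by
    simp only [R, dif_pos (And.intro h h0)]
  refine ⟨R, ?_, fun v h h0 i => ?_, hR⟩
  · rw [Topology.IsInducing.subtypeVal.continuousOn_iff]
    exact (continuousOn_fixDet_reflMat.mono fun v hv => hv.2).congr fun v hv => hR v hv.1 hv.2
  · rw [hR v h h0, fixDet_apply_zero, reflMat_apply_zero h0]

theorem SU3.firstCol_norm (A : SU3) :
    (fun i => (A : M3) i 0) ⬝ᵥ star (fun i => (A : M3) i 0) = 1 := by
  have := congrFun (congrFun A.star_mul_self 0) 0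
  rw [mul_apply, one_apply_eq] at this
  rw [← this, dotProduct]
  exact Finset.sum_congr rfl fun i _ => mul_comm _ _

/-- The stabilizer of `e₀` in `SU(3)`, which is a copy of `SU(2)`. -/
def stabE0 : Set SU3 := {A | ∀ i, (A : M3) i 0 = (Pi.single 0 1 : Fin 3 → ℂ) i}

/-- The inverse of a matrix in `SU(3)` is both its adjoint and its adjugate. -/
theorem stabE0_form {A : SU3} (h : A ∈ stabE0) : (A : M3) =
    !![1, 0, 0; 0, A.1 1 1, -star (A.1 2 1); 0, A.1 2 1, star (A.1 1 1)] := by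
  have h0 : A.1 0 0 = 1 := by simpa using h 0
  have h1 : A.1 1 0 = 0 := by simpa using h 1
  have h2 : A.1 2 0 = 0 := by simpa using h 2
  have hadj : star A.1 = A.1.adjugate := by
    have e : A.1.adjugate = A.1.adjugate * (A.1 * star A.1) := by
      rw [A.mul_star_self, mul_one]
    rw [e, ← mul_assoc, adjugate_mul, A.det_eq, one_smul, one_mul]
  rw [adjugate_fin_three] at hadj
  have e := fun i j => congrFun (congrFun hadj i) j
  have e10 := e 1 0
  have e20 := e 2 0
  have e21 := e 2 1
  have e22 := e 2 2
  simp [star_apply, h0, h1, h2] at e10 e20 e21 e22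
  have e21' : A.1 1 2 = -star (A.1 2 1) := by
    have := congrArg star e21
    simpa using this
  have e22' : A.1 2 2 = star (A.1 1 1) := by
    have := congrArg star e22
    simpa using this
  ext i j
  fin_cases i <;> fin_cases j <;> simp [h0, h1, h2, e10, e20, e21', e22']

/-- The group `SU(2)` is homeomorphic to the three-sphere. -/
theorem simplyConnectedSpace_stabE0 : SimplyConnectedSpace stabE0 := by
  have : SimplyConnectedSpace (Metric.sphere (0 : EuclideanSpace ℂ (Fin 2)) 1) :=
    simplyConnectedSpace_sphere (by rw [finrank_real_of_complex]; simp)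
  let φ : EuclideanSpace ℂ (Fin 2) → M3 := fun w =>
    !![1, 0, 0; 0, w 0, -star (w 1); 0, w 1, star (w 0)]
  have hφ : ∀ w ∈ Metric.sphere (0 : EuclideanSpace ℂ (Fin 2)) 1,
      φ w ∈ specialUnitaryGroup (Fin 3) ℂ := by
    intro w hw
    have hn : w 0 * star (w 0) + w 1 * star (w 1) = 1 := by
      rw [mem_sphere_zero_iff_norm, EuclideanSpace.norm_eq, Real.sqrt_eq_one,
        Fin.sum_univ_two] at hw
      have h2 : ∀ z : ℂ, z * star z = ((‖z‖ ^ 2 : ℝ) : ℂ) := fun z => by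
        simpa using Complex.mul_conj' z
      rw [h2, h2, ← Complex.ofReal_add, hw, Complex.ofReal_one]
    refine ⟨mem_unitaryGroup_iff.2 ?_, ?_⟩
    · ext i j
      fin_cases i <;> fin_cases j <;>
        simp [φ, mul_apply, Fin.sum_univ_three, star_apply] at hn ⊢ <;>
        first | ring1 | linear_combination hn
    · change (φ w).det = 1
      simp [φ, det_fin_three] at hn ⊢
      linear_combination hn
  let Φ : stabE0 ≃ₜ Metric.sphere (0 : EuclideanSpace ℂ (Fin 2)) 1 :=
    { toFun := fun A => ⟨!₂[A.1.1 1 1, A.1.1 2 1], by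
        have h := congrFun (congrFun A.1.star_mul_self 1) 1
        have h01 : A.1.1 0 1 = 0 := by rw [stabE0_form A.2]; simp
        rw [mul_apply, one_apply_eq, Fin.sum_univ_three] at h
        simp only [star_apply, h01, star_zero, zero_mul, zero_add] at h
        rw [mem_sphere_zero_iff_norm, EuclideanSpace.norm_eq, Real.sqrt_eq_one, Fin.sum_univ_two]
        have h2 : ∀ z : ℂ, star z * z = ((‖z‖ ^ 2 : ℝ) : ℂ) := fun z => by
          simpa using Complex.conj_mul' z
        rw [h2, h2, ← Complex.ofReal_add] at h
        exact_mod_cast h⟩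
      invFun := fun w => ⟨⟨φ w, hφ w w.2⟩, fun i => by fin_cases i <;> simp [φ]⟩
      left_inv := fun A => by
        apply Subtype.ext
        apply Subtype.ext
        exact (stabE0_form A.2).symm
      right_inv := fun w => by
        apply Subtype.ext
        ext i
        fin_cases i <;> simp [φ]
      continuous_toFun := by
        refine Continuous.subtype_mk ?_ _
        refine (PiLp.continuous_toLp 2 _).comp (continuous_pi fun i => ?_)
        have hc : ∀ i j, Continuous fun A : stabE0 => A.1.1 i j := fun i j =>
          (continuous_subtype_val.comp continuous_subtype_val).matrix_elem i j
        fin_cases i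
        · exact hc 1 1
        · exact hc 2 1
      continuous_invFun := by
        refine Continuous.subtype_mk (Continuous.subtype_mk ?_ _) _
        refine continuous_matrix fun i j => ?_
        fin_cases i <;> fin_cases j <;> simp [φ] <;> fun_prop }
  exact Φ.toHomotopyEquiv.simplyConnectedSpace

theorem norm_eq_one_iff_dotProduct (v : EuclideanSpace ℂ (Fin 3)) :
    ‖v‖ = 1 ↔ v.ofLp ⬝ᵥ star v.ofLp = 1 := by
  rw [EuclideanSpace.norm_eq, Real.sqrt_eq_one]
  have h2 : ∀ z : ℂ, z * star z = ((‖z‖ ^ 2 : ℝ) : ℂ) := fun z => by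
    simpa using Complex.mul_conj' z
  simp only [dotProduct, Pi.star_apply, h2]
  rw [← Complex.ofReal_sum, ← Complex.ofReal_one, Complex.ofReal_inj]

/-- The first vector of the standard basis, as a point of the unit sphere. -/
noncomputable def e0Sphere : Metric.sphere (0 : EuclideanSpace ℂ (Fin 3)) 1 :=
  ⟨EuclideanSpace.single 0 1, by simp⟩

theorem eq_e0Sphere_iff (v : Metric.sphere (0 : EuclideanSpace ℂ (Fin 3)) 1) :
    v = e0Sphere ↔ v.1 0 = 1 := by
  refine ⟨fun h => by rw [h]; simp [e0Sphere], fun h => ?_⟩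
  have hv : ‖v.1‖ = 1 := by simp
  rw [EuclideanSpace.norm_eq, Real.sqrt_eq_one, Fin.sum_univ_three, h] at hv
  have h1 : ‖v.1 1‖ ^ 2 = 0 := by
    have := sq_nonneg ‖v.1 1‖
    have := sq_nonneg ‖v.1 2‖
    simp at hv
    linarith
  have h2 : ‖v.1 2‖ ^ 2 = 0 := by
    have := sq_nonneg ‖v.1 1‖
    simp at hv
    linarith
  apply Subtype.ext
  ext i
  fin_cases i
  · simpa [e0Sphere] using h
  · simpa [e0Sphere] using h1
  · simpa [e0Sphere] using h2

theorem eq_neg_e0Sphere_iff (v : Metric.sphere (0 : EuclideanSpace ℂ (Fin 3)) 1) :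
    v = -e0Sphere ↔ 1 + v.1 0 = 0 := by
  rw [← neg_eq_iff_eq_neg, eq_e0Sphere_iff]
  change -(v.1 0) = 1 ↔ _
  rw [neg_eq_iff_eq_neg, add_comm, ← eq_neg_iff_add_eq_zero]

/-- The projection of `SU(3)` to the five-sphere. -/
noncomputable def firstCol (A : SU3) : Metric.sphere (0 : EuclideanSpace ℂ (Fin 3)) 1 :=
  ⟨WithLp.toLp 2 fun i => (A : M3) i 0, by
    rw [mem_sphere_zero_iff_norm, norm_eq_one_iff_dotProduct]
    exact A.firstCol_norm⟩

theorem continuous_coe_SU3 (i j : Fin 3) : Continuous fun A : SU3 => (A : M3) i j :=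
  continuous_subtype_val.matrix_elem i j

theorem continuous_firstCol : Continuous firstCol :=
  Continuous.subtype_mk ((PiLp.continuous_toLp 2 _).comp
    (continuous_pi fun i => continuous_coe_SU3 i 0)) _

theorem mul_apply_zero_of_mem_stabE0 (A : SU3) {k : SU3} (hk : k ∈ stabE0) (i : Fin 3) :
    ((A * k : SU3) : M3) i 0 = (A : M3) i 0 := by
  change ((A : M3) * (k : M3)) i 0 = _
  rw [mul_apply, Fin.sum_univ_three, hk 0, hk 1, hk 2]
  simp

theorem inv_mul_mem_stabE0 {A B : SU3} (h : ∀ i, (A : M3) i 0 = (B : M3) i 0) :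
    A⁻¹ * B ∈ stabE0 := by
  intro i
  change ((A⁻¹ : SU3) * (B : M3)) i 0 = _
  have h1 : ((A⁻¹ : SU3) * (B : M3)) i 0 = ((A⁻¹ : SU3) * (A : M3)) i 0 := by
    simp only [mul_apply, h]
  rw [h1, SU3.coe_inv, A.star_mul_self, one_apply, Pi.single_apply]

/-- The diagonal matrix with entries `-1, -1, 1`. -/
noncomputable def halfTurn : SU3 :=
  ⟨diagonal ![-1, -1, 1], by
    refine ⟨mem_unitaryGroup_iff.2 ?_, ?_⟩
    · rw [star_eq_conjTranspose, diagonal_conjTranspose, diagonal_mul_diagonal, ← diagonal_one]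
      congr 1
      ext i
      fin_cases i <;> simp
    · change (diagonal ![-1, -1, 1] : M3).det = 1
      rw [det_diagonal, Fin.prod_univ_three]
      simp⟩

theorem mul_halfTurn_apply_zero (A : SU3) (i : Fin 3) :
    ((A * halfTurn : SU3) : M3) i 0 = -(A : M3) i 0 := by
  change ((A : M3) * (diagonal ![-1, -1, 1] : M3)) i 0 = _
  simp [mul_diagonal]

theorem firstCol_mul_halfTurn (A : SU3) : firstCol (A * halfTurn) = -firstCol A := by
  apply Subtype.ext
  ext i
  exact mul_halfTurn_apply_zero A i

/-- The group `SU(3)` is simply connected.  It is the union of the sets of matrices with first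
column different from `e₀` and from `-e₀`; each of them is homeomorphic to the product of
a punctured five-sphere and of `SU(2)`. -/
instance : SimplyConnectedSpace SU3 := by
  obtain ⟨R, hRc, hR, -⟩ := exists_section_firstCol
  have hK : SimplyConnectedSpace stabE0 := simplyConnectedSpace_stabE0
  let S := Metric.sphere (0 : EuclideanSpace ℂ (Fin 3)) 1
  have hv1 : ∀ v : S, v.1.ofLp ⬝ᵥ star v.1.ofLp = 1 := fun v =>
    (norm_eq_one_iff_dotProduct v.1).1 (by simp)
  let R' : S → SU3 := fun v => R v.1.ofLp
  have hR'c : ContinuousOn R' {-e0Sphere}ᶜ := by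
    refine hRc.comp (Continuous.continuousOn ?_) fun v hv => ⟨hv1 v, fun h =>
      hv ((eq_neg_e0Sphere_iff v).2 h)⟩
    exact (PiLp.continuous_ofLp 2 _).comp continuous_subtype_val
  have hR' : ∀ v ∈ ({-e0Sphere}ᶜ : Set S), firstCol (R' v) = v := fun v hv => by
    apply Subtype.ext
    ext i
    exact hR _ (hv1 v) (fun h => hv ((eq_neg_e0Sphere_iff v).2 h)) i
  have hcol : ∀ {A B : SU3}, firstCol A = firstCol B → ∀ i, (A : M3) i 0 = (B : M3) i 0 :=
    fun h i => congrFun (congrArg (fun v : S => v.1.ofLp) h) i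
  have hmul : ∀ (A : SU3) {k : SU3}, k ∈ stabE0 → firstCol (A * k) = firstCol A := by
    intro A k hk
    apply Subtype.ext
    ext i
    exact mul_apply_zero_of_mem_stabE0 A hk i
  let Y : Set S := {-e0Sphere}ᶜ
  let U : Set SU3 := firstCol ⁻¹' Y
  -- over the complement of `-e₀`, the section `R` trivializes the projection to the first column
  let Φ : U ≃ₜ Y × stabE0 :=
    { toFun := fun A => (⟨firstCol A.1, A.2⟩, ⟨(R' (firstCol A.1))⁻¹ * A.1,
        inv_mul_mem_stabE0 (hcol (hR' _ A.2))⟩)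
      invFun := fun p => ⟨R' p.1.1 * p.2.1, by
        change firstCol _ ∈ Y
        rw [hmul _ p.2.2, hR' _ p.1.2]
        exact p.1.2⟩
      left_inv := fun A => Subtype.ext (mul_inv_cancel_left _ _)
      right_inv := fun p => by
        have h : firstCol (R' p.1.1 * p.2.1) = p.1.1 := by rw [hmul _ p.2.2, hR' _ p.1.2]
        apply Prod.ext
        · exact Subtype.ext h
        · apply Subtype.ext
          change (R' (firstCol (R' p.1.1 * p.2.1)))⁻¹ * (R' p.1.1 * p.2.1) = _
          rw [h, inv_mul_cancel_left]
      continuous_toFun := by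
        have h1 : Continuous fun A : U => firstCol A.1 :=
          continuous_firstCol.comp continuous_subtype_val
        refine (h1.subtype_mk _).prodMk (Continuous.subtype_mk ?_ _)
        exact (hR'c.comp_continuous h1 fun A => A.2).inv.mul continuous_subtype_val
      continuous_invFun := by
        refine Continuous.subtype_mk ?_ _
        exact (hR'c.comp_continuous (continuous_subtype_val.comp continuous_fst)
          fun p => p.1.2).mul (continuous_subtype_val.comp continuous_snd) }
  have hrank : 2 < Module.finrank ℝ (EuclideanSpace ℂ (Fin 3)) := by
    rw [finrank_real_of_complex]; simp
  have hYc : ContractibleSpace Y := by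
    have hn : ‖((-e0Sphere : S) : EuclideanSpace ℂ (Fin 3))‖ = 1 := by simp
    have e1 := (stereographic hn).toHomeomorphSourceTarget
    have e2 : ((stereographic hn).target) ≃ₜ (ℝ ∙ ((-e0Sphere : S) : EuclideanSpace ℂ (Fin 3)))ᗮ :=
      (Homeomorph.setCongr (stereographic_target hn)).trans (Homeomorph.Set.univ _)
    have e3 : Y ≃ₜ (stereographic hn).source :=
      Homeomorph.setCongr (stereographic_source hn).symm
    exact (e3.trans (e1.trans e2)).contractibleSpace
  have hU : IsSimplyConnected U := by
    obtain ⟨c⟩ := ContractibleSpace.hequiv_unit Y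
    exact ((Φ.toHomotopyEquiv.trans (c.prodCongr (ContinuousMap.HomotopyEquiv.refl stabE0))).trans
      (Homeomorph.punitProd stabE0).toHomotopyEquiv).simplyConnectedSpace
  -- right multiplication by `halfTurn` negates the first column, so it carries the second set to `U`
  let τ : SU3 ≃ₜ SU3 := Homeomorph.mulRight halfTurn
  have hτ : τ ⁻¹' U = firstCol ⁻¹' {e0Sphere}ᶜ := by
    ext A
    change firstCol (A * halfTurn) ≠ -e0Sphere ↔ firstCol A ≠ e0Sphere
    rw [firstCol_mul_halfTurn, ne_eq, neg_inj]
  refine simplyConnectedSpace_of_union (U := U) (V := τ ⁻¹' U)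
    (isOpen_compl_singleton.preimage continuous_firstCol)
    (by rw [hτ]; exact isOpen_compl_singleton.preimage continuous_firstCol) ?_ hU
    (τ.isSimplyConnected_preimage.2 hU) ?_
  · rw [hτ, ← Set.preimage_union, ← Set.compl_inter]
    have : ({-e0Sphere} ∩ {e0Sphere} : Set S) = ∅ := by
      rw [Set.eq_empty_iff_forall_notMem]
      rintro x ⟨h1, h2⟩
      have h1' := (eq_neg_e0Sphere_iff x).1 h1
      rw [(eq_e0Sphere_iff x).1 h2] at h1'
      norm_num at h1'
    rw [this]
    simp
  -- the intersection is the part of the product over the sphere without two points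
  · have hp : IsPathConnected (((({e0Sphere}ᶜ : Set S) ∩ {-e0Sphere}ᶜ)) ×ˢ stabE0) :=
      (isPathConnected_sphere_compl_pair hrank e0Sphere).prod
        (isPathConnected_iff_pathConnectedSpace.2 inferInstance)
    have := hp.image' (f := fun p : S × SU3 => R' p.1 * p.2)
      ((hR'c.comp continuous_fst.continuousOn fun p hp => hp.1.2).mul continuous_snd.continuousOn)
    convert this using 1
    rw [hτ]
    ext A
    constructor
    · rintro ⟨h1, h2⟩
      exact ⟨(firstCol A, (R' (firstCol A))⁻¹ * A),
        ⟨⟨h2, h1⟩, inv_mul_mem_stabE0 (hcol (hR' _ h1))⟩, mul_inv_cancel_left _ _⟩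
    · rintro ⟨p, ⟨⟨h1, h2⟩, h3⟩, rfl⟩
      have h : firstCol (R' p.1 * p.2) = p.1 := by rw [hmul _ h3, hR' _ h2]
      refine ⟨?_, ?_⟩
      · change firstCol (R' p.1 * p.2) ∈ Y
        rw [h]; exact h2
      · change firstCol (R' p.1 * p.2) ∈ ({e0Sphere}ᶜ : Set S)
        rw [h]; exact h1

/-! ### Closed one-manifolds -/

section OneManifold

open Set

variable {M : Type*}

/-- The parameters of the arc `f` beyond which `f` stays in the arc `g`. -/
def upperOverlap (f g : ℝ → M) : Set ℝ := {s | Ici s ⊆ f ⁻¹' range g}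

/-- The parameters of the arc `f` before which `f` stays in the arc `g`. -/
def lowerOverlap (f g : ℝ → M) : Set ℝ := {s | Iic s ⊆ f ⁻¹' range g}

variable {f g : ℝ → M}

theorem lt_of_mem_overlaps (hfg : ¬ range f ⊆ range g) {s s' : ℝ} (hs : s ∈ lowerOverlap f g)
    (hs' : s' ∈ upperOverlap f g) : s < s' := by
  by_contra h
  refine hfg ?_
  rintro _ ⟨r, rfl⟩
  rcases le_total r s with h1 | h1
  · exact hs h1
  · exact hs' ((not_lt.1 h).trans h1)

theorem disjoint_overlaps (hfg : ¬ range f ⊆ range g) :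
    Disjoint (lowerOverlap f g) (upperOverlap f g) :=
  Set.disjoint_left.2 fun _ h h' => lt_irrefl _ (lt_of_mem_overlaps hfg h h')

variable [TopologicalSpace M]

theorem exists_coordChange (hf : IsOpenEmbedding f) (hg : IsOpenEmbedding g) :
    ∃ φ : ℝ → ℝ, ContinuousOn φ (f ⁻¹' range g) ∧ ∀ s ∈ f ⁻¹' range g, g (φ s) = f s := by
  let e := hg.toOpenPartialHomeomorph g
  refine ⟨fun s => e.symm (f s), ?_, fun s hs => ?_⟩
  · refine e.symm.continuousOn.comp hf.continuous.continuousOn fun s hs => ?_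
    simpa [e] using hs
  · exact e.right_inv (by simpa [e] using hs)

theorem isOpen_upperOverlap (hf : IsOpenEmbedding f) (hg : IsOpenEmbedding g) :
    IsOpen (upperOverlap f g) := by
  rw [Metric.isOpen_iff]
  intro s hs
  obtain ⟨ε, hε, h⟩ := Metric.isOpen_iff.1 (hg.isOpen_range.preimage hf.continuous) s
    (hs (mem_Ici.2 le_rfl))
  refine ⟨ε, hε, fun s' hs' r hr => ?_⟩
  rw [Real.ball_eq_Ioo] at h hs'
  by_cases hrs : s ≤ r
  · exact hs hrs
  · exact h ⟨lt_of_lt_of_le hs'.1 hr, by linarith [not_le.1 hrs]⟩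

theorem isOpen_lowerOverlap (hf : IsOpenEmbedding f) (hg : IsOpenEmbedding g) :
    IsOpen (lowerOverlap f g) := by
  rw [Metric.isOpen_iff]
  intro s hs
  obtain ⟨ε, hε, h⟩ := Metric.isOpen_iff.1 (hg.isOpen_range.preimage hf.continuous) s
    (hs (mem_Iic.2 le_rfl))
  refine ⟨ε, hε, fun s' hs' r hr => ?_⟩
  rw [Real.ball_eq_Ioo] at h hs'
  by_cases hrs : r ≤ s
  · exact hs hrs
  · exact h ⟨by linarith [not_le.1 hrs], lt_of_le_of_lt hr hs'.2⟩

/-- The overlap of two arcs, none of which contains the other, consists of ends of the arcs: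
the part of `g` inside a bounded piece of `f` with end points outside of `g` would be open
and closed in `g`. -/
theorem mem_overlaps [T2Space M] (hf : IsOpenEmbedding f) (hg : IsOpenEmbedding g)
    (hgf : ¬ range g ⊆ range f) {s : ℝ} (hs : f s ∈ range g) :
    s ∈ lowerOverlap f g ∪ upperOverlap f g := by
  by_contra h
  rw [mem_union, not_or] at h
  obtain ⟨s₁, hs₁, h₁⟩ := Set.not_subset.1 h.1
  obtain ⟨s₂, hs₂, h₂⟩ := Set.not_subset.1 h.2
  rw [mem_Iic] at hs₁
  rw [mem_Ici] at hs₂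
  have heq : g ⁻¹' (f '' Icc s₁ s₂) = g ⁻¹' (f '' Ioo s₁ s₂) := by
    ext t
    constructor
    · rintro ⟨r, hr, hrt⟩
      refine ⟨r, ⟨lt_of_le_of_ne hr.1 ?_, lt_of_le_of_ne hr.2 ?_⟩, hrt⟩
      · rintro rfl; exact h₁ ⟨t, hrt.symm⟩
      · rintro rfl; exact h₂ ⟨t, hrt.symm⟩
    · rintro ⟨r, hr, hrt⟩
      exact ⟨r, ⟨hr.1.le, hr.2.le⟩, hrt⟩
  have hcl : IsClopen (g ⁻¹' (f '' Icc s₁ s₂)) :=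
    ⟨((isCompact_Icc.image hf.continuous).isClosed).preimage hg.continuous,
      heq ▸ (hf.isOpenMap _ isOpen_Ioo).preimage hg.continuous⟩
  obtain ⟨t, ht⟩ := hs
  have hu := hcl.eq_univ ⟨t, s, ⟨hs₁, hs₂⟩, ht.symm⟩
  refine hgf ?_
  rintro _ ⟨r, rfl⟩
  obtain ⟨q, -, hq⟩ : r ∈ g ⁻¹' (f '' Icc s₁ s₂) := hu ▸ mem_univ r
  exact ⟨q, hq⟩

/-- The coordinate change from `f` to `g` maps a connected set into one of two disjoint open sets that
cover its image. -/
theorem coordChange_mem (hf : IsOpenEmbedding f) (hg : IsOpenEmbedding g) {S u v : Set ℝ}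
    (hS : IsPreconnected S) (hSg : S ⊆ f ⁻¹' range g) (hu : IsOpen u) (hv : IsOpen v)
    (huv : Disjoint u v) (hSuv : ∀ s ∈ S, ∀ t, f s = g t → t ∈ u ∪ v) {c d : ℝ} (hc : c ∈ S)
    (hcd : f c = g d) (hd : d ∈ u) : ∀ s ∈ S, ∀ t, f s = g t → t ∈ u := by
  obtain ⟨φ, hφ, hφg⟩ := exists_coordChange hf hg
  have him := hS.image φ (hφ.mono hSg)
  have hcd' : φ c = d := hg.injective ((hφg c (hSg hc)).trans hcd)
  have hne : (φ '' S ∩ u).Nonempty := ⟨d, ⟨c, hc, hcd'⟩, hd⟩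
  have hsub := IsPreconnected.subset_left_of_subset_union hu hv huv
    (by rintro _ ⟨s, hs, rfl⟩; exact hSuv s hs _ (hφg s (hSg hs)).symm)
    hne him
  intro s hs t hst
  have : φ s = t := hg.injective ((hφg s (hSg hs)).trans hst)
  exact this ▸ hsub ⟨s, hs, rfl⟩

/-- If the upper end of `f` lies in `g` and the lower end of `g` lies in `f`, then the coordinate
change preserves the orientation. -/
theorem coordChange_orientation [T2Space M] (hf : IsOpenEmbedding f) (hg : IsOpenEmbedding g)
    (hfg : ¬ range f ⊆ range g) (hgf : ¬ range g ⊆ range f) {c d : ℝ}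
    (hc : c ∈ upperOverlap f g) (hd : d ∈ lowerOverlap g f) (hcd : f c = g d) :
    (∀ s, c < s → ∃ t, d < t ∧ f s = g t) ∧ ∀ t, t < d → ∃ s, s < c ∧ g t = f s := by
  have hIoi : Ioi c ⊆ f ⁻¹' range g := fun s hs => hc (mem_Ici.2 (le_of_lt hs))
  have hIio : Iio d ⊆ g ⁻¹' range f := fun s hs => hd (mem_Iic.2 (le_of_lt hs))
  have hne : ∀ s, c < s → ∀ t, f s = g t → t ≠ d := by
    rintro s hs t hst rfl
    exact hs.ne (hf.injective (hcd.trans hst.symm))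
  have hne' : ∀ t, t < d → ∀ s, g t = f s → s ≠ c := by
    rintro t ht s hst rfl
    exact ht.ne (hg.injective (hst.trans hcd))
  have hdis : ∀ {x : ℝ}, Disjoint (Iio x) (Ioi x) := fun {x} =>
    Set.disjoint_left.2 fun y hy hy' => lt_asymm (mem_Iio.1 hy) (mem_Ioi.1 hy')
  have claim₁ : (∀ s ∈ Ioi c, ∀ t, f s = g t → t ∈ Iio d) ∨
      (∀ s ∈ Ioi c, ∀ t, f s = g t → t ∈ Ioi d) := by
    obtain ⟨t₀, ht₀⟩ := hIoi (show c + 1 ∈ Ioi c by simp)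
    rcases lt_or_gt_of_ne (hne (c + 1) (by simp) t₀ ht₀.symm) with h | h
    · left
      exact coordChange_mem hf hg isPreconnected_Ioi hIoi isOpen_Iio isOpen_Ioi
        hdis
        (fun s hs t hst => lt_or_gt_of_ne (hne s hs t hst)) (by simp) ht₀.symm h
    · right
      exact coordChange_mem hf hg isPreconnected_Ioi hIoi isOpen_Ioi isOpen_Iio
        hdis.symm
        (fun s hs t hst => (lt_or_gt_of_ne (hne s hs t hst)).symm) (by simp) ht₀.symm h
  have claim₂ : (∀ t ∈ Iio d, ∀ s, g t = f s → s ∈ Iio c) ∨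
      (∀ t ∈ Iio d, ∀ s, g t = f s → s ∈ Ioi c) := by
    obtain ⟨s₀, hs₀⟩ := hIio (show d - 1 ∈ Iio d by simp)
    rcases lt_or_gt_of_ne (hne' (d - 1) (by simp) s₀ hs₀.symm) with h | h
    · left
      exact coordChange_mem hg hf isPreconnected_Iio hIio isOpen_Iio isOpen_Ioi
        hdis
        (fun s hs t hst => lt_or_gt_of_ne (hne' s hs t hst)) (by simp) hs₀.symm h
    · right
      exact coordChange_mem hg hf isPreconnected_Iio hIio isOpen_Ioi isOpen_Iio
        hdis.symm
        (fun s hs t hst => (lt_or_gt_of_ne (hne' s hs t hst)).symm) (by simp) hs₀.symm h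
  -- if the orientation is reversed at `c`, then the part of `g` inside `f (Ioi s₁)` is open and closed
  rcases claim₁ with h₁ | h₁
  · exfalso
    have h₂ : ∀ t ∈ Iio d, ∀ s, g t = f s → s ∈ Ioi c := by
      refine claim₂.resolve_left fun h => ?_
      obtain ⟨t₀, ht₀⟩ := hIoi (show c + 1 ∈ Ioi c by simp)
      have := h t₀ (h₁ (c + 1) (by simp) t₀ ht₀.symm) (c + 1) ht₀
      simp at this
      linarith
    obtain ⟨_, ⟨s₁, rfl⟩, hs₁⟩ := Set.not_subset.1 hfg
    have hs₁c : s₁ < c := by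
      by_contra h
      exact hs₁ (hc (not_lt.1 h))
    -- `f (Ioi s₁)` meets `g` in a closed set, because `f s₁` is not in `g`
    have heq : g ⁻¹' (f '' Ioi s₁) = g ⁻¹' (f '' Icc s₁ c) ∪ Iic d := by
      ext t
      constructor
      · rintro ⟨r, hr, hrt⟩
        by_cases hrc : r ≤ c
        · exact Or.inl ⟨r, ⟨le_of_lt hr, hrc⟩, hrt⟩
        · exact Or.inr (mem_Iic.2 (le_of_lt (h₁ r (not_le.1 hrc) t hrt)))
      · rintro (⟨r, hr, hrt⟩ | h)
        · refine ⟨r, lt_of_le_of_ne hr.1 ?_, hrt⟩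
          rintro rfl
          exact hs₁ ⟨t, hrt.symm⟩
        · rcases eq_or_lt_of_le (mem_Iic.1 h) with rfl | h
          · exact ⟨c, hs₁c, hcd⟩
          · obtain ⟨s, hs⟩ := hIio h
            exact ⟨s, hs₁c.trans (h₂ t h s hs.symm), hs⟩
    have hcl : IsClopen (g ⁻¹' (f '' Ioi s₁)) :=
      ⟨heq ▸ (((isCompact_Icc.image hf.continuous).isClosed).preimage hg.continuous).union
        isClosed_Iic, (hf.isOpenMap _ isOpen_Ioi).preimage hg.continuous⟩
    have hu := hcl.eq_univ ⟨d, c, hs₁c, hcd⟩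
    refine hgf ?_
    rintro _ ⟨r, rfl⟩
    obtain ⟨q, -, hq⟩ : r ∈ g ⁻¹' (f '' Ioi s₁) := hu ▸ mem_univ r
    exact ⟨q, hq⟩
  · have h₂ : ∀ t ∈ Iio d, ∀ s, g t = f s → s ∈ Iio c := by
      refine claim₂.resolve_right fun h => ?_
      obtain ⟨s₀, hs₀⟩ := hIio (show d - 1 ∈ Iio d by simp)
      have := h₁ s₀ (h (d - 1) (by simp) s₀ hs₀.symm) (d - 1) hs₀
      simp at this
      linarith
    refine ⟨fun s hs => ?_, fun t ht => ?_⟩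
    · obtain ⟨t, ht⟩ := hIoi hs
      exact ⟨t, h₁ s hs t ht.symm, ht.symm⟩
    · obtain ⟨s, hs⟩ := hIio ht
      exact ⟨s, h₂ t ht s hs.symm, hs.symm⟩

/-- Coordinate changes between arcs are monotone. -/
theorem coordChange_between (hf : IsOpenEmbedding f) (hg : IsOpenEmbedding g) {x y z : ℝ}
    (hxy : x < y) (hyz : y < z) (h : Icc x z ⊆ f ⁻¹' range g) {a b c : ℝ} (ha : f x = g a)
    (hb : f y = g b) (hc : f z = g c) : (a < b ∧ b < c) ∨ (c < b ∧ b < a) := by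
  obtain ⟨φ, hφ, hφg⟩ := exists_coordChange hf hg
  have hx : x ∈ Icc x z := ⟨le_rfl, (hxy.trans hyz).le⟩
  have hy : y ∈ Icc x z := ⟨hxy.le, hyz.le⟩
  have hz : z ∈ Icc x z := ⟨(hxy.trans hyz).le, le_rfl⟩
  obtain rfl : φ x = a := hg.injective ((hφg x (h hx)).trans ha)
  obtain rfl : φ y = b := hg.injective ((hφg y (h hy)).trans hb)
  obtain rfl : φ z = c := hg.injective ((hφg z (h hz)).trans hc)
  have hinj : InjOn φ (Icc x z) := fun p hp q hq hpq =>
    hf.injective (by rw [← hφg p (h hp), ← hφg q (h hq), hpq])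
  rcases ContinuousOn.strictMonoOn_of_injOn_Icc' (hxy.trans hyz).le (hφ.mono h) hinj with hm | hm
  · exact Or.inl ⟨hm hx hy hxy, hm hy hz hyz⟩
  · exact Or.inr ⟨hm hy hz hyz, hm hx hy hxy⟩

/-- Invariance of domain in dimension one. -/
theorem isOpenMap_of_injective {h : ℝ → M} (hc : Continuous h) (hi : Function.Injective h)
    (harc : ∀ x, ∃ k : ℝ → M, IsOpenEmbedding k ∧ h x ∈ range k) : IsOpenMap h := by
  refine IsOpenMap.of_nhds_le fun x => ?_
  rw [Filter.le_map_iff]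
  intro N hN
  obtain ⟨k, hk, hxk⟩ := harc x
  have hN' : N ∩ h ⁻¹' range k ∈ 𝓝 x :=
    Filter.inter_mem hN ((hk.isOpen_range.preimage hc).mem_nhds hxk)
  obtain ⟨ε, hε, hεN⟩ := Metric.nhds_basis_closedBall.mem_iff.1 hN'
  rw [Real.closedBall_eq_Icc] at hεN
  let e := hk.toOpenPartialHomeomorph k
  have he : ∀ s ∈ Icc (x - ε) (x + ε), k (e.symm (h s)) = h s := fun s hs =>
    e.right_inv (by simpa [e] using (hεN hs).2)
  have hec : ContinuousOn (fun s => e.symm (h s)) (Icc (x - ε) (x + ε)) :=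
    e.symm.continuousOn.comp hc.continuousOn fun s hs => by simpa [e] using (hεN hs).2
  have hei : InjOn (fun s => e.symm (h s)) (Icc (x - ε) (x + ε)) := fun s hs t ht hst =>
    hi (by rw [← he s hs, ← he t ht]; exact congrArg k hst)
  have h1 : x - ε ≤ x + ε := by linarith
  have hxm : x ∈ Icc (x - ε) (x + ε) := ⟨by linarith, by linarith⟩
  have himg : (fun s => e.symm (h s)) '' Icc (x - ε) (x + ε) ∈ 𝓝 (e.symm (h x)) := by
    rcases hec.strictMonoOn_of_injOn_Icc' h1 hei with hm | hm
    · exact Filter.mem_of_superset (Icc_mem_nhds (hm ⟨le_rfl, h1⟩ hxm (by linarith))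
        (hm hxm ⟨h1, le_rfl⟩ (by linarith))) (intermediate_value_Icc h1 hec)
    · exact Filter.mem_of_superset (Icc_mem_nhds (hm hxm ⟨h1, le_rfl⟩ (by linarith))
        (hm ⟨le_rfl, h1⟩ hxm (by linarith))) (intermediate_value_Icc' h1 hec)
  have := hk.isOpenMap.image_mem_nhds himg
  rw [he x hxm] at this
  refine Filter.mem_of_superset this ?_
  rintro _ ⟨_, ⟨s, hs, rfl⟩, rfl⟩
  exact ⟨s, (hεN hs).1, (he s hs).symm⟩

end OneManifold

section OneManifold

open Set

variable {M : Type*} [TopologicalSpace M]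

/-- A parametrization of an embedded circle: a loop that is injective except for its end points. -/
structure IsCircleParam (p : I → M) : Prop where
  continuous : Continuous p
  closed : p 0 = p 1
  eq_or : ∀ s t, p s = p t → s = t ∨ (s = 0 ∧ t = 1) ∨ (s = 1 ∧ t = 0)

theorem ordConnected_upperOverlap {M : Type*} (f g : ℝ → M) : (upperOverlap f g).OrdConnected :=
  ⟨fun _ hx _ _ _ hz _ hr => hx (hz.1.trans hr)⟩

theorem ordConnected_lowerOverlap {M : Type*} (f g : ℝ → M) : (lowerOverlap f g).OrdConnected :=
  ⟨fun _ _ _ hy _ hz _ hr => hy (le_trans (mem_Iic.1 hr) hz.2)⟩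

/-- The circle that runs along `f` from `a` to `b` and then along `g` from `c` to `d`. -/
theorem isCircleParam_of_arcs {f g : ℝ → M} (hf : IsOpenEmbedding f) (hg : IsOpenEmbedding g)
    {a b c d : ℝ} (hab : a < b) (hcd : c < d) (hbc : f b = g c) (had : f a = g d)
    (hcross : ∀ s ∈ Icc a b, ∀ t ∈ Icc c d, f s = g t → (s = b ∧ t = c) ∨ (s = a ∧ t = d)) :
    ∃ p : I → M, IsCircleParam p ∧ range p = f '' Icc a b ∪ g '' Icc c d := by
  set h : ℝ → M := fun x => if x ≤ b - a then f (a + x) else g (c + (x - (b - a))) with hh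
  set l : ℝ := (b - a) + (d - c) with hl
  have hlpos : 0 < l := by linarith
  have hcont : Continuous h := by
    refine Continuous.if_le ?_ ?_ continuous_id continuous_const ?_
    · exact hf.continuous.comp (by fun_prop)
    · exact hg.continuous.comp (by fun_prop)
    · intro x hx
      rw [hx, sub_self, add_zero, ← hbc]
      congr 1
      ring
  have hinj : ∀ x y, 0 ≤ x → x ≤ y → y ≤ l → h x = h y → x = y ∨ (x = 0 ∧ y = l) := by
    intro x y hx hxy hy hxy'
    simp only [hh] at hxy'
    split_ifs at hxy' with h1 h2 h2
    · left
      have := hf.injective hxy'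
      linarith
    · rcases hcross _ ⟨by linarith, by linarith⟩ _ ⟨by linarith, by linarith⟩ hxy' with h3 | h3
      · left; linarith [h3.1, h3.2]
      · right; constructor <;> linarith [h3.1, h3.2]
    · linarith
    · left
      have := hg.injective hxy'
      linarith
  refine ⟨fun u => h (l * u), ⟨hcont.comp (by fun_prop), ?_, ?_⟩, ?_⟩
  · simp only [hh, Icc.coe_zero, Icc.coe_one, mul_zero, mul_one]
    rw [if_pos (by linarith), if_neg (by linarith), add_zero, had]
    congr 1
    linarith
  · intro s t hst
    have key : ∀ s t : I, s ≤ t → h (l * s) = h (l * t) → s = t ∨ (s = 0 ∧ t = 1) := by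
      intro s t hle hst
      rcases hinj (l * s) (l * t) (mul_nonneg hlpos.le s.2.1)
        (mul_le_mul_of_nonneg_left hle hlpos.le)
        (by simpa using mul_le_mul_of_nonneg_left t.2.2 hlpos.le) hst with h1 | h1
      · exact Or.inl (Subtype.ext (mul_left_cancel₀ hlpos.ne' h1))
      · refine Or.inr ⟨Subtype.ext ?_, Subtype.ext ?_⟩
        · simpa [hlpos.ne'] using h1.1
        · simpa [hlpos.ne'] using h1.2
    rcases le_total s t with hle | hle
    · rcases key s t hle hst with h1 | h1
      · exact Or.inl h1
      · exact Or.inr (Or.inl h1)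
    · rcases key t s hle hst.symm with h1 | h1
      · exact Or.inl h1.symm
      · exact Or.inr (Or.inr ⟨h1.2, h1.1⟩)
  · have hsurj : ∀ x, 0 ≤ x → x ≤ l → h x ∈ range fun u : I => h (l * u) := fun x h0 h1 =>
      ⟨⟨x / l, div_nonneg h0 hlpos.le, (div_le_one hlpos).2 h1⟩, by
        simp only
        rw [mul_div_cancel₀ _ hlpos.ne']⟩
    apply Subset.antisymm
    · rintro _ ⟨u, rfl⟩
      have hu : l * (u : ℝ) ≤ l := by simpa using mul_le_mul_of_nonneg_left u.2.2 hlpos.le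
      have hu0 : 0 ≤ l * (u : ℝ) := mul_nonneg hlpos.le u.2.1
      simp only [hh]
      split_ifs with h1
      · exact Or.inl ⟨_, ⟨by linarith, by linarith⟩, rfl⟩
      · exact Or.inr ⟨_, ⟨by linarith, by linarith⟩, rfl⟩
    · rintro _ (⟨s, hs, rfl⟩ | ⟨t, ht, rfl⟩)
      · have := hsurj (s - a) (by linarith [hs.1]) (by linarith [hs.2])
        simp only [hh] at this
        rwa [if_pos (by linarith [hs.2]), add_sub_cancel] at this
      · rcases eq_or_lt_of_le ht.1 with rfl | hlt
        · have := hsurj (b - a) (by linarith) (by linarith)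
          simp only [hh] at this
          rwa [if_pos le_rfl, add_sub_cancel, hbc] at this
        · have := hsurj ((t - c) + (b - a)) (by linarith) (by linarith [ht.2])
          simp only [hh] at this
          rwa [if_neg (by linarith), add_sub_cancel_right, add_sub_cancel] at this

/-- The union of two overlapping arcs is an arc if they overlap at one end only, and a circle if
they overlap at both ends. -/
theorem arc_or_circle_of_overlap [T2Space M] {f g : ℝ → M} (hf : IsOpenEmbedding f)
    (hg : IsOpenEmbedding g) (hfg : ¬ range f ⊆ range g) (hgf : ¬ range g ⊆ range f) {c d : ℝ}
    (hc : c ∈ upperOverlap f g) (hd : d ∈ lowerOverlap g f) (hcd : f c = g d) :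
    (∃ h : ℝ → M, IsOpenEmbedding h ∧ range h = range f ∪ range g) ∨
      ∃ p : I → M, IsCircleParam p ∧ range p = range f ∪ range g := by
  obtain ⟨o₁, o₂⟩ := coordChange_orientation hf hg hfg hgf hc hd hcd
  -- below `c`, inside the upper overlap, the arc `f` runs through the part of `g` below `d`
  have mon₁ : ∀ s ∈ upperOverlap f g, s < c → ∀ t, f s = g t → t < d := by
    intro s hs hsc t hst
    obtain ⟨e, he, hce⟩ := o₁ (c + 1) (by linarith)
    rcases coordChange_between hf hg hsc (by linarith : c < c + 1) (fun r hr => hs hr.1) hst hcd hce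
      with h | h
    · exact h.1
    · linarith [h.1]
  have hA : ∀ s t, f s = g t → s ∈ lowerOverlap f g ∨ s ∈ upperOverlap f g := fun s t hst =>
    mem_overlaps hf hg hgf ⟨t, hst.symm⟩
  have hB : ∀ s t, f s = g t → t ∈ lowerOverlap g f ∨ t ∈ upperOverlap g f := fun s t hst =>
    mem_overlaps hg hf hfg ⟨s, hst⟩
  -- if the other ends overlap, too, at `f s' = g t'`, then the arcs between these points form a circle
  by_cases hemp : ∃ s', s' ∈ lowerOverlap f g
  · right
    obtain ⟨s', hs'⟩ := hemp
    obtain ⟨t', ht'⟩ := hs' (mem_Iic.2 le_rfl)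
    have pR : ∀ {f g : ℝ → M}, IsPreconnected (upperOverlap f g) := fun {f g} =>
      (ordConnected_upperOverlap f g).isPreconnected
    have pL : ∀ {f g : ℝ → M}, IsPreconnected (lowerOverlap f g) := fun {f g} =>
      (ordConnected_lowerOverlap f g).isPreconnected
    have sR : ∀ {f g : ℝ → M}, upperOverlap f g ⊆ f ⁻¹' range g := fun {f g} s hs =>
      hs (mem_Ici.2 le_rfl)
    have sL : ∀ {f g : ℝ → M}, lowerOverlap f g ⊆ f ⁻¹' range g := fun {f g} s hs =>
      hs (mem_Iic.2 le_rfl)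
    -- each overlap of `f` corresponds to one overlap of `g`, by connectedness
    have t₁ := coordChange_mem hf hg pR sR (isOpen_lowerOverlap hg hf) (isOpen_upperOverlap hg hf)
      (disjoint_overlaps hgf) (fun s _ t hst => hB s t hst) hc hcd hd
    have t₂ := coordChange_mem hg hf pL sL (isOpen_upperOverlap hf hg) (isOpen_lowerOverlap hf hg)
      (disjoint_overlaps hfg).symm (fun s _ t hst => (hA t s hst.symm).symm) hd hcd.symm hc
    have ht'B : t' ∈ upperOverlap g f := by
      refine (hB s' t' ht'.symm).resolve_left fun h => ?_
      exact Set.disjoint_left.1 (disjoint_overlaps hfg) hs' (t₂ t' h s' ht')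
    obtain ⟨q₁, q₂⟩ := coordChange_orientation hg hf hgf hfg ht'B hs' ht'
    have t₃ := coordChange_mem hf hg pL sL (isOpen_upperOverlap hg hf) (isOpen_lowerOverlap hg hf)
      (disjoint_overlaps hgf).symm (fun s _ t hst => (hB s t hst).symm) hs' ht'.symm ht'B
    have t₄ := coordChange_mem hg hf pR sR (isOpen_lowerOverlap hf hg) (isOpen_upperOverlap hf hg)
      (disjoint_overlaps hfg) (fun s _ t hst => hA t s hst.symm) ht'B ht' hs'
    have mon₂ : ∀ s ∈ lowerOverlap f g, s' < s → ∀ t, f s = g t → t' < t := by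
      intro s hs hsc t hst
      obtain ⟨e, he, hce⟩ := q₂ (s' - 1) (by linarith)
      rcases coordChange_between hf hg (by linarith : s' - 1 < s') hsc (fun r hr => hs hr.2) hce
        ht'.symm hst with h | h
      · exact h.2
      · linarith [h.2]
    have hs'c : s' < c := lt_of_mem_overlaps hfg hs' hc
    have hdt' : d < t' := lt_of_mem_overlaps hgf hd ht'B
    obtain ⟨p, hp, hpr⟩ := isCircleParam_of_arcs hf hg hs'c hdt' hcd ht'.symm (by
      intro s hs t ht hst
      rcases hA s t hst with h | h
      · right
        rcases eq_or_lt_of_le hs.1 with rfl | hlt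
        · exact ⟨rfl, hg.injective (hst.symm.trans ht'.symm)⟩
        · exact absurd (mon₂ s h hlt t hst) (not_lt.2 ht.2)
      · left
        rcases eq_or_lt_of_le hs.2 with rfl | hlt
        · exact ⟨rfl, hg.injective (hst.symm.trans hcd)⟩
        · exact absurd (mon₁ s h hlt t hst) (not_lt.2 ht.1))
    refine ⟨p, hp, hpr.trans (Subset.antisymm (union_subset_union (image_subset_range _ _)
      (image_subset_range _ _)) ?_)⟩
    rintro _ (⟨s, rfl⟩ | ⟨t, rfl⟩)
    · by_cases h1 : s' ≤ s
      · by_cases h2 : s ≤ c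
        · exact Or.inl ⟨s, ⟨h1, h2⟩, rfl⟩
        · obtain ⟨t, ht, hst⟩ := o₁ s (not_le.1 h2)
          have hs : s ∈ upperOverlap f g := fun r hr => hc ((not_le.1 h2).le.trans hr)
          exact Or.inr ⟨t, ⟨ht.le, (lt_of_mem_overlaps hgf (t₁ s hs t hst) ht'B).le⟩, hst.symm⟩
      · obtain ⟨t, ht, hst⟩ := q₂ s (not_le.1 h1)
        have hs : s ∈ lowerOverlap f g := fun r hr =>
          hs' (mem_Iic.2 ((mem_Iic.1 hr).trans (not_le.1 h1).le))
        exact Or.inr ⟨t, ⟨(lt_of_mem_overlaps hgf hd (t₃ s hs t hst)).le, ht.le⟩, hst.symm⟩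
    · by_cases h1 : d ≤ t
      · by_cases h2 : t ≤ t'
        · exact Or.inr ⟨t, ⟨h1, h2⟩, rfl⟩
        · obtain ⟨s, hs, hst⟩ := q₁ t (not_le.1 h2)
          have ht : t ∈ upperOverlap g f := fun r hr => ht'B ((not_le.1 h2).le.trans hr)
          exact Or.inl ⟨s, ⟨hs.le, (lt_of_mem_overlaps hfg (t₄ t ht s hst) hc).le⟩, hst.symm⟩
      · obtain ⟨s, hs, hst⟩ := o₂ t (not_le.1 h1)
        have ht : t ∈ lowerOverlap g f := fun r hr =>
          hd (mem_Iic.2 ((mem_Iic.1 hr).trans (not_le.1 h1).le))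
        exact Or.inl ⟨s, ⟨(lt_of_mem_overlaps hfg hs' (t₂ t ht s hst)).le, hs.le⟩, hst.symm⟩
  · left
    have hup : ∀ s t, f s = g t → s ∈ upperOverlap f g := fun s t hst =>
      (hA s t hst).resolve_left fun h => hemp ⟨s, h⟩
    -- the arc that runs along `f` up to `c` and then along `g`
    set h : ℝ → M := fun x => if x ≤ c then f x else g (d + (x - c)) with hh
    have hrange : range h = range f ∪ range g := by
      apply Subset.antisymm
      · rintro _ ⟨x, rfl⟩
        simp only [hh]
        split_ifs
        · exact Or.inl ⟨_, rfl⟩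
        · exact Or.inr ⟨_, rfl⟩
      · have hg' : ∀ t, d < t → g t ∈ range h := fun t ht => ⟨t - d + c, by
          simp only [hh]
          rw [if_neg (by linarith), add_sub_cancel_right, add_sub_cancel]⟩
        have hf' : ∀ s, s ≤ c → f s ∈ range h := fun s hs => ⟨s, by simp only [hh, if_pos hs]⟩
        rintro _ (⟨s, rfl⟩ | ⟨t, rfl⟩)
        · by_cases h1 : s ≤ c
          · exact hf' s h1
          · obtain ⟨t, ht, hst⟩ := o₁ s (not_le.1 h1)
            exact hst ▸ hg' t ht
        · rcases lt_trichotomy t d with h1 | rfl | h1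
          · obtain ⟨s, hs, hst⟩ := o₂ t h1
            exact hst ▸ hf' s hs.le
          · exact hcd ▸ hf' c le_rfl
          · exact hg' t h1
    have hcont : Continuous h := by
      refine Continuous.if_le hf.continuous ?_ continuous_id continuous_const fun x hx => ?_
      · exact hg.continuous.comp (by fun_prop)
      · rw [hx, sub_self, add_zero, ← hcd]
    have hcross : ∀ x y, x ≤ c → c < y → f x ≠ g (d + (y - c)) := by
      intro x y hx hy hxy
      rcases eq_or_lt_of_le hx with rfl | hlt
      · have := hg.injective (hcd.symm.trans hxy)
        linarith
      · linarith [mon₁ x (hup x _ hxy) hlt _ hxy]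
    have hinj : Function.Injective h := by
      intro x y hxy
      simp only [hh] at hxy
      split_ifs at hxy with h1 h2 h2
      · exact hf.injective hxy
      · exact absurd hxy (hcross x y h1 (not_le.1 h2))
      · exact absurd hxy.symm (hcross y x h2 (not_le.1 h1))
      · have := hg.injective hxy
        linarith
    refine ⟨h, IsOpenEmbedding.of_continuous_injective_isOpenMap hcont hinj
      (isOpenMap_of_injective hcont hinj fun x => ?_), hrange⟩
    have : h x ∈ range f ∪ range g := hrange ▸ mem_range_self x
    rcases this with h1 | h1
    · exact ⟨f, hf, h1⟩
    · exact ⟨g, hg, h1⟩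

/-- The union of two overlapping arcs is an arc or a circle.  After a change of orientation, the upper
end of `f` overlaps the lower end of `g`. -/
theorem arc_or_circle [T2Space M] {f g : ℝ → M} (hf : IsOpenEmbedding f)
    (hg : IsOpenEmbedding g) (hfg : ¬ range f ⊆ range g) (hgf : ¬ range g ⊆ range f)
    (hne : (range f ∩ range g).Nonempty) :
    (∃ h : ℝ → M, IsOpenEmbedding h ∧ range h = range f ∪ range g) ∨
      ∃ p : I → M, IsCircleParam p ∧ range p = range f ∪ range g := by
  obtain ⟨_, ⟨s, rfl⟩, ⟨t, hts⟩⟩ := hne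
  have hneg : ∀ f : ℝ → M, range (fun x => f (-x)) = range f := fun f =>
    (neg_surjective (G := ℝ)).range_comp f
  have hemb : ∀ {f : ℝ → M}, IsOpenEmbedding f → IsOpenEmbedding fun x => f (-x) := fun hf =>
    hf.comp (Homeomorph.neg ℝ).isOpenEmbedding
  have e1 : ∃ f' : ℝ → M, IsOpenEmbedding f' ∧ range f' = range f ∧ ∃ s', f' s' = f s ∧
      s' ∈ upperOverlap f' g := by
    rcases mem_overlaps hf hg hgf ⟨t, hts⟩ with h | h
    · exact ⟨_, hemb hf, hneg f, -s, by simp, fun r hr =>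
        h (mem_Iic.2 (by linarith [mem_Ici.1 hr]))⟩
    · exact ⟨f, hf, rfl, s, rfl, h⟩
  have e2 : ∃ g' : ℝ → M, IsOpenEmbedding g' ∧ range g' = range g ∧ ∃ t', g' t' = g t ∧
      t' ∈ lowerOverlap g' f := by
    rcases mem_overlaps hg hf hfg ⟨s, hts.symm⟩ with h | h
    · exact ⟨g, hg, rfl, t, rfl, h⟩
    · exact ⟨_, hemb hg, hneg g, -t, by simp, fun r hr =>
        h (mem_Ici.2 (by linarith [mem_Iic.1 hr]))⟩
  obtain ⟨f', hf', hfr, s', hs', hsm⟩ := e1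
  obtain ⟨g', hg', hgr, t', ht', htm⟩ := e2
  rw [← hfr, ← hgr]
  rw [← hfr, ← hgr] at hfg hgf
  refine arc_or_circle_of_overlap hf' hg' hfg hgf (c := s') (d := t') ?_ ?_ ?_
  · simpa only [upperOverlap, hgr] using hsm
  · simpa only [lowerOverlap, hfr] using htm
  · rw [hs', ht', hts]

/-- Classification of closed one-manifolds: in a compact Hausdorff space that is covered by open
arcs, every connected component is a circle. -/
theorem exists_isCircleParam [T2Space M] [CompactSpace M]
    (harc : ∀ x : M, ∃ f : ℝ → M, IsOpenEmbedding f ∧ x ∈ range f) (x₀ : M) :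
    ∃ p : I → M, IsCircleParam p ∧ range p = connectedComponent x₀ := by
  classical
  choose k hk hxk using harc
  obtain ⟨T, hT⟩ := isCompact_univ.elim_finite_subcover (fun x => range (k x))
    (fun x => (hk x).isOpen_range) fun x _ => mem_iUnion.2 ⟨x, hxk x⟩
  let N : Set M → ℕ := fun S => (T.filter fun x => range (k x) ⊆ S).card
  have hNT : ∀ S, N S ≤ T.card := fun S => Finset.card_filter_le _ _
  -- an arc through `x₀` containing as many arcs of the finite cover as possible
  obtain ⟨f, ⟨hf, hx₀⟩, hmax⟩ : ∃ f : ℝ → M, (IsOpenEmbedding f ∧ x₀ ∈ range f) ∧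
      ∀ g : ℝ → M, IsOpenEmbedding g ∧ x₀ ∈ range g → N (range g) ≤ N (range f) := by
    let P : ℕ → Prop := fun n => ∃ f : ℝ → M, (IsOpenEmbedding f ∧ x₀ ∈ range f) ∧ N (range f) = n
    have hP : ∃ n, P n := ⟨_, k x₀, ⟨hk x₀, hxk x₀⟩, rfl⟩
    obtain ⟨n, hn⟩ := hP
    have hn' : n ≤ T.card := by
      obtain ⟨f, -, rfl⟩ := hn
      exact hNT _
    obtain ⟨f, hf, hfN⟩ := Nat.findGreatest_spec (P := P) hn' hn
    exact ⟨f, hf, fun g hg => hfN ▸ Nat.le_findGreatest (hNT _) ⟨g, hg, rfl⟩⟩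
  -- the line is not compact, so some arc `k y` of the cover contains a limit point of `f` outside of `f`
  have hncl : ¬ IsClosed (range f) := by
    intro h
    have : CompactSpace (range f) := isCompact_iff_compactSpace.1 h.isCompact
    have := hf.isEmbedding.toHomeomorph.symm.compactSpace
    exact not_compactSpace_iff.2 inferInstance this
  obtain ⟨x, hxc, hxf⟩ : ∃ x, x ∈ closure (range f) ∧ x ∉ range f := by
    by_contra h
    push Not at h
    exact hncl (isClosed_of_closure_subset h)
  obtain ⟨y, hyT, hxy⟩ : ∃ y ∈ T, x ∈ range (k y) := by simpa using hT (mem_univ x)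
  have hne : (range f ∩ range (k y)).Nonempty := by
    rw [inter_comm]
    exact mem_closure_iff.1 hxc _ (hk y).isOpen_range hxy
  have hlt : ∀ S : Set M, range f ⊆ S → range (k y) ⊆ S → N (range f) < N S := by
    intro S h1 h2
    refine Finset.card_lt_card (Finset.ssubset_iff_of_subset ?_ |>.2 ⟨y, ?_, ?_⟩)
    · exact fun z hz => by
        rw [Finset.mem_filter] at hz ⊢
        exact ⟨hz.1, hz.2.trans h1⟩
    · exact Finset.mem_filter.2 ⟨hyT, h2⟩
    · intro h
      exact hxf ((Finset.mem_filter.1 h).2 hxy)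
  have hfk : ¬ range f ⊆ range (k y) := fun h =>
    absurd (hmax _ ⟨hk y, h hx₀⟩) (not_le.2 (hlt _ h Subset.rfl))
  -- by maximality, the union of `f` and `k y` is not an arc
  rcases arc_or_circle hf (hk y) hfk (fun h => hxf (h hxy)) hne with ⟨h, hh, hr⟩ | ⟨p, hp, hr⟩
  · exact absurd (hmax h ⟨hh, hr ▸ Or.inl hx₀⟩)
      (not_le.2 (hlt _ (hr ▸ subset_union_left) (hr ▸ subset_union_right)))
  · refine ⟨p, hp, Subset.antisymm ?_ ?_⟩
    · exact (isPreconnected_range hp.continuous).subset_connectedComponent (hr ▸ Or.inl hx₀)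
    · exact IsClopen.connectedComponent_subset ⟨(isCompact_range hp.continuous).isClosed,
        hr ▸ hf.isOpen_range.union (hk y).isOpen_range⟩ (hr ▸ Or.inl hx₀)

/-- Every point lies in the image of a ball in a chart, reparametrized by the line. -/
theorem exists_open_arc [ChartedSpace ℝ M] (x : M) :
    ∃ f : ℝ → M, IsOpenEmbedding f ∧ x ∈ range f := by
  let e := chartAt ℝ x
  have hx : e x ∈ e.target := e.map_source (mem_chart_source ℝ x)
  obtain ⟨r, hr, hrt⟩ := Metric.isOpen_iff.1 e.open_target _ hx
  let b := OpenPartialHomeomorph.univBall (E := ℝ) (e x) r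
  have hbt : b.target = Metric.ball (e x) r := OpenPartialHomeomorph.univBall_target _ hr
  have hsrc : (b.trans e.symm).source = univ := by
    rw [OpenPartialHomeomorph.trans_source, OpenPartialHomeomorph.univBall_source, univ_inter,
      eq_univ_iff_forall]
    intro y
    have : b y ∈ b.target := b.map_source (by simp [b])
    exact hrt (hbt ▸ this)
  refine ⟨b.trans e.symm, OpenPartialHomeomorph.isOpenEmbedding _ hsrc, b.symm (e x), ?_⟩
  change e.symm (b (b.symm (e x))) = x
  rw [b.right_inv (by rw [hbt]; exact Metric.mem_ball_self hr),
    e.left_inv (mem_chart_source ℝ x)]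

end OneManifold

/-! ### Graphs of symmetric matrices -/

section RealMatrices

/-- Real `3 × 3` matrices. -/
abbrev MR : Type := Matrix (Fin 3) (Fin 3) ℝ

/-- The inclusion of real matrices into complex matrices. -/
def cx : MR →+* M3 := Complex.ofRealHom.mapMatrix

theorem cx_apply (S : MR) (i j : Fin 3) : cx S i j = (S i j : ℂ) := rfl

theorem det_cx (S : MR) : (cx S).det = (S.det : ℂ) := (RingHom.map_det Complex.ofRealHom S).symm

theorem star_cx (S : MR) : star (cx S) = cx Sᵀ := by
  ext i j
  simp [cx_apply, star_apply]

theorem cx_diagonal (c : Fin 3 → ℝ) : cx (diagonal c) = diagonal fun i => (c i : ℂ) := by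
  ext i j
  rw [cx_apply, diagonal_apply, diagonal_apply]
  split_ifs <;> simp

theorem cx_injective : Function.Injective cx := fun S T h => by
  ext i j
  have := congrFun (congrFun h i) j
  rw [cx_apply, cx_apply] at this
  exact_mod_cast this

theorem continuous_cx : Continuous cx :=
  continuous_matrix fun i j => Complex.continuous_ofReal.comp (continuous_id.matrix_elem i j)

/-- The matrix `1 + i S`, which maps `ℝ³` to the graph of `i S`. -/
noncomputable def gmat (S : MR) : M3 := 1 + Complex.I • cx S

theorem continuous_gmat : Continuous gmat :=
  continuous_const.add (continuous_cx.const_smul Complex.I)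

/-- The real part of `det (1 + i S)` is positive, its imaginary part vanishes, and `S` is symmetric
and invertible.  If `ℝ³` and the graph of `i S` form a graphical pair, then the condition that is
added here is the sign of the determinant; it holds if the pair is close. -/
structure PosGraph (S : MR) : Prop where
  symm : Sᵀ = S
  im_det : (gmat S).det.im = 0
  re_det : 0 < (gmat S).det.re
  det_ne : S.det ≠ 0

/-- There is an orthonormal basis of eigenvectors, the first eigenvalue is negative and
the other ones are positive. -/
def MatOneNeg (S : MR) : Prop :=
  ∃ (X : MR) (c : Fin 3 → ℝ), Xᵀ * X = 1 ∧ S = X * diagonal c * Xᵀ ∧ c 0 < 0 ∧ 0 < c 1 ∧ 0 < c 2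

theorem gmat_conj {X : MR} (hX : X * Xᵀ = 1) (S : MR) :
    gmat (X * S * Xᵀ) = cx X * gmat S * cx Xᵀ := by
  rw [gmat, gmat, mul_add, add_mul, mul_one, ← map_mul, hX, map_one, map_mul, map_mul,
    mul_smul_comm, smul_mul_assoc]

theorem det_conj {X : MR} (hX : X * Xᵀ = 1) (S : MR) : (X * S * Xᵀ).det = S.det := by
  rw [det_mul, det_mul, mul_right_comm, ← det_mul, hX, det_one, one_mul]

theorem det_gmat_conj {X : MR} (hX : X * Xᵀ = 1) (S : MR) :
    (gmat (X * S * Xᵀ)).det = (gmat S).det := by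
  rw [gmat_conj hX, det_mul, det_mul, mul_right_comm, ← det_mul, ← map_mul, hX, map_one, det_one,
    one_mul]

theorem gmat_diagonal (c : Fin 3 → ℝ) :
    gmat (diagonal c) = diagonal fun j => 1 + Complex.I * (c j : ℂ) := by
  rw [gmat, cx_diagonal, ← diagonal_one, ← diagonal_smul, diagonal_add]
  rfl

theorem det_gmat_diagonal (c : Fin 3 → ℝ) : (gmat (diagonal c)).det =
    ((1 - (c 0 * c 1 + c 1 * c 2 + c 0 * c 2) : ℝ) : ℂ) +
      ((c 0 + c 1 + c 2 - c 0 * c 1 * c 2 : ℝ) : ℂ) * Complex.I := by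
  rw [gmat_diagonal, det_diagonal, Fin.prod_univ_three]
  have := Complex.I_sq
  push_cast
  linear_combination ((c 0 : ℂ) * c 1 + c 1 * c 2 + c 0 * c 2 + c 0 * c 1 * c 2 * Complex.I) * this

theorem PosGraph.conj {X : MR} (hX : X * Xᵀ = 1) {S : MR} (h : PosGraph S) :
    PosGraph (X * S * Xᵀ) where
  symm := by rw [transpose_mul, transpose_mul, transpose_transpose, h.symm, mul_assoc]
  im_det := by rw [det_gmat_conj hX, h.im_det]
  re_det := by rw [det_gmat_conj hX]; exact h.re_det
  det_ne := by rw [det_conj hX]; exact h.det_ne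

theorem exists_diagonalization {S : MR} (h : Sᵀ = S) :
    ∃ (X : MR) (c : Fin 3 → ℝ), Xᵀ * X = 1 ∧ S = X * diagonal c * Xᵀ := by
  have hS : S.IsHermitian := by
    rw [IsHermitian, conjTranspose_eq_transpose_of_trivial, h]
  refine ⟨hS.eigenvectorUnitary, hS.eigenvalues, ?_, ?_⟩
  · have := mem_unitaryGroup_iff'.1 hS.eigenvectorUnitary.2
    rwa [star_eq_conjTranspose, conjTranspose_eq_transpose_of_trivial] at this
  · have := hS.spectral_theorem
    rw [Unitary.conjStarAlgAut_apply, star_eq_conjTranspose,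
      conjTranspose_eq_transpose_of_trivial] at this
    exact this

/-- The sum of three angles `θ_j ∈ (-π/2, π/2)` vanishes if and only if `∏ (1 + i tan θ_j)` is
positive; in this case the angles do not all have the same sign. -/
theorem exists_perm_signs {c : Fin 3 → ℝ} (him : c 0 + c 1 + c 2 - c 0 * c 1 * c 2 = 0)
    (hre : 0 < 1 - (c 0 * c 1 + c 1 * c 2 + c 0 * c 2)) (hdet : c 0 * c 1 * c 2 < 0) :
    ∃ i : Fin 3, c (Equiv.swap 0 i 0) < 0 ∧ 0 < c (Equiv.swap 0 i 1) ∧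
      0 < c (Equiv.swap 0 i 2) := by
  have h2 : (Equiv.swap (0 : Fin 3) 2) 1 = 1 := by decide
  have h1 : (Equiv.swap (0 : Fin 3) 1) 2 = 2 := by decide
  have h0 : c 0 ≠ 0 := by intro h; simp [h] at hdet
  have h1' : c 1 ≠ 0 := by intro h; simp [h] at hdet
  have h2' : c 2 ≠ 0 := by intro h; simp [h] at hdet
  rcases lt_or_gt_of_ne h0 with a | a <;> rcases lt_or_gt_of_ne h1' with b | b <;>
    rcases lt_or_gt_of_ne h2' with d | d
  · exfalso
    have hab : 0 < c 0 * c 1 := mul_pos_of_neg_of_neg a b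
    have hbd : 0 < c 1 * c 2 := mul_pos_of_neg_of_neg b d
    have had : 0 < c 0 * c 2 := mul_pos_of_neg_of_neg a d
    nlinarith
  · exact absurd (mul_pos (mul_pos_of_neg_of_neg a b) d) (not_lt.2 hdet.le)
  · exact absurd (mul_pos_of_neg_of_neg (mul_neg_of_neg_of_pos a b) d) (not_lt.2 hdet.le)
  · exact ⟨0, by simpa using a, by simpa using b, by simpa using d⟩
  · exact absurd (mul_pos_of_neg_of_neg (mul_neg_of_pos_of_neg a b) d) (not_lt.2 hdet.le)
  · exact ⟨1, by simpa using b, by simpa using a, by simpa [h1] using d⟩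
  · exact ⟨2, by simpa using d, by simpa [h2] using b, by simpa using a⟩
  · exact absurd (mul_pos (mul_pos a b) d) (not_lt.2 hdet.le)

theorem MatOneNeg.det_neg {S : MR} (h : MatOneNeg S) : S.det < 0 := by
  obtain ⟨X, c, hX, rfl, h0, h1, h2⟩ := h
  rw [det_conj (mul_eq_one_comm.1 hX), det_diagonal, Fin.prod_univ_three]
  exact mul_neg_of_neg_of_pos (mul_neg_of_neg_of_pos h0 h1) h2

theorem PosGraph.matOneNeg {S : MR} (h : PosGraph S) (hd : S.det < 0) : MatOneNeg S := by
  obtain ⟨X, c, hX, hS⟩ := exists_diagonalization h.symm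
  have hX' := mul_eq_one_comm.1 hX
  have him := h.im_det
  have hre := h.re_det
  rw [hS, det_gmat_conj hX', det_gmat_diagonal] at him hre
  rw [hS, det_conj hX', det_diagonal, Fin.prod_univ_three] at hd
  have hz : ∀ a b : ℝ, ((a : ℂ) + (b : ℂ) * Complex.I).re = a ∧
      ((a : ℂ) + (b : ℂ) * Complex.I).im = b := fun a b => by simp
  rw [(hz _ _).2] at him
  rw [(hz _ _).1] at hre
  obtain ⟨i, hi⟩ := exists_perm_signs him hre hd
  set τ := Equiv.swap (0 : Fin 3) i
  refine ⟨X.submatrix id τ, c ∘ τ, ?_, ?_, hi⟩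
  · rw [transpose_submatrix, ← submatrix_mul _ _ _ _ _ Function.bijective_id, hX,
      submatrix_one_equiv]
  · rw [hS, ← submatrix_diagonal_equiv, transpose_submatrix,
      ← submatrix_mul _ _ _ _ _ τ.bijective, ← submatrix_mul _ _ _ _ _ τ.bijective,
      submatrix_id_id]

theorem matOneNeg_iff {S : MR} (h : PosGraph S) : MatOneNeg S ↔ S.det < 0 :=
  ⟨MatOneNeg.det_neg, h.matOneNeg⟩

theorem MatOneNeg.eigenvector {X : MR} {c : Fin 3 → ℝ} (hX : Xᵀ * X = 1) (h1 : 0 < c 1)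
    (h2 : 0 < c 2) {x : Fin 3 → ℝ} {l : ℝ} (hl : l < 0)
    (hx : (X * diagonal c * Xᵀ) *ᵥ x = l • x) : ∃ a : ℝ, x = a • fun i => X i 0 := by
  have hX' := mul_eq_one_comm.1 hX
  set y := Xᵀ *ᵥ x with hy
  have hxy : x = X *ᵥ y := by rw [hy, mulVec_mulVec, hX', one_mulVec]
  have hyl : diagonal c *ᵥ y = l • y := by
    have := congrArg (fun v => Xᵀ *ᵥ v) hx
    simp only [mulVec_mulVec, mulVec_smul] at this
    rw [← mul_assoc, ← mul_assoc, hX, one_mul] at this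
    rw [hy, mulVec_mulVec, this]
  have hz : ∀ i, 0 < c i → y i = 0 := by
    intro i hi
    have := congrFun hyl i
    rw [mulVec_diagonal, Pi.smul_apply, smul_eq_mul] at this
    have h3 : (c i - l) * y i = 0 := by rw [sub_mul, this, sub_self]
    exact (mul_eq_zero.1 h3).resolve_left (by linarith)
  refine ⟨y 0, ?_⟩
  rw [hxy]
  ext i
  rw [mulVec, dotProduct, Fin.sum_univ_three, hz 1 h1, hz 2 h2]
  simp [mul_comm]

theorem det_smul_one_sub {X : MR} {c : Fin 3 → ℝ} (hX : Xᵀ * X = 1) (ξ : ℝ) :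
    (ξ • (1 : MR) - X * diagonal c * Xᵀ).det = (ξ - c 0) * (ξ - c 1) * (ξ - c 2) := by
  have hX' := mul_eq_one_comm.1 hX
  have : ξ • (1 : MR) - X * diagonal c * Xᵀ = X * diagonal (fun j => ξ - c j) * Xᵀ := by
    have h1 : diagonal (fun j => ξ - c j) = ξ • (1 : MR) - diagonal c := by
      rw [← diagonal_one, ← diagonal_smul, diagonal_sub]
      congr 1
      ext j
      simp
    rw [h1, mul_sub, sub_mul, mul_smul_comm, mul_one, smul_mul_assoc, hX']
  rw [this, det_conj hX', det_diagonal, Fin.prod_univ_three]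

/-- The negative eigenline depends continuously on the matrix.  The negative eigenvalue `l` is
continuous, because the characteristic polynomial changes sign there and has no other
negative root; and `S² - (tr S - l) S + (det S / l)` is a multiple of the projection
onto the eigenline. -/
theorem exists_continuousOn_eigenvector {B : Type*} [TopologicalSpace B] {S : B → MR} {U : Set B}
    {b₀ : B} (hU : U ∈ 𝓝 b₀) (hS : ContinuousOn S U) (hneg : ∀ b ∈ U, MatOneNeg (S b)) :
    ∃ U' ∈ 𝓝 b₀, U' ⊆ U ∧ ∃ x : B → Fin 3 → ℝ, ContinuousOn x U' ∧
      ∀ b ∈ U', x b ≠ 0 ∧ ∃ l : ℝ, l < 0 ∧ S b *ᵥ x b = l • x b := by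
  classical
  choose! X c hX hSX hc0 hc1 hc2 using hneg
  -- the characteristic polynomial is negative below `c b 0` and positive between `c b 0` and `0`
  have hlam : ContinuousOn (fun b => c b 0) U := by
    intro b hb
    have hdet : ∀ ξ : ℝ, ContinuousWithinAt (fun b => (ξ • (1 : MR) - S b).det) U b := fun ξ =>
      (Continuous.matrix_det (continuous_const.sub continuous_id)).continuousAt.comp_continuousWithinAt
        (hS b hb)
    have hval : ∀ b ∈ U, ∀ ξ : ℝ, (ξ • (1 : MR) - S b).det =
        (ξ - c b 0) * ((ξ - c b 1) * (ξ - c b 2)) := fun b hb ξ => by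
      conv_lhs => rw [hSX b hb]
      rw [det_smul_one_sub (hX b hb), mul_assoc]
    have hpos : ∀ b ∈ U, ∀ ξ : ℝ, ξ < 0 → 0 < (ξ - c b 1) * (ξ - c b 2) := fun b hb ξ hξ =>
      mul_pos_of_neg_of_neg (by linarith [hc1 b hb]) (by linarith [hc2 b hb])
    refine tendsto_order.2 ⟨fun a ha => ?_, fun a ha => ?_⟩
    · have ha0 : a < 0 := ha.trans (hc0 b hb)
      have h1 : (a • (1 : MR) - S b).det < 0 := by
        rw [hval b hb]
        exact mul_neg_of_neg_of_pos (sub_neg.2 ha) (hpos b hb a ha0)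
      filter_upwards [(hdet a).eventually (gt_mem_nhds h1), self_mem_nhdsWithin] with b' h2 hb'
      rw [hval b' hb'] at h2
      exact sub_neg.1 (neg_of_mul_neg_left h2 (hpos b' hb' a ha0).le)
    · obtain ⟨a', ha', ha'0⟩ := exists_between (lt_min ha (hc0 b hb))
      have ha'0' : a' < 0 := ha'0.trans_le (min_le_right _ _)
      have h1 : 0 < (a' • (1 : MR) - S b).det := by
        rw [hval b hb]
        exact mul_pos (sub_pos.2 ha') (hpos b hb a' ha'0')
      filter_upwards [(hdet a').eventually (lt_mem_nhds h1), self_mem_nhdsWithin] with b' h2 hb'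
      rw [hval b' hb'] at h2
      exact (sub_pos.1 (pos_of_mul_pos_left h2 (hpos b' hb' a' ha'0').le)).trans
        (ha'0.trans_le (min_le_left _ _))
  have hb₀ : b₀ ∈ U := mem_of_mem_nhds hU
  -- `(S - c₁) (S - c₂)`, expressed by the negative eigenvalue, the trace and the determinant
  let q : B → MR := fun b => S b * S b - ((S b).trace - c b 0) • S b +
    ((S b).det / c b 0) • (1 : MR)
  have hqc : ContinuousOn q U := by
    have htr : ContinuousOn (fun b => (S b).trace) U :=
      (Continuous.matrix_trace continuous_id).comp_continuousOn hS
    have hdt : ContinuousOn (fun b => (S b).det) U :=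
      (Continuous.matrix_det continuous_id).comp_continuousOn hS
    exact ((hS.mul hS).sub ((htr.sub hlam).smul hS)).add
      ((hdt.div hlam fun b hb => (hc0 b hb).ne).smul continuousOn_const)
  have hq : ∀ b ∈ U, q b = X b * diagonal (fun j =>
      (c b j - c b 1) * (c b j - c b 2)) * (X b)ᵀ := by
    intro b hb
    have hX' := mul_eq_one_comm.1 (hX b hb)
    have htr : (S b).trace = c b 0 + c b 1 + c b 2 := by
      rw [hSX b hb, trace_mul_comm, ← mul_assoc, hX b hb, one_mul, trace_diagonal,
        Fin.sum_univ_three]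
    have hdt : (S b).det / c b 0 = c b 1 * c b 2 := by
      rw [hSX b hb, det_conj hX', det_diagonal, Fin.prod_univ_three]
      field_simp [(hc0 b hb).ne]
    have hSS : S b * S b = X b * diagonal (fun j => c b j * c b j) * (X b)ᵀ := by
      conv_lhs => rw [hSX b hb]
      rw [mul_assoc, mul_assoc, ← mul_assoc (X b)ᵀ, ← mul_assoc (X b)ᵀ, hX b hb, one_mul,
        ← mul_assoc (diagonal _), diagonal_mul_diagonal, mul_assoc]
    have h1 : diagonal (fun j => (c b j - c b 1) * (c b j - c b 2)) =
        diagonal (fun j => c b j * c b j) - (c b 1 + c b 2) • diagonal (c b) +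
          (c b 1 * c b 2) • (1 : MR) := by
      rw [← diagonal_one, ← diagonal_smul, ← diagonal_smul, diagonal_sub, diagonal_add]
      congr 1
      ext j
      simp
      ring
    simp only [q]
    rw [htr, hdt, hSS, h1, mul_add, mul_sub, add_mul, sub_mul, mul_smul_comm, smul_mul_assoc,
      ← hSX b hb, mul_smul_comm, mul_one, smul_mul_assoc, hX']
    congr 3
    ring
  -- the vector `q b x₀` stays nonzero near `b₀`, because `q b₀` does not annihilate the eigenvector `x₀`
  let x₀ : Fin 3 → ℝ := fun i => X b₀ i 0
  let x : B → Fin 3 → ℝ := fun b => q b *ᵥ x₀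
  have hxc : ContinuousOn x U :=
    (Continuous.matrix_mulVec continuous_id continuous_const).comp_continuousOn hqc
  have hx₀ : x b₀ ≠ 0 := by
    have h1 : (X b₀)ᵀ *ᵥ x₀ = Pi.single 0 1 := by
      ext i
      have := congrFun (congrFun (hX b₀ hb₀) i) 0
      rw [mul_apply] at this
      rw [mulVec, dotProduct, this, one_apply, Pi.single_apply]
    have h2 : (X b₀)ᵀ *ᵥ x b₀ =
        Pi.single 0 ((c b₀ 0 - c b₀ 1) * (c b₀ 0 - c b₀ 2)) := by
      simp only [x]
      rw [hq b₀ hb₀, mulVec_mulVec, ← mul_assoc, ← mul_assoc, hX b₀ hb₀, one_mul,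
        ← mulVec_mulVec, h1]
      ext i
      rw [mulVec_diagonal, Pi.single_apply, Pi.single_apply]
      split_ifs with h
      · rw [h, mul_one]
      · rw [mul_zero]
    intro h3
    rw [h3, mulVec_zero] at h2
    have := congrFun h2 0
    rw [Pi.single_eq_same, Pi.zero_apply] at this
    have h4 := mul_pos_of_neg_of_neg (a := c b₀ 0 - c b₀ 1) (b := c b₀ 0 - c b₀ 2)
      (by linarith [hc0 b₀ hb₀, hc1 b₀ hb₀]) (by linarith [hc0 b₀ hb₀, hc2 b₀ hb₀])
    linarith
  refine ⟨U ∩ {b | x b ≠ 0}, Filter.inter_mem hU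
    ((hxc.continuousAt hU).eventually_ne hx₀), Set.inter_subset_left, x,
    hxc.mono Set.inter_subset_left, fun b hb => ⟨hb.2, c b 0, hc0 b hb.1, ?_⟩⟩
  have h1 : S b * q b = c b 0 • q b := by
    rw [hq b hb.1]
    conv_lhs => rw [hSX b hb.1]
    rw [mul_assoc, mul_assoc, ← mul_assoc (X b)ᵀ, ← mul_assoc (X b)ᵀ, hX b hb.1, one_mul,
      ← mul_assoc (diagonal _), diagonal_mul_diagonal, ← mul_assoc, ← smul_mul_assoc,
      ← mul_smul_comm, ← diagonal_smul]
    congr 3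
    ext j
    fin_cases j <;> simp
  simp only [x]
  rw [mulVec_mulVec, h1, smul_mulVec]

end RealMatrices

/-! ### Real subspaces spanned by complex matrices with respect to a frame -/

section Frames

variable {W : Type*} [NormedAddCommGroup W] [InnerProductSpace ℂ W]

/-- The vector with complex coordinates `v` with respect to `e`. -/
noncomputable def comb (e : Fin 3 → W) : (Fin 3 → ℂ) →ₗ[ℂ] W := Fintype.linearCombination ℂ e

theorem comb_apply (e : Fin 3 → W) (v : Fin 3 → ℂ) : comb e v = ∑ i, v i • e i := rfl

/-- A real vector as a complex vector. -/
def rv (x : Fin 3 → ℝ) : Fin 3 → ℂ := fun i => (x i : ℂ)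

theorem cx_mulVec_rv (S : MR) (x : Fin 3 → ℝ) : cx S *ᵥ rv x = rv (S *ᵥ x) := by
  ext i
  simp [mulVec, dotProduct, rv, cx_apply]

theorem gmat_mulVec_rv (S : MR) (x : Fin 3 → ℝ) :
    gmat S *ᵥ rv x = rv x + Complex.I • rv (S *ᵥ x) := by
  rw [gmat, add_mulVec, one_mulVec, smul_mulVec, cx_mulVec_rv]

theorem rv_add_I_smul_rv_inj {x y x' y' : Fin 3 → ℝ}
    (h : rv x + Complex.I • rv y = rv x' + Complex.I • rv y') : x = x' ∧ y = y' := by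
  constructor <;> ext i
  · have := congrArg Complex.re (congrFun h i)
    simpa [rv] using this
  · have := congrArg Complex.im (congrFun h i)
    simpa [rv] using this

theorem rv_injective : Function.Injective rv := fun x y h => by
  ext i
  have := congrFun h i
  simpa [rv] using this

theorem rv_zero : rv 0 = 0 := by ext i; simp [rv]

/-- The frame whose `j`-th vector has the `j`-th column of `A` as coordinates. -/
noncomputable def frameMul (e : Fin 3 → W) (A : M3) : Fin 3 → W := fun j => ∑ i, A i j • e i

theorem frameMul_one (e : Fin 3 → W) : frameMul e 1 = e := by
  ext j
  simp [frameMul, one_apply]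

theorem frameMul_frameMul (e : Fin 3 → W) (A B : M3) :
    frameMul (frameMul e A) B = frameMul e (A * B) := by
  ext j
  simp only [frameMul, Finset.smul_sum, mul_apply, Finset.sum_smul, smul_smul]
  rw [Finset.sum_comm]
  exact Finset.sum_congr rfl fun i _ => Finset.sum_congr rfl fun k _ => by rw [mul_comm]

theorem comb_frameMul (e : Fin 3 → W) (A : M3) (v : Fin 3 → ℂ) :
    comb (frameMul e A) v = comb e (A *ᵥ v) := by
  simp only [comb_apply, frameMul, Finset.smul_sum, mulVec, dotProduct, Finset.sum_smul, smul_smul]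
  rw [Finset.sum_comm]
  exact Finset.sum_congr rfl fun i _ => Finset.sum_congr rfl fun k _ => by rw [mul_comm]

theorem frameMul_eq_comb (e : Fin 3 → W) (A : M3) (j : Fin 3) :
    frameMul e A j = comb e fun i => A i j := rfl

/-- The real span of the columns of `A` with respect to the frame `e`. -/
noncomputable def Sp (e : Fin 3 → W) (A : M3) : Submodule ℝ W :=
  Submodule.span ℝ (Set.range (frameMul e A))

theorem mem_Sp {e : Fin 3 → W} {A : M3} {w : W} : w ∈ Sp e A ↔ ∃ x, w = comb e (A *ᵥ rv x) := by
  rw [Sp, Submodule.mem_span_range_iff_exists_fun]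
  have h : ∀ x : Fin 3 → ℝ, ∑ j, x j • frameMul e A j = comb e (A *ᵥ rv x) := fun x => by
    rw [← comb_frameMul, comb_apply]
    exact Finset.sum_congr rfl fun j _ => (Complex.coe_smul (x j) (frameMul e A j)).symm
  exact ⟨fun ⟨x, hx⟩ => ⟨x, by rw [← hx, h]⟩, fun ⟨x, hx⟩ => ⟨x, by rw [hx, h]⟩⟩

theorem Sp_frameMul (e : Fin 3 → W) (A B : M3) : Sp (frameMul e A) B = Sp e (A * B) := by
  rw [Sp, Sp, frameMul_frameMul]

theorem Sp_mul_cx (e : Fin 3 → W) (A : M3) {Q : MR} (hQ : Q.det ≠ 0) :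
    Sp e (A * cx Q) = Sp e A := by
  ext w
  rw [mem_Sp, mem_Sp]
  constructor
  · rintro ⟨x, rfl⟩
    exact ⟨Q *ᵥ x, by rw [← cx_mulVec_rv, mulVec_mulVec]⟩
  · rintro ⟨x, rfl⟩
    refine ⟨Q⁻¹ *ᵥ x, ?_⟩
    rw [← cx_mulVec_rv, mulVec_mulVec, mul_assoc, ← map_mul,
      mul_nonsing_inv _ (isUnit_iff_ne_zero.2 hQ), map_one, mul_one]

theorem inner_comb {e : Fin 3 → W} (he : Orthonormal ℂ e) (v w : Fin 3 → ℂ) :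
    inner ℂ (comb e v) (comb e w) = star v ⬝ᵥ w := by
  rw [comb_apply, comb_apply, he.inner_sum]
  rfl

theorem comb_injective {e : Fin 3 → W} (he : Orthonormal ℂ e) : Function.Injective (comb e) :=
  he.linearIndependent.fintypeLinearCombination_injective

theorem orthonormal_frameMul {e : Fin 3 → W} (he : Orthonormal ℂ e) {A : M3}
    (hA : star A * A = 1) : Orthonormal ℂ (frameMul e A) := by
  rw [orthonormal_iff_ite]
  intro i j
  rw [frameMul_eq_comb, frameMul_eq_comb, inner_comb he, ← one_apply, ← hA]
  rfl

theorem exists_comb {e : Fin 3 → W} (he : Orthonormal ℂ e) (hW : Module.finrank ℂ W = 3) (w : W) :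
    ∃ v, w = comb e v := by
  have : w ∈ Submodule.span ℂ (Set.range e) := by
    rw [he.linearIndependent.span_eq_top_of_card_eq_finrank (by simp [hW])]
    trivial
  rw [Submodule.mem_span_range_iff_exists_fun] at this
  obtain ⟨c, hc⟩ := this
  exact ⟨c, hc.symm⟩

theorem exists_frameMul {e : Fin 3 → W} (he : Orthonormal ℂ e) (hW : Module.finrank ℂ W = 3)
    (s : Fin 3 → W) : ∃ A, s = frameMul e A := by
  choose v hv using fun j => exists_comb he hW (s j)
  exact ⟨fun i j => v j i, funext hv⟩

theorem vol_frameMul (Ω : W [⋀^Fin 3]→ₗ[ℂ] ℂ) (e : Fin 3 → W) (A : M3) :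
    Ω (frameMul e A) = A.det * Ω e := by
  have h := (Ω.compLinearMap (comb e)).eq_smul_basis_det (Pi.basisFun ℂ (Fin 3))
  have h1 := congrArg (fun f => f fun j i => A i j) h
  simp only [AlternatingMap.compLinearMap_apply, AlternatingMap.smul_apply, smul_eq_mul] at h1
  have h2 : (fun i => comb e ((Pi.basisFun ℂ (Fin 3)) i)) = e := by
    ext i
    simp [comb_apply, Pi.single_apply]
  have h3 : (Pi.basisFun ℂ (Fin 3)).det (fun j i => A i j) = A.det := by
    rw [Module.Basis.det_apply]
    congr 1
  rw [h2, h3, mul_comm] at h1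
  exact h1

theorem linearIndependent_frameMul {e : Fin 3 → W} (he : Orthonormal ℂ e) {A : M3}
    (hA : A.det ≠ 0) : LinearIndependent ℝ (frameMul e A) := by
  have h1 : LinearIndependent ℂ (frameMul e A) := by
    rw [Fintype.linearIndependent_iff]
    intro v hv
    have h2 : comb e (A *ᵥ v) = 0 := by rw [← comb_frameMul]; exact hv
    have h3 : A *ᵥ v = 0 := comb_injective he (by rw [h2, map_zero])
    exact fun i => congrFun (eq_zero_of_mulVec_eq_zero hA h3) i
  exact h1.restrict_scalars (R := ℝ) (by
    intro a b hab
    simpa using hab)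

theorem eq_mul_cx_of_Sp_eq {e : Fin 3 → W} (he : Orthonormal ℂ e) {A B : M3}
    (h : Sp e B ≤ Sp e A) : ∃ Q : MR, B = A * cx Q := by
  have h1 : ∀ j, ∃ x, (fun i => B i j) = A *ᵥ rv x := fun j => by
    have h2 : frameMul e B j ∈ Sp e A := h (Submodule.subset_span ⟨j, rfl⟩)
    obtain ⟨x, hx⟩ := mem_Sp.1 h2
    exact ⟨x, comb_injective he hx⟩
  choose x hx using h1
  refine ⟨Matrix.of fun i j => x j i, ?_⟩
  ext i j
  exact congrFun (hx j) i

/-! ### Special Lagrangian subspaces -/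

theorem isSpecialLagrangian_Sp {Ω : W [⋀^Fin 3]→ₗ[ℂ] ℂ} {e : Fin 3 → W} (he : Orthonormal ℂ e)
    (hΩ : Ω e = 1) {A : M3} {G : MR} (hA : star A * A = cx G) (hd : A.det.im = 0) :
    IsSpecialLagrangian Ω (Sp e A) := by
  constructor
  · intro u hu v hv
    obtain ⟨x, rfl⟩ := mem_Sp.1 hu
    obtain ⟨y, rfl⟩ := mem_Sp.1 hv
    rw [inner_comb he, star_mulVec, ← dotProduct_mulVec, mulVec_mulVec, ← star_eq_conjTranspose, hA,
      cx_mulVec_rv]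
    simp [dotProduct, rv]
  · intro x hx
    choose y hy using fun j => mem_Sp.1 (hx j)
    have : x = frameMul e (A * cx (Matrix.of fun i j => y j i)) := by
      ext j
      rw [hy]
      rfl
    rw [this, vol_frameMul, hΩ, mul_one, det_mul, det_cx, Complex.mul_im, hd]
    simp

theorem IsSpecialLagrangian.exists_gram {Ω : W [⋀^Fin 3]→ₗ[ℂ] ℂ} {e : Fin 3 → W}
    (he : Orthonormal ℂ e) (hΩ : Ω e = 1) {A : M3} (h : IsSpecialLagrangian Ω (Sp e A)) :
    (∃ G : MR, star A * A = cx G) ∧ A.det.im = 0 := by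
  have hm : ∀ j, frameMul e A j ∈ Sp e A := fun j => Submodule.subset_span ⟨j, rfl⟩
  constructor
  · refine ⟨(star A * A).map Complex.re, ?_⟩
    ext i j
    have h1 := h.1 _ (hm i) _ (hm j)
    rw [frameMul_eq_comb, frameMul_eq_comb, inner_comb he] at h1
    have h2 : ((star A * A) i j).im = 0 := h1
    rw [cx_apply]
    exact Complex.ext rfl (by rw [h2, Complex.ofReal_im])
  · have h1 := h.2 _ hm
    change (Ω (frameMul e A)).im = 0 at h1
    rwa [vol_frameMul, hΩ, mul_one] at h1

theorem star_gmat_mul_gmat {S : MR} (hS : Sᵀ = S) : star (gmat S) * gmat S = cx (1 + S * S) := by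
  rw [gmat, star_add, star_one, star_smul, star_cx, hS, map_add, map_one, map_mul, add_mul, one_mul,
    mul_add, mul_one, smul_mul_smul_comm]
  have : star Complex.I * Complex.I = 1 := by simp
  rw [this, one_smul]
  have h2 : star Complex.I = -Complex.I := by simp
  rw [h2, neg_smul]
  abel

theorem star_mul_gmat_gram (g : SU3) {S : MR} (hS : Sᵀ = S) :
    star ((g : M3) * gmat S) * ((g : M3) * gmat S) = cx (1 + S * S) := by
  rw [star_mul, mul_assoc, ← mul_assoc (star (g : M3)), g.star_mul_self, one_mul,
    star_gmat_mul_gmat hS]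

theorem isSpecialLagrangian_graph {Ω : W [⋀^Fin 3]→ₗ[ℂ] ℂ} {e : Fin 3 → W} (he : Orthonormal ℂ e)
    (hΩ : Ω e = 1) (g : SU3) {S : MR} (hS : Sᵀ = S) (hd : (gmat S).det.im = 0) :
    IsSpecialLagrangian Ω (Sp e ((g : M3) * gmat S)) :=
  isSpecialLagrangian_Sp he hΩ (star_mul_gmat_gram g hS) (by rwa [det_mul, g.det_eq, one_mul])

theorem isSpecialLagrangian_SU3 {Ω : W [⋀^Fin 3]→ₗ[ℂ] ℂ} {e : Fin 3 → W} (he : Orthonormal ℂ e)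
    (hΩ : Ω e = 1) (g : SU3) : IsSpecialLagrangian Ω (Sp e (g : M3)) :=
  isSpecialLagrangian_Sp he hΩ (G := 1) (by rw [g.star_mul_self, map_one]) (by simp [g.det_eq])

theorem J_comb (e : Fin 3 → W) (v : Fin 3 → ℂ) : J (comb e v) = comb e (Complex.I • v) := by
  rw [map_smul]
  rfl

theorem SU3.mulVec_injective (g : SU3) : Function.Injective ((g : M3) *ᵥ ·) := fun x y h => by
  have := congrArg ((star (g : M3)) *ᵥ ·) h
  simpa only [mulVec_mulVec, g.star_mul_self, one_mulVec] using this

theorem Sp_inf_graph {e : Fin 3 → W} (he : Orthonormal ℂ e) (g : SU3) {S : MR} (hS : S.det ≠ 0) :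
    Sp e (g : M3) ⊓ Sp e ((g : M3) * gmat S) = ⊥ := by
  rw [eq_bot_iff]
  rintro w ⟨h1, h2⟩
  obtain ⟨x, rfl⟩ := mem_Sp.1 h1
  obtain ⟨y, hy⟩ := mem_Sp.1 h2
  have h3 := comb_injective he hy
  rw [← mulVec_mulVec, gmat_mulVec_rv] at h3
  have h4 : rv x + Complex.I • rv 0 = rv y + Complex.I • rv (S *ᵥ y) := by
    rw [rv_zero, smul_zero, add_zero]
    exact g.mulVec_injective h3
  obtain ⟨rfl, h6⟩ := rv_add_I_smul_rv_inj h4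
  rw [eq_zero_of_mulVec_eq_zero hS h6.symm, rv_zero, mulVec_zero, map_zero]
  exact Submodule.zero_mem _

theorem J_Sp_inf_graph {e : Fin 3 → W} (he : Orthonormal ℂ e) (g : SU3) (S : MR) :
    (Sp e (g : M3)).map J ⊓ Sp e ((g : M3) * gmat S) = ⊥ := by
  rw [eq_bot_iff]
  rintro w ⟨h1, h2⟩
  obtain ⟨w', h0, rfl⟩ := h1
  obtain ⟨x, rfl⟩ := mem_Sp.1 h0
  obtain ⟨y, hy⟩ := mem_Sp.1 h2
  rw [J_comb] at hy
  have h3 := comb_injective he hy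
  rw [← mulVec_mulVec, gmat_mulVec_rv, ← mulVec_smul] at h3
  have h4 : rv 0 + Complex.I • rv x = rv y + Complex.I • rv (S *ᵥ y) := by
    rw [rv_zero, zero_add]
    exact g.mulVec_injective h3
  obtain ⟨h5, h6⟩ := rv_add_I_smul_rv_inj h4
  rw [h6, ← h5, mulVec_zero, rv_zero, mulVec_zero, map_zero, map_zero]
  exact Submodule.zero_mem _

theorem graph_det_ne_zero {e : Fin 3 → W} (he : Orthonormal ℂ e) (g : SU3) {S : MR}
    (h : Sp e (g : M3) ⊓ Sp e ((g : M3) * gmat S) = ⊥) : S.det ≠ 0 := by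
  intro hd
  obtain ⟨x, hx, hSx⟩ := exists_mulVec_eq_zero_iff.2 hd
  have h1 : comb e ((g : M3) *ᵥ rv x) ∈ Sp e (g : M3) ⊓ Sp e ((g : M3) * gmat S) := by
    refine ⟨mem_Sp.2 ⟨x, rfl⟩, mem_Sp.2 ⟨x, ?_⟩⟩
    rw [← mulVec_mulVec, gmat_mulVec_rv, hSx, rv_zero, smul_zero, add_zero]
  rw [h, Submodule.mem_bot] at h1
  have h2 := comb_injective he (h1.trans (map_zero _).symm)
  have h3 : rv x = rv 0 := g.mulVec_injective (by
    change (g : M3) *ᵥ rv x = (g : M3) *ᵥ rv 0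
    rw [h2, rv_zero, mulVec_zero])
  exact hx (rv_injective h3)

/-- The real part of a complex matrix. -/
def reMat (A : M3) : MR := A.map Complex.re

/-- The imaginary part of a complex matrix. -/
def imMat (A : M3) : MR := A.map Complex.im

theorem re_add_im (A : M3) : cx (reMat A) + Complex.I • cx (imMat A) = A := by
  ext i j
  change ((A i j).re : ℂ) + Complex.I * ((A i j).im : ℂ) = A i j
  rw [mul_comm, Complex.re_add_im]

/-- The matrix `S` such that the column space of `g (1 + i S)` is the one of `A`. -/
noncomputable def slope (g A : M3) : MR := imMat (star g * A) * (reMat (star g * A))⁻¹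

/-- A special Lagrangian subspace that is transverse to `J V` is the graph of `J S` for
a symmetric endomorphism `S` of `V`. -/
theorem slope_spec {Ω : W [⋀^Fin 3]→ₗ[ℂ] ℂ} {e : Fin 3 → W} (he : Orthonormal ℂ e)
    (hΩ : Ω e = 1) (g : SU3) {A : M3} (hA : A.det ≠ 0) (hSL : IsSpecialLagrangian Ω (Sp e A))
    (hJ : (Sp e (g : M3)).map J ⊓ Sp e A = ⊥) :
    (reMat (star (g : M3) * A)).det ≠ 0 ∧ Sp e A = Sp e ((g : M3) * gmat (slope g A)) ∧
      (slope g A)ᵀ = slope g A ∧ (gmat (slope g A)).det.im = 0 := by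
  set P := reMat (star (g : M3) * A) with hP
  set Q := imMat (star (g : M3) * A) with hQ
  have hB : star (g : M3) * A = cx P + Complex.I • cx Q := (re_add_im _).symm
  have hAB : A = (g : M3) * (cx P + Complex.I • cx Q) := by
    rw [← hB, ← mul_assoc, g.mul_star_self, one_mul]
  -- a null vector of the real part would give a vector of `J V` in the column space of `A`
  have hPd : P.det ≠ 0 := by
    intro hd
    obtain ⟨x, hx, hPx⟩ := exists_mulVec_eq_zero_iff.2 hd
    have h0 : A *ᵥ rv x = Complex.I • ((g : M3) *ᵥ rv (Q *ᵥ x)) := by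
      rw [hAB, ← mulVec_mulVec, add_mulVec, smul_mulVec, cx_mulVec_rv, cx_mulVec_rv, hPx, rv_zero,
        zero_add, mulVec_smul]
    have h1 : comb e (A *ᵥ rv x) ∈ (Sp e (g : M3)).map J ⊓ Sp e A :=
      ⟨⟨comb e ((g : M3) *ᵥ rv (Q *ᵥ x)), mem_Sp.2 ⟨_, rfl⟩, by rw [J_comb, h0]⟩,
        mem_Sp.2 ⟨x, rfl⟩⟩
    rw [hJ, Submodule.mem_bot] at h1
    have h2 := comb_injective he (h1.trans (map_zero _).symm)
    have h3 := eq_zero_of_mulVec_eq_zero hA h2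
    exact hx (rv_injective (h3.trans rv_zero.symm))
  have hS : slope g A = Q * P⁻¹ := rfl
  have hPu := isUnit_iff_ne_zero.2 hPd
  have hSP : slope g A * P = Q := by rw [hS, mul_assoc, nonsing_inv_mul _ hPu, mul_one]
  have hA2 : A = (g : M3) * gmat (slope g A) * cx P := by
    rw [mul_assoc, gmat, add_mul, one_mul, smul_mul_assoc, ← map_mul, hSP, ← hAB]
  obtain ⟨⟨G, hG⟩, hd⟩ := hSL.exists_gram he hΩ
  refine ⟨hPd, ?_, ?_, ?_⟩
  · conv_lhs => rw [hA2, Sp_mul_cx _ _ hPd]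
  · have h1 : star (cx P + Complex.I • cx Q) * (cx P + Complex.I • cx Q) = cx G := by
      rw [← hB, star_mul, star_star, mul_assoc, ← mul_assoc (g : M3), g.mul_star_self, one_mul, hG]
    -- by the Lagrangian condition `Pᵀ Q` is symmetric, hence so is `Q P⁻¹`
    have h2 : Pᵀ * Q = Qᵀ * P := by
      rw [star_add, star_smul, star_cx, star_cx, add_mul, mul_add, mul_add, mul_smul_comm,
        smul_mul_assoc, smul_mul_smul_comm, ← map_mul, ← map_mul, ← map_mul, ← map_mul] at h1
      ext i j
      have h3 := congrArg Complex.im (congrFun (congrFun h1 i) j)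
      simp [cx_apply, -map_mul] at h3
      linarith
    have hPt : IsUnit Pᵀ.det := by rwa [det_transpose]
    rw [hS, transpose_mul, transpose_nonsing_inv]
    calc Pᵀ⁻¹ * Qᵀ = Pᵀ⁻¹ * (Qᵀ * P) * P⁻¹ := by
          rw [mul_assoc, mul_assoc, mul_nonsing_inv _ hPu, mul_one]
      _ = Q * P⁻¹ := by rw [← h2, ← mul_assoc, nonsing_inv_mul _ hPt, one_mul]
  · rw [hA2, det_mul, det_mul, g.det_eq, one_mul, det_cx, Complex.mul_im, Complex.ofReal_im,
      Complex.ofReal_re, mul_zero, zero_add] at hd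
    exact (mul_eq_zero.1 hd).resolve_right hPd

theorem gmat_slope_injective {e : Fin 3 → W} (he : Orthonormal ℂ e) (g : SU3) {S T : MR}
    (h : Sp e ((g : M3) * gmat S) = Sp e ((g : M3) * gmat T)) : S = T := by
  obtain ⟨Q, hQ⟩ := eq_mul_cx_of_Sp_eq he h.ge
  have h1 : gmat T = gmat S * cx Q := by
    have := congrArg (star (g : M3) * ·) hQ
    simp only [← mul_assoc, g.star_mul_self, one_mul] at this
    exact this
  have h2 : ∀ x : Fin 3 → ℝ, T *ᵥ x = S *ᵥ x := fun x => by
    have h3 := congrArg (· *ᵥ rv x) h1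
    simp only [← mulVec_mulVec, cx_mulVec_rv, gmat_mulVec_rv] at h3
    obtain ⟨h4, h5⟩ := rv_add_I_smul_rv_inj h3
    rw [h5, ← h4]
  exact (Matrix.ext_of_mulVec_single fun i => (h2 _).symm)

end Frames

/-! ### The bilinear form of a graph in coordinates -/

section GraphForm

attribute [local instance] InnerProductSpace.complexToReal

variable {W : Type*} [NormedAddCommGroup W] [InnerProductSpace ℂ W]

theorem rv_smul (c : ℝ) (x : Fin 3 → ℝ) : rv (c • x) = (c : ℂ) • rv x := by
  ext i
  simp [rv]

theorem mem_Sp_one {e : Fin 3 → W} {w : W} : w ∈ Sp e 1 ↔ ∃ x, w = comb e (rv x) := by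
  rw [mem_Sp]
  simp only [one_mulVec]

theorem mem_Sp_gmat {e : Fin 3 → W} {S : MR} {w : W} :
    w ∈ Sp e (gmat S) ↔ ∃ x, w = comb e (rv x) + comb e (Complex.I • rv (S *ᵥ x)) := by
  rw [mem_Sp]
  simp only [gmat_mulVec_rv, map_add]

theorem real_inner_comb {e : Fin 3 → W} (he : Orthonormal ℂ e) (v w : Fin 3 → ℂ) :
    ⟪comb e v, comb e w⟫_ℝ = (star v ⬝ᵥ w).re := by
  rw [real_inner_eq_re_inner ℂ, inner_comb he]
  rfl

theorem real_inner_comb_rv {e : Fin 3 → W} (he : Orthonormal ℂ e) (x y : Fin 3 → ℝ) :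
    ⟪comb e (rv x), comb e (rv y)⟫_ℝ = x ⬝ᵥ y := by
  rw [real_inner_comb he]
  simp [dotProduct, rv]

theorem exists_isGraphMap {e : Fin 3 → W} (he : Orthonormal ℂ e) (S : MR) :
    ∃ A : Sp e 1 →ₗ[ℝ] (Sp e 1)ᗮ, IsGraphMap (Sp e 1) (Sp e (gmat S)) A ∧
      ∀ (v : Sp e 1) (x : Fin 3 → ℝ), (v : W) = comb e (rv x) →
        (A v : W) = comb e (Complex.I • rv (S *ᵥ x)) := by
  let T : W →ₗ[ℝ] W :=
    { toFun := fun w => comb e (Complex.I • rv (S *ᵥ fun j => ⟪e j, w⟫_ℝ))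
      map_add' := fun v w => by
        rw [← map_add, ← smul_add]
        congr 2
        ext i
        simp [rv, mulVec, dotProduct, inner_add_right, mul_add, Finset.sum_add_distrib]
      map_smul' := fun c w => by
        have h1 : (fun j => ⟪e j, c • w⟫_ℝ) = c • fun j => ⟪e j, w⟫_ℝ := by
          ext j
          exact real_inner_smul_right _ _ _
        rw [RingHom.id_apply, h1, mulVec_smul, rv_smul, smul_comm, map_smul, Complex.coe_smul] }
  have hx : ∀ x : Fin 3 → ℝ, (fun j => ⟪e j, comb e (rv x)⟫_ℝ) = x := fun x => by
    ext j
    have h1 : e j = comb e (rv (Pi.single j 1)) := by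
      simp [comb_apply, rv, Pi.single_apply]
    rw [h1, real_inner_comb_rv he, single_one_dotProduct]
  have hT : ∀ x : Fin 3 → ℝ, T (comb e (rv x)) = comb e (Complex.I • rv (S *ᵥ x)) := fun x => by
    change comb e (Complex.I • rv (S *ᵥ fun j => ⟪e j, comb e (rv x)⟫_ℝ)) = _
    rw [hx]
  have hperp : ∀ v : Sp e 1, T v ∈ (Sp e 1)ᗮ := by
    rintro ⟨v, hv⟩
    obtain ⟨x, rfl⟩ := mem_Sp_one.1 hv
    rw [Submodule.mem_orthogonal]
    intro u hu
    obtain ⟨y, rfl⟩ := mem_Sp_one.1 hu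
    rw [hT, real_inner_comb he]
    simp [dotProduct, rv]
  refine ⟨(T.comp (Sp e 1).subtype).codRestrict _ hperp, ?_, ?_⟩
  · intro w
    rw [mem_Sp_gmat]
    constructor
    · rintro ⟨x, rfl⟩
      refine ⟨⟨comb e (rv x), mem_Sp_one.2 ⟨x, rfl⟩⟩, ?_⟩
      change _ = comb e (rv x) + T (comb e (rv x))
      rw [hT]
    · rintro ⟨⟨v, hv⟩, rfl⟩
      obtain ⟨x, rfl⟩ := mem_Sp_one.1 hv
      refine ⟨x, ?_⟩
      change comb e (rv x) + T (comb e (rv x)) = _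
      rw [hT]
  · rintro ⟨v, hv⟩ x rfl
    exact hT x

/-- In the basis `e`, the form `B_{V,V'}` of the graph of `J S` has matrix `S`. -/
theorem bform_graph {e : Fin 3 → W} (he : Orthonormal ℂ e) (S : MR) {u v : Sp e 1}
    {x y : Fin 3 → ℝ} (hu : (u : W) = comb e (rv x)) (hv : (v : W) = comb e (rv y)) :
    bform (Sp e 1) (Sp e (gmat S)) u v = x ⬝ᵥ S *ᵥ y := by
  obtain ⟨A, hA, hA'⟩ := exists_isGraphMap he S
  have h1 : graphMap (Sp e 1) (Sp e (gmat S)) = A := by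
    have h2 : ∃ A, IsGraphMap (Sp e 1) (Sp e (gmat S)) A := ⟨A, hA⟩
    rw [graphMap, dif_pos h2]
    exact h2.choose_spec.unique hA
  rw [bform, h1]
  change ⟪J (u : W), (A v : W)⟫_ℝ = _
  rw [hA' v y hv, hu, J_comb, real_inner_comb he]
  simp [dotProduct, rv]

theorem isEigen_graph_iff {e : Fin 3 → W} (he : Orthonormal ℂ e) {S : MR} (hS : Sᵀ = S)
    {u : Sp e 1} {x : Fin 3 → ℝ} (hu : (u : W) = comb e (rv x)) (c : ℝ) :
    IsEigen (Sp e 1) (Sp e (gmat S)) c u ↔ S *ᵥ x = c • x := by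
  have h1 : ∀ y : Fin 3 → ℝ, x ⬝ᵥ S *ᵥ y = (S *ᵥ x) ⬝ᵥ y := fun y => by
    rw [dotProduct_mulVec, ← mulVec_transpose, hS]
  constructor
  · intro h
    refine dotProduct_eq _ _ fun y => ?_
    have h2 := h ⟨comb e (rv y), mem_Sp_one.2 ⟨y, rfl⟩⟩
    rw [bform_graph he S hu rfl, h1] at h2
    rw [h2, smul_dotProduct, smul_eq_mul, Submodule.coe_inner, hu, real_inner_comb_rv he]
  · rintro h ⟨v, hv⟩
    obtain ⟨y, rfl⟩ := mem_Sp_one.1 hv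
    rw [bform_graph he S hu rfl, h1, h, smul_dotProduct, smul_eq_mul, Submodule.coe_inner, hu,
      real_inner_comb_rv he]

theorem oneNegTwoPos_graph_iff {e : Fin 3 → W} (he : Orthonormal ℂ e) {S : MR} (hS : Sᵀ = S) :
    OneNegTwoPos (Sp e 1) (Sp e (gmat S)) ↔ MatOneNeg S := by
  constructor
  · rintro ⟨b, c, hb, hc⟩
    choose x hx using fun i => mem_Sp_one.1 (b i).2
    have h1 : ∀ i j, x i ⬝ᵥ x j = if i = j then 1 else 0 := fun i j => by
      rw [← orthonormal_iff_ite.1 b.orthonormal i j, Submodule.coe_inner, hx, hx,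
        real_inner_comb_rv he]
    have h2 : ∀ i, S *ᵥ x i = c i • x i := fun i => (isEigen_graph_iff he hS (hx i) _).1 (hb i)
    set X : MR := Matrix.of fun i j => x j i with hX
    have h3 : Xᵀ * X = 1 := by
      ext i j
      rw [one_apply, ← h1 i j]
      rfl
    have h4 : S * X = X * diagonal c := by
      ext i j
      rw [mul_diagonal]
      have := congrFun (h2 j) i
      rw [Pi.smul_apply, smul_eq_mul, mul_comm] at this
      exact this
    refine ⟨X, c, h3, ?_, hc⟩
    rw [← h4, mul_assoc, mul_eq_one_comm.1 h3, mul_one]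
  · rintro ⟨X, c, hX, rfl, hc⟩
    let v : Fin 3 → Sp e 1 := fun i => ⟨comb e (rv fun k => X k i), mem_Sp_one.2 ⟨_, rfl⟩⟩
    have hv : Orthonormal ℝ v := by
      rw [orthonormal_iff_ite]
      intro i j
      rw [Submodule.coe_inner, real_inner_comb_rv he, ← one_apply, ← hX]
      rfl
    have hfin : Module.finrank ℝ (Sp e 1) = 3 := by
      rw [Sp, finrank_span_eq_card (linearIndependent_frameMul he (by simp)), Fintype.card_fin]
    have hspan := hv.linearIndependent.span_eq_top_of_card_eq_finrank (by simp [hfin])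
    refine ⟨OrthonormalBasis.mk hv hspan.ge, c, fun i => ?_, hc⟩
    rw [OrthonormalBasis.coe_mk]
    refine (isEigen_graph_iff he hS rfl _).2 ?_
    have h1 : (X * diagonal c * Xᵀ) * X = X * diagonal c := by rw [mul_assoc, hX, mul_one]
    ext k
    have h2 := congrFun (congrFun h1 k) i
    rw [mul_diagonal] at h2
    rw [Pi.smul_apply, smul_eq_mul, mul_comm, ← h2]
    rfl

theorem negEigenspace_graph {e : Fin 3 → W} (he : Orthonormal ℂ e) {S : MR} (hS : Sᵀ = S)
    (h : MatOneNeg S) {x : Fin 3 → ℝ} (hx : x ≠ 0) {l : ℝ} (hl : l < 0) (hSx : S *ᵥ x = l • x) :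
    negEigenspace (Sp e 1) (Sp e (gmat S)) = Submodule.span ℝ {comb e (rv x)} := by
  apply le_antisymm
  · rw [negEigenspace, Submodule.span_le]
    rintro w ⟨⟨u, hu⟩, rfl, c, hc, hE⟩
    obtain ⟨y, rfl⟩ := mem_Sp_one.1 hu
    have hy := (isEigen_graph_iff he hS rfl c).1 hE
    obtain ⟨X, d, hX, rfl, hd⟩ := h
    obtain ⟨a, ha⟩ := MatOneNeg.eigenvector hX hd.2.1 hd.2.2 hc hy
    obtain ⟨b, hb⟩ := MatOneNeg.eigenvector hX hd.2.1 hd.2.2 hl hSx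
    have hb0 : b ≠ 0 := by
      rintro rfl
      exact hx (by rw [hb, zero_smul])
    rw [SetLike.mem_coe, Submodule.mem_span_singleton]
    refine ⟨a / b, ?_⟩
    have : y = (a / b) • x := by rw [ha, hb, smul_smul, div_mul_cancel₀ _ hb0]
    change (a / b) • comb e (rv x) = comb e (rv y)
    rw [this, rv_smul, map_smul, Complex.coe_smul]
  · rw [Submodule.span_singleton_le_iff_mem]
    exact Submodule.subset_span ⟨⟨_, mem_Sp_one.2 ⟨x, rfl⟩⟩, rfl, l, hl,
      (isEigen_graph_iff he hS rfl l).2 hSx⟩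

end GraphForm

/-! ### Interchanging the two subspaces -/

section Reversal

attribute [local instance] InnerProductSpace.complexToReal

variable {W : Type*} [NormedAddCommGroup W] [InnerProductSpace ℂ W]

/-- If `V'` is the graph of `J S` over `V`, then `V` is the graph of `J S'` over `V'`, where `S'` has
the eigenvalues of `-S`: multiplication by `(1 + i c) / |1 + i c|` on the eigenvectors of `S` maps `V`
to `V'`. -/
theorem exists_reversed_frame {e : Fin 3 → W} (he : Orthonormal ℂ e) {X : MR} (hX : Xᵀ * X = 1)
    (c : Fin 3 → ℝ) : ∃ e' : Fin 3 → W, Orthonormal ℂ e' ∧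
      Sp e (gmat (X * diagonal c * Xᵀ)) = Sp e' 1 ∧ Sp e 1 = Sp e' (gmat (diagonal (-c))) := by
  have hX' := mul_eq_one_comm.1 hX
  have hXd : X.det ≠ 0 := by
    intro h
    have := congrArg det hX'
    rw [det_mul, h, zero_mul, det_one] at this
    exact zero_ne_one this
  have hr : ∀ j, 0 < √(1 + c j ^ 2) := fun j => Real.sqrt_pos.2 (by positivity)
  have hr2 : ∀ j, ((√(1 + c j ^ 2) : ℝ) : ℂ) * ((√(1 + c j ^ 2) : ℝ) : ℂ) = 1 + (c j : ℂ) ^ 2 :=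
    fun j => by
      rw [← Complex.ofReal_mul, Real.mul_self_sqrt (by positivity)]
      push_cast
      rfl
  have hrc : ∀ j, ((√(1 + c j ^ 2) : ℝ) : ℂ) ≠ 0 := fun j => by exact_mod_cast (hr j).ne'
  -- polar coordinates `1 + i c j = d j * r j`; then `d j * (1 - i c j) = r j`
  set r : Fin 3 → ℝ := fun j => √(1 + c j ^ 2) with hrdef
  set d : Fin 3 → ℂ := fun j => (1 + Complex.I * (c j : ℂ)) / (r j : ℂ) with hd
  have hdr : ∀ j, d j * r j = 1 + Complex.I * (c j : ℂ) := fun j => div_mul_cancel₀ _ (hrc j)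
  have hdd : ∀ j, d j * (1 + Complex.I * ((-c) j : ℝ)) = r j := fun j => by
    rw [hd]
    simp only [Pi.neg_apply, Complex.ofReal_neg]
    rw [div_mul_eq_mul_div, div_eq_iff (hrc j), hr2 j]
    linear_combination (-(c j : ℂ) ^ 2) * Complex.I_sq
  have hstar : ∀ j, star (d j) * d j = 1 := fun j => by
    have h1 : star (d j) = (1 + Complex.I * ((-c) j : ℝ)) / (r j : ℂ) := by
      rw [hd]
      simp
    rw [h1, div_mul_eq_mul_div, mul_comm, hdd, div_self (hrc j)]
  have hu : star (cx X * diagonal d) * (cx X * diagonal d) = 1 := by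
    rw [star_mul, star_cx, mul_assoc, ← mul_assoc (cx Xᵀ), ← map_mul, hX, map_one, one_mul,
      star_eq_conjTranspose, diagonal_conjTranspose, diagonal_mul_diagonal, ← diagonal_one]
    congr 1
    ext j
    exact hstar j
  have hrd : (diagonal r).det ≠ 0 := by
    rw [det_diagonal]
    exact Finset.prod_ne_zero_iff.2 fun j _ => (hr j).ne'
  refine ⟨frameMul e (cx X * diagonal d), orthonormal_frameMul he hu, ?_, ?_⟩
  · rw [Sp_frameMul, mul_one, ← Sp_mul_cx e (cx X * diagonal d) hrd, gmat_conj hX',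
      Sp_mul_cx _ _ (by rwa [det_transpose]), gmat_diagonal, mul_assoc, cx_diagonal,
      diagonal_mul_diagonal]
    congr 3
    ext j
    exact (hdr j).symm
  · rw [Sp_frameMul, gmat_diagonal, mul_assoc, diagonal_mul_diagonal]
    have : (fun j => d j * (1 + Complex.I * ((-c) j : ℝ))) = fun j => (r j : ℂ) := funext hdd
    rw [this, ← cx_diagonal, Sp_mul_cx _ _ hrd]
    conv_lhs => rw [← Sp_mul_cx e 1 hXd, one_mul]

theorem oneNegTwoPos_iff_det_neg {e : Fin 3 → W} (he : Orthonormal ℂ e) {S : MR} (hS : PosGraph S) :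
    OneNegTwoPos (Sp e 1) (Sp e (gmat S)) ↔ S.det < 0 := by
  rw [oneNegTwoPos_graph_iff he hS.symm, matOneNeg_iff hS]

theorem exists_reversed_posGraph {e : Fin 3 → W} (he : Orthonormal ℂ e) {S : MR}
    (hS : PosGraph S) : ∃ (e' : Fin 3 → W) (S' : MR), Orthonormal ℂ e' ∧
      Sp e (gmat S) = Sp e' 1 ∧ Sp e 1 = Sp e' (gmat S') ∧ PosGraph S' ∧
        (S'.det < 0 ↔ 0 < S.det) := by
  obtain ⟨X, c, hX, rfl⟩ := exists_diagonalization hS.symm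
  have hX' := mul_eq_one_comm.1 hX
  obtain ⟨e', he', h1, h2⟩ := exists_reversed_frame he hX c
  have him := hS.im_det
  have hre := hS.re_det
  have hne := hS.det_ne
  rw [det_gmat_conj hX', det_gmat_diagonal] at him hre
  rw [det_conj hX', det_diagonal, Fin.prod_univ_three] at hne
  simp at him hre
  refine ⟨e', _, he', h1, h2, ⟨diagonal_transpose _, ?_, ?_, ?_⟩, ?_⟩
  · rw [det_gmat_diagonal]
    simp
    linarith
  · rw [det_gmat_diagonal]
    simp
    linarith
  · rw [det_diagonal, Fin.prod_univ_three]
    simpa using hne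
  · rw [det_conj hX', det_diagonal, det_diagonal, Fin.prod_univ_three, Fin.prod_univ_three]
    simp

theorem oneNegTwoPos_reversed_iff {e : Fin 3 → W} (he : Orthonormal ℂ e) {S : MR}
    (hS : PosGraph S) : OneNegTwoPos (Sp e (gmat S)) (Sp e 1) ↔ 0 < S.det := by
  obtain ⟨e', S', he', h1, h2, hS', hd⟩ := exists_reversed_posGraph he hS
  rw [h1, h2, oneNegTwoPos_iff_det_neg he' hS', hd]

end Reversal

/-! ### Deformations of symmetric matrices -/

/-- The symmetric matrix of a form on `ℝ ⊕ ℝ²` that splits. -/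
def blockMat (a b c d : ℝ) : MR := !![-a, 0, 0; 0, b, c; 0, c, d]

/-- The imaginary part vanishes if and only if the trace and the determinant agree. -/
theorem det_gmat_blockMat (a b c d : ℝ) : (gmat (blockMat a b c d)).det =
    ((1 + a * (b + d) - (b * d - c * c) : ℝ) : ℂ) +
      ((b + d - a + a * (b * d - c * c) : ℝ) : ℂ) * Complex.I := by
  have h : gmat (blockMat a b c d) = !![1 - Complex.I * a, 0, 0; 0, 1 + Complex.I * b,
      Complex.I * c; 0, Complex.I * c, 1 + Complex.I * d] := by
    ext i j
    fin_cases i <;> fin_cases j <;> simp [gmat, blockMat, cx_apply, sub_eq_add_neg]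
  rw [h, det_fin_three]
  simp
  linear_combination (-(a : ℂ) * b - a * d + b * d - c * c + (-a * b * d + a * c * c) * Complex.I) * Complex.I_sq

theorem det_blockMat (a b c d : ℝ) : (blockMat a b c d).det = -a * (b * d - c * c) := by
  rw [blockMat, det_fin_three]
  simp
  ring

/-- Matrices that satisfy `PosGraph`, with a negative eigenvalue on the first basis vector and
positive eigenvalues on its complement. -/
def Adapted (S : MR) : Prop :=
  ∃ a b c d : ℝ, S = blockMat a b c d ∧ 0 < a ∧ 0 < b * d - c * c ∧ b * d - c * c < 1 ∧
    b + d = a * (1 - (b * d - c * c))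

theorem Adapted.posGraph {S : MR} (h : Adapted S) : PosGraph S := by
  obtain ⟨a, b, c, d, rfl, ha, hD, hD1, ht⟩ := h
  refine ⟨?_, ?_, ?_, ?_⟩
  · ext i j
    fin_cases i <;> fin_cases j <;> rfl
  · rw [det_gmat_blockMat]
    simp
    linarith
  · rw [det_gmat_blockMat]
    simp
    have : 0 ≤ a * (b + d) := by
      rw [ht]
      exact mul_nonneg ha.le (mul_nonneg ha.le (by linarith))
    linarith
  · rw [det_blockMat]
    exact mul_ne_zero (neg_ne_zero.2 ha.ne') hD.ne'

theorem Adapted.det_neg {S : MR} (h : Adapted S) : S.det < 0 := by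
  obtain ⟨a, b, c, d, rfl, ha, hD, -, -⟩ := h
  rw [det_blockMat]
  nlinarith [mul_pos ha hD]

theorem Adapted.matOneNeg {S : MR} (h : Adapted S) : MatOneNeg S := h.posGraph.matOneNeg h.det_neg

/-- For a block matrix, the sign of the real part of `det (1 + i S)` decides whether the determinant of
the second block is less than `1`. -/
theorem PosGraph.adapted {S : MR} (h : PosGraph S) (hd : S.det < 0) (h1 : S 1 0 = 0)
    (h2 : S 2 0 = 0) (h0 : S 0 0 < 0) : Adapted S := by
  have hs : ∀ i j, S i j = S j i := fun i j => by conv_lhs => rw [← h.symm, transpose_apply]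
  have hS : S = blockMat (-S 0 0) (S 1 1) (S 1 2) (S 2 2) := by
    ext i j
    fin_cases i <;> fin_cases j <;> simp [blockMat, h1, h2, hs 0 1, hs 0 2, hs 2 1]
  have him := h.im_det
  have hre := h.re_det
  rw [hS] at him hre hd
  rw [det_gmat_blockMat] at him hre
  rw [det_blockMat] at hd
  simp at him hre
  have hD : 0 < S 1 1 * S 2 2 - S 1 2 * S 1 2 := by
    by_contra hc
    nlinarith
  have ht : S 1 1 + S 2 2 = -S 0 0 * (1 - (S 1 1 * S 2 2 - S 1 2 * S 1 2)) := by linarith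
  refine ⟨_, _, _, _, hS, by linarith, hD, ?_, ht⟩
  by_contra hc
  rw [not_lt] at hc
  rw [ht] at hre
  nlinarith [mul_nonneg (mul_self_nonneg (S 0 0)) (sub_nonneg.2 hc)]

/-- The projection onto the first coordinate. -/
def proj0 : MR := blockMat (-1) 0 0 0

/-- The part of `deform κ ν S` that acts on the complement of the first basis vector. -/
noncomputable def deformCore (κ ν : ℝ) (S : MR) : MR :=
  κ • (S - S 0 0 • proj0) + ν • (1 - proj0)

/-- The matrix `κ S + ν` on the complement of the first basis vector, extended to the whole space in
such a way that the trace and the determinant agree. -/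
noncomputable def deform (κ ν : ℝ) (S : MR) : MR :=
  deformCore κ ν S - ((deformCore κ ν S).trace / (1 - (deformCore κ ν S + proj0).det)) • proj0

theorem deformCore_blockMat (κ ν a b c d : ℝ) : deformCore κ ν (blockMat a b c d) =
    blockMat 0 (κ * b + ν) (κ * c) (κ * d + ν) := by
  ext i j
  fin_cases i <;> fin_cases j <;> simp [deformCore, blockMat, proj0]

theorem deform_blockMat (κ ν a b c d : ℝ) : deform κ ν (blockMat a b c d) =
    blockMat ((κ * (b + d) + 2 * ν) /
      (1 - (κ ^ 2 * (b * d - c * c) + κ * ν * (b + d) + ν ^ 2)))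
      (κ * b + ν) (κ * c) (κ * d + ν) := by
  have h1 : (blockMat 0 (κ * b + ν) (κ * c) (κ * d + ν)).trace = κ * (b + d) + 2 * ν := by
    rw [trace_fin_three]
    simp [blockMat]
    ring
  have h2 : (blockMat 0 (κ * b + ν) (κ * c) (κ * d + ν) + proj0).det =
      κ ^ 2 * (b * d - c * c) + κ * ν * (b + d) + ν ^ 2 := by
    rw [det_fin_three]
    simp [blockMat, proj0]
    ring
  rw [deform, deformCore_blockMat, h1, h2]
  ext i j
  fin_cases i <;> fin_cases j <;> simp [blockMat, proj0]

theorem proj0_conj {h : MR} (hh : h * hᵀ = 1) (hp : h * proj0 = proj0 * h) :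
    h * proj0 * hᵀ = proj0 := by
  rw [hp, mul_assoc, hh, mul_one]

theorem deformCore_conj {h : MR} (hh : h * hᵀ = 1) (hp : h * proj0 = proj0 * h) (κ ν : ℝ) (S : MR) :
    deformCore κ ν (h * S * hᵀ) = h * deformCore κ ν S * hᵀ := by
  have hp' := proj0_conj hh hp
  have hpt : proj0ᵀ = proj0 := by
    ext i j
    fin_cases i <;> fin_cases j <;> rfl
  have hp2 : proj0 * hᵀ = hᵀ * proj0 := by
    have := congrArg transpose hp
    rw [transpose_mul, transpose_mul, hpt] at this
    exact this
  have h0 : ∀ T : MR, proj0 * T * proj0 = T 0 0 • proj0 := fun T => by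
    ext i j
    fin_cases i <;> fin_cases j <;> simp [proj0, blockMat, vecMul, dotProduct,
      mul_apply, Fin.sum_univ_three]
  have h00 : (h * S * hᵀ) 0 0 • proj0 = S 0 0 • proj0 := by
    rw [← h0, ← h0]
    calc proj0 * (h * S * hᵀ) * proj0 = (proj0 * h) * S * (hᵀ * proj0) := by simp only [mul_assoc]
      _ = h * (proj0 * S * proj0) * hᵀ := by rw [← hp, ← hp2]; simp only [mul_assoc]
      _ = proj0 * S * proj0 := by
        rw [h0, mul_smul_comm, smul_mul_assoc, hp']
  rw [deformCore, deformCore, h00]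
  simp only [mul_add, add_mul, mul_sub, sub_mul, mul_smul_comm, smul_mul_assoc, hp', mul_one, hh]

theorem trace_deformCore_conj {h : MR} (hh : h * hᵀ = 1) (hp : h * proj0 = proj0 * h) (κ ν : ℝ)
    (S : MR) : (deformCore κ ν (h * S * hᵀ)).trace = (deformCore κ ν S).trace := by
  rw [deformCore_conj hh hp, trace_mul_comm, ← mul_assoc, mul_eq_one_comm.1 hh, one_mul]

/-- `deform` is equivariant under orthogonal matrices that preserve the first coordinate line. -/
theorem deform_conj {h : MR} (hh : h * hᵀ = 1) (hp : h * proj0 = proj0 * h) (κ ν : ℝ) (S : MR) :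
    deform κ ν (h * S * hᵀ) = h * deform κ ν S * hᵀ := by
  have hp' := proj0_conj hh hp
  have hdet : (h * deformCore κ ν S * hᵀ + proj0).det = (deformCore κ ν S + proj0).det := by
    rw [← det_conj hh (deformCore κ ν S + proj0), mul_add, add_mul, hp']
  rw [deform, trace_deformCore_conj hh hp, deformCore_conj hh hp, hdet, deform, mul_sub, sub_mul,
    mul_smul_comm, smul_mul_assoc, hp']

/-- The determinant of `κ S + ν` on the complement of the first basis vector is
`κ² D + κ ν t + ν²`, where `D` and `t` are the determinant and the trace for `S`.  It is less than `1`
by assumption and positive, so `deform κ ν S` is adapted again. -/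
theorem adapted_deform {S : MR} (hS : Adapted S) {κ ν : ℝ} (hκ : 0 ≤ κ) (hν : 0 ≤ ν)
    (h : 0 < κ + ν)
    (hD : κ ^ 2 * (deformCore 1 0 S + proj0).det + κ * ν * (deformCore 1 0 S).trace + ν ^ 2 < 1) :
    Adapted (deform κ ν S) := by
  obtain ⟨a, b, c, d, rfl, ha, hD0, hD1, ht⟩ := hS
  have h1 : (deformCore 1 0 (blockMat a b c d)).trace = b + d := by
    rw [deformCore_blockMat, trace_fin_three]
    simp [blockMat]
  have h2 : (deformCore 1 0 (blockMat a b c d) + proj0).det = b * d - c * c := by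
    rw [deformCore_blockMat, det_fin_three]
    simp [blockMat, proj0]
  rw [h1, h2] at hD
  have htpos : 0 < b + d := by
    rw [ht]
    exact mul_pos ha (by linarith)
  set D' := κ ^ 2 * (b * d - c * c) + κ * ν * (b + d) + ν ^ 2 with hD'
  have hdet : (κ * b + ν) * (κ * d + ν) - κ * c * (κ * c) = D' := by
    rw [hD']
    ring
  rw [deform_blockMat]
  refine ⟨_, _, _, _, rfl, ?_, ?_, ?_, ?_⟩
  · refine div_pos ?_ (by linarith)
    rcases hκ.eq_or_lt with h3 | h3
    · rw [← h3]
      linarith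
    · have := mul_pos h3 htpos
      linarith
  · rw [hdet]
    rcases hκ.eq_or_lt with h3 | h3
    · have : 0 < ν := by linarith
      rw [hD', ← h3]
      nlinarith
    · have h4 := mul_pos (pow_pos h3 2) hD0
      have h5 := mul_nonneg (mul_nonneg hκ hν) htpos.le
      have h6 := sq_nonneg ν
      rw [hD']
      linarith
  · rw [hdet]
    exact hD
  · rw [hdet, div_mul_cancel₀ _ (by linarith)]
    ring

theorem Adapted.core {S : MR} (hS : Adapted S) :
    0 < (deformCore 1 0 S).trace ∧ 0 < (deformCore 1 0 S + proj0).det ∧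
      (deformCore 1 0 S + proj0).det < 1 := by
  obtain ⟨a, b, c, d, rfl, ha, hD0, hD1, ht⟩ := hS
  have h1 : (deformCore 1 0 (blockMat a b c d)).trace = b + d := by
    rw [deformCore_blockMat, trace_fin_three]
    simp [blockMat]
  have h2 : (deformCore 1 0 (blockMat a b c d) + proj0).det = b * d - c * c := by
    rw [deformCore_blockMat, det_fin_three]
    simp [blockMat, proj0]
  rw [h1, h2]
  exact ⟨by rw [ht]; exact mul_pos ha (by linarith), hD0, hD1⟩

theorem Adapted.det_deformCore {S : MR} (hS : Adapted S) (κ ν : ℝ) :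
    (deformCore κ ν S + proj0).det = κ ^ 2 * (deformCore 1 0 S + proj0).det +
      κ * ν * (deformCore 1 0 S).trace + ν ^ 2 := by
  obtain ⟨a, b, c, d, rfl, -⟩ := hS
  rw [deformCore_blockMat, deformCore_blockMat, det_fin_three, det_fin_three, trace_fin_three]
  simp [blockMat, proj0]
  ring

theorem Adapted.deform_one_zero {S : MR} (hS : Adapted S) : deform 1 0 S = S := by
  obtain ⟨a, b, c, d, rfl, ha, hD0, hD1, ht⟩ := hS
  rw [deform_blockMat]
  have : (1 * (b + d) + 2 * 0) / (1 - (1 ^ 2 * (b * d - c * c) + 1 * 0 * (b + d) + 0 ^ 2)) = a := by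
    rw [div_eq_iff (by linarith)]
    linarith
  rw [this]
  simp

theorem Adapted.deform_zero_zero {S : MR} (hS : Adapted S) : deform 0 0 S = 0 := by
  obtain ⟨a, b, c, d, rfl, -⟩ := hS
  rw [deform_blockMat]
  ext i j
  fin_cases i <;> fin_cases j <;> simp [blockMat]

/-- The value at which all deformations end. -/
noncomputable def stdMat : MR := blockMat (4 / 3) (1 / 2) 0 (1 / 2)

theorem Adapted.deform_zero_half {S : MR} (hS : Adapted S) : deform 0 (1 / 2) S = stdMat := by
  obtain ⟨a, b, c, d, rfl, -⟩ := hS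
  rw [deform_blockMat, stdMat]
  norm_num

theorem adapted_stdMat : Adapted stdMat := ⟨_, _, _, _, rfl, by norm_num⟩

theorem continuous_deformCore {Y : Type*} [TopologicalSpace Y] {κ ν : Y → ℝ} {S : Y → MR}
    {s : Set Y} (hκ : ContinuousOn κ s) (hν : ContinuousOn ν s) (hS : ContinuousOn S s) :
    ContinuousOn (fun y => deformCore (κ y) (ν y) (S y)) s := by
  have h0 : ContinuousOn (fun y => S y 0 0) s :=
    (continuous_id.matrix_elem (0 : Fin 3) (0 : Fin 3)).comp_continuousOn hS
  exact (hκ.smul (hS.sub (h0.smul continuousOn_const))).add (hν.smul continuousOn_const)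

theorem continuousOn_deform {Y : Type*} [TopologicalSpace Y] {κ ν : Y → ℝ} {S : Y → MR}
    {s : Set Y} (hκ : ContinuousOn κ s) (hν : ContinuousOn ν s) (hS : ContinuousOn S s)
    (hne : ∀ y ∈ s, (deformCore (κ y) (ν y) (S y) + proj0).det < 1) :
    ContinuousOn (fun y => deform (κ y) (ν y) (S y)) s := by
  have h1 := continuous_deformCore hκ hν hS
  have h2 : ContinuousOn (fun y => (deformCore (κ y) (ν y) (S y)).trace) s :=
    continuous_id.matrix_trace.comp_continuousOn h1
  have h3 : ContinuousOn (fun y => (deformCore (κ y) (ν y) (S y) + proj0).det) s :=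
    continuous_id.matrix_det.comp_continuousOn (h1.add continuousOn_const)
  exact h1.sub ((h2.div (continuousOn_const.sub h3) fun y hy =>
    (sub_pos.2 (hne y hy)).ne').smul continuousOn_const)

/-- Deformations of symmetric matrices that pass to pairs of special Lagrangian subbundles: they
do not depend on the choice of a basis that is adapted to the negative eigenspace. -/
structure IsDeformation (Φ : I → MR → MR) : Prop where
  conj : ∀ s {h : MR} (S), h * hᵀ = 1 → h * proj0 = proj0 * h →
    Φ s (h * S * hᵀ) = h * Φ s S * hᵀ
  continuousOn : ContinuousOn (fun q : I × MR => Φ q.1 q.2) {q | Adapted q.2}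
  adapted_or : ∀ s {S}, Adapted S → Adapted (Φ s S) ∨ Φ s S = 0

/-- The deformation of a matrix to zero. -/
noncomputable def shrink (s : I) (S : MR) : MR := deform s 0 S

theorem shrink_lt {S : MR} (hS : Adapted S) (s : I) :
    (deformCore s 0 S + proj0).det < 1 := by
  obtain ⟨h1, h2, h3⟩ := hS.core
  rw [hS.det_deformCore]
  have h4 : (s : ℝ) ^ 2 ≤ 1 := pow_le_one₀ s.2.1 s.2.2
  nlinarith [sq_nonneg (s : ℝ)]

theorem adapted_shrink {S : MR} (hS : Adapted S) {s : I} (hs : 0 < s) : Adapted (shrink s S) := by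
  refine adapted_deform hS s.2.1 le_rfl ?_ ?_
  · rw [add_zero]
    exact hs
  · rw [← hS.det_deformCore]
    exact shrink_lt hS s

theorem isDeformation_shrink : IsDeformation shrink where
  conj s h S hh hp := deform_conj hh hp _ _ S
  continuousOn := continuousOn_deform (continuous_subtype_val.comp continuous_fst).continuousOn
    continuousOn_const continuous_snd.continuousOn fun q hq => shrink_lt hq q.1
  adapted_or s S hS := by
    rcases eq_or_lt_of_le (unitInterval.nonneg' : 0 ≤ s) with rfl | h
    · exact Or.inr hS.deform_zero_zero
    · exact Or.inl (adapted_shrink hS h)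

/-- The factor that keeps the determinant less than `1` during the deformation to `stdMat`. -/
noncomputable def stdFactor (s : I) (S : MR) : ℝ :=
  (1 + (s : ℝ) * (1 - s) * (deformCore 1 0 S).trace)⁻¹

/-- The deformation of a matrix to `stdMat`. -/
noncomputable def standardize (s : I) (S : MR) : MR :=
  deform ((1 - s) * stdFactor s S) (s / 2 * stdFactor s S) S

theorem one_le_stdFactor_inv {S : MR} (hS : Adapted S) (s : I) :
    1 ≤ 1 + (s : ℝ) * (1 - s) * (deformCore 1 0 S).trace := by
  have := mul_nonneg (mul_nonneg s.2.1 (sub_nonneg.2 s.2.2)) hS.core.1.le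
  linarith

theorem stdFactor_pos {S : MR} (hS : Adapted S) (s : I) : 0 < stdFactor s S :=
  inv_pos.2 (zero_lt_one.trans_le (one_le_stdFactor_inv hS s))

/-- For `κ = 1 - s` and `ν = s / 2`, the term `κ ν t` of the determinant may exceed `1`; `stdFactor` is
chosen to compensate for it. -/
theorem standardize_lt {S : MR} (hS : Adapted S) (s : I) :
    (deformCore ((1 - s) * stdFactor s S) (s / 2 * stdFactor s S) S + proj0).det < 1 := by
  obtain ⟨h1, h2, h3⟩ := hS.core
  rw [hS.det_deformCore]
  have hm := one_le_stdFactor_inv hS s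
  have hr : stdFactor s S * (1 + (s : ℝ) * (1 - s) * (deformCore 1 0 S).trace) = 1 :=
    inv_mul_cancel₀ (by linarith)
  set D := (deformCore 1 0 S + proj0).det
  set t := (deformCore 1 0 S).trace
  set r := stdFactor s S
  obtain ⟨s, hs0, hs1⟩ := s
  simp only at hr hm ⊢
  have hr0 : 0 < r := stdFactor_pos hS _
  have h5 : (1 - s) ^ 2 * D + s ^ 2 / 4 < 1 := by
    rcases hs0.eq_or_lt with h | h
    · rw [← h]
      linarith
    · nlinarith [mul_nonneg (sq_nonneg (1 - s)) (sub_nonneg.2 h3.le)]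
  have h6 : (1 - s) ^ 2 * D + (1 - s) * (s / 2) * t + s ^ 2 / 4 < (1 + s * (1 - s) * t) ^ 2 := by
    have : 0 ≤ s * (1 - s) * t := mul_nonneg (mul_nonneg hs0 (by linarith)) h1.le
    nlinarith [sq_nonneg (s * (1 - s) * t)]
  calc ((1 - s) * r) ^ 2 * D + (1 - s) * r * (s / 2 * r) * t + (s / 2 * r) ^ 2
      = r ^ 2 * ((1 - s) ^ 2 * D + (1 - s) * (s / 2) * t + s ^ 2 / 4) := by ring
    _ < r ^ 2 * (1 + s * (1 - s) * t) ^ 2 := mul_lt_mul_of_pos_left h6 (by positivity)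
    _ = 1 := by rw [← mul_pow, hr, one_pow]

theorem adapted_standardize {S : MR} (hS : Adapted S) (s : I) : Adapted (standardize s S) := by
  have h := stdFactor_pos hS s
  refine adapted_deform hS (mul_nonneg (sub_nonneg.2 s.2.2) h.le)
    (mul_nonneg (div_nonneg s.2.1 zero_le_two) h.le) ?_ ?_
  · rw [← add_mul]
    refine mul_pos ?_ h
    have := s.2.2
    have := s.2.1
    linarith
  · rw [← hS.det_deformCore]
    exact standardize_lt hS s

theorem isDeformation_standardize : IsDeformation standardize where
  conj s h S hh hp := by
    rw [standardize, stdFactor, trace_deformCore_conj hh hp, deform_conj hh hp]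
    rfl
  continuousOn := by
    have hs : Continuous fun q : I × MR => (q.1 : ℝ) := continuous_subtype_val.comp continuous_fst
    have hf : ContinuousOn (fun q : I × MR => stdFactor q.1 q.2) {q | Adapted q.2} := by
      refine ContinuousOn.inv₀ ?_ fun q hq => (zero_lt_one.trans_le (one_le_stdFactor_inv hq _)).ne'
      refine continuousOn_const.add (((hs.mul (continuous_const.sub hs)).continuousOn).mul ?_)
      exact continuous_id.matrix_trace.comp_continuousOn (continuous_deformCore continuousOn_const
        continuousOn_const continuous_snd.continuousOn)
    exact continuousOn_deform ((continuous_const.sub hs).continuousOn.mul hf)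
      ((hs.div_const 2).continuousOn.mul hf) continuous_snd.continuousOn
      fun q hq => standardize_lt hq q.1
  adapted_or s S hS := Or.inl (adapted_standardize hS s)

theorem standardize_zero {S : MR} (hS : Adapted S) : standardize 0 S = S := by
  rw [standardize, stdFactor]
  simp [hS.deform_one_zero]

theorem standardize_one {S : MR} (hS : Adapted S) : standardize 1 S = stdMat := by
  rw [standardize, stdFactor]
  simpa using hS.deform_zero_half

/-! ### Continuous sections in coordinates -/

theorem eq_inv_det_smul_adjugate {A : M3} {c : Fin 3 → ℂ} (hA : A.det ≠ 0) :
    c = A.det⁻¹ • (A.adjugate *ᵥ (A *ᵥ c)) := by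
  rw [mulVec_mulVec, adjugate_mul, smul_mulVec, one_mulVec, smul_smul, inv_mul_cancel₀ hA, one_smul]

section Continuity

variable {B : Type*} [TopologicalSpace B] {U : Set B} {A : B → M3} {b₀ : B}

theorem continuousWithinAt_adjugate (hA : ContinuousWithinAt A U b₀) :
    ContinuousWithinAt (fun b => (A b).adjugate) U b₀ := by
  have hF : Continuous fun A : M3 => A.adjugate := Continuous.matrix_adjugate continuous_id
  exact hF.continuousAt.comp_continuousWithinAt hA

theorem continuousWithinAt_det (hA : ContinuousWithinAt A U b₀) :
    ContinuousWithinAt (fun b => (A b).det) U b₀ := by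
  have hF : Continuous fun A : M3 => A.det := Continuous.matrix_det continuous_id
  exact hF.continuousAt.comp_continuousWithinAt hA

theorem continuousWithinAt_mulVec {y : B → Fin 3 → ℂ} (hA : ContinuousWithinAt A U b₀)
    (hy : ContinuousWithinAt y U b₀) : ContinuousWithinAt (fun b => A b *ᵥ y b) U b₀ := by
  have hG : Continuous fun q : M3 × (Fin 3 → ℂ) => q.1 *ᵥ q.2 :=
    Continuous.matrix_mulVec continuous_fst continuous_snd
  exact hG.continuousAt.comp_continuousWithinAt (hA.prodMk hy)

/-- Solutions of continuous invertible linear systems are continuous. -/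
theorem continuousWithinAt_of_mulVec {c : B → Fin 3 → ℂ} (hA : ContinuousWithinAt A U b₀)
    (hy : ContinuousWithinAt (fun b => A b *ᵥ c b) U b₀) (hd : (A b₀).det ≠ 0) :
    ContinuousWithinAt c U b₀ := by
  have hfin : ContinuousWithinAt (fun b => (A b).det⁻¹ • ((A b).adjugate *ᵥ (A b *ᵥ c b))) U b₀ :=
    ((continuousWithinAt_det hA).inv₀ hd).smul
      (continuousWithinAt_mulVec (continuousWithinAt_adjugate hA) hy)
  refine hfin.congr_of_eventuallyEq ?_ (eq_inv_det_smul_adjugate hd)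
  filter_upwards [(continuousWithinAt_det hA).eventually_ne hd] with b hb
  exact eq_inv_det_smul_adjugate hb

end Continuity

section Sections

variable {Z : Type*} [TopologicalSpace Z] {E : Z → Type*}
  [TopologicalSpace (TotalSpace (EuclideanSpace ℂ (Fin 3)) E)]
  [∀ z, NormedAddCommGroup (E z)] [∀ z, InnerProductSpace ℂ (E z)]

/-- A continuous unitary frame over a set, of volume `1`. -/
structure IsSU3Frame (Ω : SU3Structure E) (N : Set Z) (e : ∀ z, Fin 3 → E z) : Prop where
  continuousOn : ∀ i,
    ContinuousOn (fun z => (⟨z, e z i⟩ : TotalSpace (EuclideanSpace ℂ (Fin 3)) E)) N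
  orthonormal : ∀ z ∈ N, Orthonormal ℂ (e z)
  vol : ∀ z ∈ N, Ω.vol z (e z) = 1

theorem SU3Structure.exists_isSU3Frame (Ω : SU3Structure E) (z₀ : Z) :
    ∃ N ∈ 𝓝 z₀, ∃ e : ∀ z, Fin 3 → E z, IsSU3Frame Ω N e := by
  obtain ⟨N, hN, e, h1, h2⟩ := Ω.exists_frame z₀
  exact ⟨N, hN, fun z i => e i z, h1, fun z hz => (h2 z hz).1, fun z hz => (h2 z hz).2⟩

variable {Ω : SU3Structure E} {N : Set Z} {e : ∀ z, Fin 3 → E z} {B : Type*} [TopologicalSpace B]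
  {f : B → Z} {U : Set B}

theorem IsSU3Frame.continuousOn_comp (he : IsSU3Frame Ω N e) (hf : ContinuousOn f U)
    (hfN : ∀ b ∈ U, f b ∈ N) (i : Fin 3) :
    ContinuousOn (fun b => (⟨f b, e (f b) i⟩ : TotalSpace (EuclideanSpace ℂ (Fin 3)) E)) U :=
  (he.continuousOn i).comp hf hfN

variable [FiberBundle (EuclideanSpace ℂ (Fin 3)) E] [VectorBundle ℂ (EuclideanSpace ℂ (Fin 3)) E]

variable (E) in
theorem finrank_fibre (z : Z) : Module.finrank ℂ (E z) = 3 := by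
  have h := ((trivializationAt (EuclideanSpace ℂ (Fin 3)) E z).linearEquivAt ℂ z
    (mem_baseSet_trivializationAt _ E z)).finrank_eq
  rw [h, finrank_euclideanSpace_fin]

theorem trivializationAt_comb {z₀ z : Z}
    (hz : z ∈ (trivializationAt (EuclideanSpace ℂ (Fin 3)) E z₀).baseSet) (e : Fin 3 → E z)
    (c : Fin 3 → ℂ) : (trivializationAt (EuclideanSpace ℂ (Fin 3)) E z₀ ⟨z, comb e c⟩).2 =
      ∑ i, c i • (trivializationAt (EuclideanSpace ℂ (Fin 3)) E z₀ ⟨z, e i⟩).2 := by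
  have h := (trivializationAt (EuclideanSpace ℂ (Fin 3)) E z₀).coe_linearMapAt_of_mem (R := ℂ) hz
  have h1 := fun y => congrFun h y
  rw [← h1, comb_apply, map_sum]
  exact Finset.sum_congr rfl fun i _ => by rw [map_smul, h1]

/-- Sections with continuous coefficients are continuous. -/
theorem IsSU3Frame.continuousOn_comb (he : IsSU3Frame Ω N e) (hf : ContinuousOn f U)
    (hfN : ∀ b ∈ U, f b ∈ N) {c : B → Fin 3 → ℂ} (hc : ContinuousOn c U) :
    ContinuousOn (fun b => (⟨f b, comb (e (f b)) (c b)⟩ :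
      TotalSpace (EuclideanSpace ℂ (Fin 3)) E)) U := by
  intro b₀ hb₀
  rw [FiberBundle.continuousWithinAt_totalSpace]
  refine ⟨hf b₀ hb₀, ?_⟩
  set τ := trivializationAt (EuclideanSpace ℂ (Fin 3)) E (f b₀) with hτ
  have h1 : ∀ i, ContinuousWithinAt (fun b => (τ ⟨f b, e (f b) i⟩).2) U b₀ := fun i =>
    ((FiberBundle.continuousWithinAt_totalSpace _ _).1 (he.continuousOn_comp hf hfN i b₀ hb₀)).2
  have h2 : ContinuousWithinAt (fun b => ∑ i, c b i • (τ ⟨f b, e (f b) i⟩).2) U b₀ :=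
    tendsto_finsetSum _ fun i _ =>
      (((continuous_apply i).continuousAt.comp_continuousWithinAt (hc b₀ hb₀))).smul (h1 i)
  refine h2.congr_of_eventuallyEq ?_ ?_
  · have h3 : τ.baseSet ∈ 𝓝 (f b₀) :=
      τ.open_baseSet.mem_nhds (FiberBundle.mem_baseSet_trivializationAt' _)
    filter_upwards [hf b₀ hb₀ h3] with b hb
    exact trivializationAt_comb hb _ _
  · exact trivializationAt_comb (FiberBundle.mem_baseSet_trivializationAt' _) _ _

/-- The coordinates of the vectors of a frame in a local trivialization of `E`. -/
noncomputable def trivMatrix (z₀ : Z) {z : Z} (e : Fin 3 → E z) : M3 :=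
  Matrix.of fun i j => (trivializationAt (EuclideanSpace ℂ (Fin 3)) E z₀ ⟨z, e j⟩).2 i

theorem trivMatrix_mulVec {z₀ z : Z}
    (hz : z ∈ (trivializationAt (EuclideanSpace ℂ (Fin 3)) E z₀).baseSet) (e : Fin 3 → E z)
    (c : Fin 3 → ℂ) : trivMatrix z₀ e *ᵥ c = fun i =>
      (trivializationAt (EuclideanSpace ℂ (Fin 3)) E z₀ ⟨z, comb e c⟩).2 i := by
  ext i
  rw [trivializationAt_comb hz, WithLp.ofLp_sum, Finset.sum_apply]
  rw [mulVec, dotProduct]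
  exact Finset.sum_congr rfl fun j _ => mul_comm _ _

theorem det_trivMatrix_ne_zero {z₀ z : Z}
    (hz : z ∈ (trivializationAt (EuclideanSpace ℂ (Fin 3)) E z₀).baseSet) {e : Fin 3 → E z}
    (he : Orthonormal ℂ e) : (trivMatrix z₀ e).det ≠ 0 := by
  intro hd
  obtain ⟨v, hv, hεv⟩ := exists_mulVec_eq_zero_iff.2 hd
  rw [trivMatrix_mulVec hz] at hεv
  set τ := trivializationAt (EuclideanSpace ℂ (Fin 3)) E z₀
  have h3 : τ.linearEquivAt ℂ z hz (comb e v) = 0 := by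
    ext i
    exact congrFun hεv i
  have h4 : comb e v = 0 := (τ.linearEquivAt ℂ z hz).map_eq_zero_iff.1 h3
  exact hv (comb_injective he (h4.trans (map_zero _).symm))

/-- The coefficients of continuous sections are continuous. -/
theorem IsSU3Frame.continuousOn_coeff (he : IsSU3Frame Ω N e) (hf : ContinuousOn f U)
    (hfN : ∀ b ∈ U, f b ∈ N) {c : B → Fin 3 → ℂ}
    (hc : ContinuousOn (fun b => (⟨f b, comb (e (f b)) (c b)⟩ :
      TotalSpace (EuclideanSpace ℂ (Fin 3)) E)) U) : ContinuousOn c U := by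
  intro b₀ hb₀
  set τ := trivializationAt (EuclideanSpace ℂ (Fin 3)) E (f b₀) with hτ
  have hbase : f b₀ ∈ τ.baseSet := FiberBundle.mem_baseSet_trivializationAt' _
  have h1 : ∀ i, ContinuousWithinAt (fun b => (τ ⟨f b, e (f b) i⟩).2) U b₀ := fun i =>
    ((FiberBundle.continuousWithinAt_totalSpace _ _).1 (he.continuousOn_comp hf hfN i b₀ hb₀)).2
  have h2 : ContinuousWithinAt (fun b => (τ ⟨f b, comb (e (f b)) (c b)⟩).2) U b₀ :=
    ((FiberBundle.continuousWithinAt_totalSpace _ _).1 (hc b₀ hb₀)).2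
  have hproj : ∀ i, Continuous fun y : EuclideanSpace ℂ (Fin 3) => y i := fun i =>
    (EuclideanSpace.proj i : EuclideanSpace ℂ (Fin 3) →L[ℂ] ℂ).continuous
  have hε : ContinuousWithinAt (fun b => trivMatrix (f b₀) (e (f b))) U b₀ :=
    tendsto_pi_nhds.2 fun i => tendsto_pi_nhds.2 fun j =>
      (hproj i).continuousAt.tendsto.comp (h1 j)
  refine continuousWithinAt_of_mulVec hε ?_
    (det_trivMatrix_ne_zero hbase (he.orthonormal _ (hfN b₀ hb₀)))
  have hy : ContinuousWithinAt (fun b => (fun i => (τ ⟨f b, comb (e (f b)) (c b)⟩).2 i : Fin 3 → ℂ))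
      U b₀ := tendsto_pi_nhds.2 fun i => (hproj i).continuousAt.tendsto.comp h2
  refine hy.congr_of_eventuallyEq ?_ (trivMatrix_mulVec hbase _ _)
  filter_upwards [hf b₀ hb₀ (τ.open_baseSet.mem_nhds hbase)] with b hb
  exact trivMatrix_mulVec hb _ _

theorem IsSU3Frame.continuousOn_frameMul (he : IsSU3Frame Ω N e) (hf : ContinuousOn f U)
    (hfN : ∀ b ∈ U, f b ∈ N) {A : B → M3} (hA : ContinuousOn A U) (j : Fin 3) :
    ContinuousOn (fun b => (⟨f b, frameMul (e (f b)) (A b) j⟩ :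
      TotalSpace (EuclideanSpace ℂ (Fin 3)) E)) U :=
  he.continuousOn_comb hf hfN (c := fun b i => A b i j) (continuousOn_pi.2 fun i =>
    (continuous_id.matrix_elem i j).comp_continuousOn hA)

theorem IsSU3Frame.continuousOn_matrix (he : IsSU3Frame Ω N e) (hf : ContinuousOn f U)
    (hfN : ∀ b ∈ U, f b ∈ N) {A : B → M3}
    (hA : ∀ j, ContinuousOn (fun b => (⟨f b, frameMul (e (f b)) (A b) j⟩ :
      TotalSpace (EuclideanSpace ℂ (Fin 3)) E)) U) : ContinuousOn A U :=
  continuousOn_pi.2 fun i => continuousOn_pi.2 fun j =>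
    (continuous_apply i).comp_continuousOn
      (he.continuousOn_coeff hf hfN (c := fun b i => A b i j) (hA j))

end Sections

/-! ### Gluing sections over the unit interval -/

/-- Sections over an interval can be continued if every value extends to a local section. -/
theorem exists_section_unitInterval {F : I → Type*} {X : Type*} [TopologicalSpace X]
    (Φ : ∀ t, F t → X) (G : ∀ t, F t → Prop)
    (hloc : ∀ t₀, ∃ U ∈ 𝓝 t₀, ∀ a ∈ U, ∀ v : F a, G a v → ∃ s : ∀ t, F t, s a = v ∧
      ContinuousOn (fun t => Φ t (s t)) U ∧ ∀ t ∈ U, G t (s t))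
    (v₀ : F 0) (hv₀ : G 0 v₀) :
    ∃ s : ∀ t, F t, s 0 = v₀ ∧ Continuous (fun t => Φ t (s t)) ∧ ∀ t, G t (s t) := by
  classical
  choose U hU hs using hloc
  obtain ⟨τ, hτ0, hτ, ⟨n, hn⟩, hc⟩ := exists_monotone_Icc_subset_open_cover_unitInterval
    (c := fun t => interior (U t)) (fun _ => isOpen_interior)
    fun t _ => Set.mem_iUnion.2 ⟨t, mem_interior_iff_mem_nhds.2 (hU t)⟩
  have key : ∀ k, ∃ s : ∀ t, F t, s 0 = v₀ ∧ ContinuousOn (fun t => Φ t (s t)) (Set.Icc 0 (τ k)) ∧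
      ∀ t ∈ Set.Icc 0 (τ k), G t (s t) := by
    intro k
    induction k with
    | zero =>
      have h0 : ∀ t ∈ Set.Icc (0 : I) (τ 0), t = 0 := fun t ht => by
        rw [hτ0] at ht
        exact le_antisymm ht.2 ht.1
      obtain ⟨s, hs0, -⟩ := hs 0 0 (mem_of_mem_nhds (hU 0)) v₀ hv₀
      refine ⟨s, hs0, ?_, fun t ht => ?_⟩
      · rw [hτ0, Set.Icc_self]
        exact continuousOn_singleton _ _
      · obtain rfl := h0 t ht
        rwa [hs0]
    | succ k ih =>
      obtain ⟨s, hs0, hsc, hsG⟩ := ih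
      obtain ⟨i, hi⟩ := hc k
      have hle : τ k ≤ τ (k + 1) := hτ (Nat.le_succ k)
      have hi' := hi.trans interior_subset
      have hk0 : τ k ∈ Set.Icc 0 (τ k) := ⟨unitInterval.nonneg', le_rfl⟩
      obtain ⟨s', hs'0, hs'c, hs'G⟩ := hs i (τ k) (hi' ⟨le_rfl, hle⟩) (s (τ k)) (hsG _ hk0)
      let r : ∀ t, F t := fun t => if t ≤ τ k then s t else s' t
      have hr1 : ∀ t ∈ Set.Icc 0 (τ k), r t = s t := fun t ht => if_pos ht.2
      have hr2 : ∀ t ∈ Set.Icc (τ k) (τ (k + 1)), r t = s' t := fun t ht => by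
        rcases ht.1.eq_or_lt with h | h
        · subst h
          exact (if_pos le_rfl).trans hs'0.symm
        · exact if_neg (not_le.2 h)
      have hun : Set.Icc 0 (τ (k + 1)) = Set.Icc 0 (τ k) ∪ Set.Icc (τ k) (τ (k + 1)) :=
        (Set.Icc_union_Icc_eq_Icc unitInterval.nonneg' hle).symm
      refine ⟨r, ?_, ?_, ?_⟩
      · rw [hr1 0 ⟨le_rfl, unitInterval.nonneg'⟩, hs0]
      · rw [hun]
        refine ContinuousOn.union_of_isClosed ?_ ?_ isClosed_Icc isClosed_Icc
        · exact hsc.congr fun t ht => by simp only [hr1 t ht]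
        · exact (hs'c.mono hi').congr fun t ht => by simp only [hr2 t ht]
      · rw [hun]
        rintro t (ht | ht)
        · rw [hr1 t ht]
          exact hsG t ht
        · rw [hr2 t ht]
          exact hs'G t (hi' ht)
  obtain ⟨s, hs0, hsc, hsG⟩ := key n
  have h1 : Set.Icc 0 (τ n) = Set.univ := by
    rw [hn n le_rfl]
    exact Set.eq_univ_of_forall fun t => ⟨unitInterval.nonneg', unitInterval.le_one'⟩
  rw [h1] at hsc hsG
  exact ⟨s, hs0, continuousOn_univ.1 hsc, fun t => hsG t trivial⟩

/-! ### Continuity on closed one-manifolds -/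

section Circles

variable {Z : Type*} [TopologicalSpace Z]

theorem coe_circleParam {p : ConnectedComponents Z → I → Z}
    (hr : ∀ z : Z, Set.range (p z) = connectedComponent z) (Γ : ConnectedComponents Z) (t : I) :
    (p Γ t : ConnectedComponents Z) = Γ := by
  obtain ⟨x, rfl⟩ := ConnectedComponents.surjective_coe Γ
  have h : p x t ∈ connectedComponent x := hr x ▸ Set.mem_range_self t
  exact ConnectedComponents.coe_eq_coe'.2 h

variable [ChartedSpace ℝ Z] [T2Space Z]

variable (Z) in
/-- All components of a closed one-manifold can be parametrized by circles. -/
theorem exists_circleParams [CompactSpace Z] : ∃ p : ConnectedComponents Z → I → Z,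
    (∀ Γ, IsCircleParam (p Γ)) ∧ ∀ z : Z, Set.range (p z) = connectedComponent z := by
  have h : ∀ Γ : ConnectedComponents Z, ∃ p : I → Z, IsCircleParam p ∧
      ∀ z : Z, (z : ConnectedComponents Z) = Γ → Set.range p = connectedComponent z := by
    intro Γ
    obtain ⟨x, rfl⟩ := ConnectedComponents.surjective_coe Γ
    obtain ⟨p, hp, hr⟩ := exists_isCircleParam (fun y : Z => exists_open_arc y) x
    exact ⟨p, hp, fun z hz => hr.trans (ConnectedComponents.coe_eq_coe.1 hz).symm⟩
  choose p hp hr using h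
  exact ⟨p, hp, fun z => hr z z rfl⟩

/-- A function on a closed one-manifold, with parameters in a compact space, is continuous if its
pull-backs under the parametrizations of the components are. -/
theorem continuous_of_circleParams {p : ConnectedComponents Z → I → Z}
    (hp : ∀ Γ, IsCircleParam (p Γ)) (hr : ∀ z : Z, Set.range (p z) = connectedComponent z)
    {K : Type*} [TopologicalSpace K] [CompactSpace K] [T2Space K] {Y : Type*} [TopologicalSpace Y]
    {F : Z × K → Y} (hF : ∀ Γ, Continuous fun q : I × K => F (p Γ q.1, q.2)) : Continuous F := by
  rw [continuous_iff_continuousAt]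
  rintro ⟨z₀, k₀⟩
  have : LocallyConnectedSpace Z := ChartedSpace.locallyConnectedSpace ℝ Z
  let Γ : ConnectedComponents Z := z₀
  let q : I × K → Z × K := fun x => (p Γ x.1, x.2)
  have hq : Continuous q := ((hp Γ).continuous.comp continuous_fst).prodMk continuous_snd
  intro O hO
  obtain ⟨O', hO'O, hO', hmem⟩ := mem_nhds_iff.1 hO
  -- the continuous map `q` from a compact space is closed, so the bad points form a closed set
  have hC : IsClosed (q '' ((fun x => F (q x)) ⁻¹' O')ᶜ) :=
    hq.isClosedMap _ (hO'.preimage (hF Γ)).isClosed_compl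
  have h1 : (z₀, k₀) ∉ q '' ((fun x => F (q x)) ⁻¹' O')ᶜ := by
    rintro ⟨x, hx, hxz⟩
    apply hx
    rw [Set.mem_preimage, hxz]
    exact hmem
  have h2 : connectedComponent z₀ ×ˢ (Set.univ : Set K) ∈ 𝓝 (z₀, k₀) :=
    (isOpen_connectedComponent.prod isOpen_univ).mem_nhds ⟨mem_connectedComponent, trivial⟩
  change ∀ᶠ x in 𝓝 (z₀, k₀), F x ∈ O
  filter_upwards [hC.isOpen_compl.mem_nhds h1, h2] with ⟨z, k⟩ hz hz'
  rw [← hr z₀] at hz'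
  obtain ⟨t, rfl⟩ := hz'.1
  by_contra hcon
  exact hz ⟨(t, k), fun h => hcon (hO'O h), rfl⟩

end Circles

/-! ### Bundles with structure group `SU(3)` over closed one-manifolds are trivial -/

section Triviality

variable {Z : Type*} [TopologicalSpace Z] {E : Z → Type*}
  [TopologicalSpace (TotalSpace (EuclideanSpace ℂ (Fin 3)) E)]
  [∀ z, NormedAddCommGroup (E z)] [∀ z, InnerProductSpace ℂ (E z)]

/-- The vectors of a basis of a fibre as points of the total space. -/
def toTotal {z : Z} (v : Fin 3 → E z) : Fin 3 → TotalSpace (EuclideanSpace ℂ (Fin 3)) E :=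
  fun i => ⟨z, v i⟩

/-- Unitary bases of volume `1`. -/
def SU3Structure.IsBasis (Ω : SU3Structure E) {z : Z} (v : Fin 3 → E z) : Prop :=
  Orthonormal ℂ v ∧ Ω.vol z v = 1

theorem SU3Structure.IsBasis.frameMul {Ω : SU3Structure E} {z : Z} {v : Fin 3 → E z}
    (hv : Ω.IsBasis v) (m : SU3) : Ω.IsBasis (frameMul v (m : M3)) :=
  ⟨orthonormal_frameMul hv.1 m.star_mul_self, by rw [vol_frameMul, hv.2, m.det_eq, one_mul]⟩

theorem SU3Structure.IsBasis.transport {Ω : SU3Structure E} {z z' : Z} (h : z = z')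
    {v : Fin 3 → E z} (hv : Ω.IsBasis v) :
    ∃ w : Fin 3 → E z', Ω.IsBasis w ∧ toTotal w = toTotal v := by
  subst h
  exact ⟨v, hv, rfl⟩

variable {Ω : SU3Structure E}

theorem IsSU3Frame.isBasis {N : Set Z} {e : ∀ z, Fin 3 → E z} (he : IsSU3Frame Ω N e) {z : Z}
    (hz : z ∈ N) : Ω.IsBasis (e z) := ⟨he.orthonormal z hz, he.vol z hz⟩

variable [FiberBundle (EuclideanSpace ℂ (Fin 3)) E] [VectorBundle ℂ (EuclideanSpace ℂ (Fin 3)) E]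

theorem SU3Structure.IsBasis.exists_frameMul {z : Z} {v w : Fin 3 → E z} (hv : Ω.IsBasis v)
    (hw : Ω.IsBasis w) : ∃ m : SU3, w = SLPairs.frameMul v (m : M3) := by
  obtain ⟨A, rfl⟩ := SLPairs.exists_frameMul hv.1 (finrank_fibre E z) w
  have hdet : A.det = 1 := by
    have := hw.2
    rwa [vol_frameMul, hv.2, mul_one] at this
  have hstar : star A * A = 1 := by
    ext i j
    rw [one_apply, ← orthonormal_iff_ite.1 hw.1 i j, frameMul_eq_comb, frameMul_eq_comb,
      inner_comb hv.1]
    rfl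
  exact ⟨⟨A, mem_specialUnitaryGroup_iff.2 ⟨mem_unitaryGroup_iff'.2 hstar, hdet⟩⟩, rfl⟩

theorem continuous_toTotal_frameMul (Ω : SU3Structure E) {B : Type*} [TopologicalSpace B] {f : B → Z}
    (hf : Continuous f) {ε : ∀ b, Fin 3 → E (f b)} (hε : Continuous fun b => toTotal (ε b))
    {A : B → M3} (hA : Continuous A) : Continuous fun b => toTotal (frameMul (ε b) (A b)) := by
  rw [continuous_iff_continuousAt]
  intro b₀
  obtain ⟨N, hN, e, he⟩ := Ω.exists_isSU3Frame (f b₀)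
  have hU : f ⁻¹' N ∈ 𝓝 b₀ := hf.continuousAt hN
  have h1 : ∀ b, ∃ M : M3, b ∈ f ⁻¹' N → ε b = frameMul (e (f b)) M := fun b => by
    by_cases hb : b ∈ f ⁻¹' N
    · obtain ⟨M, hM⟩ := SLPairs.exists_frameMul (he.orthonormal _ hb) (finrank_fibre E _) (ε b)
      exact ⟨M, fun _ => hM⟩
    · exact ⟨0, fun h => (hb h).elim⟩
  choose M hM using h1
  have hMc : ContinuousOn M (f ⁻¹' N) := by
    refine he.continuousOn_matrix hf.continuousOn (fun _ h => h) fun j => ?_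
    refine ((continuous_apply j).comp hε).continuousOn.congr fun b hb => ?_
    rw [← hM b hb]
    rfl
  have h2 : ContinuousOn (fun b => toTotal (frameMul (ε b) (A b))) (f ⁻¹' N) := by
    refine continuousOn_pi.2 fun j => ?_
    refine (he.continuousOn_frameMul hf.continuousOn (fun _ h => h) (A := fun b => M b * A b)
      (hMc.mul hA.continuousOn) j).congr fun b hb => ?_
    change toTotal (frameMul (ε b) (A b)) j = ⟨f b, frameMul (e (f b)) (M b * A b) j⟩
    rw [← frameMul_frameMul, ← hM b hb]
    rfl
  exact h2.continuousAt hU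

/-- Frames along a loop: continue a frame along the loop, and then correct it by a path in `SU(3)` from
the identity to the matrix that relates its two ends. -/
theorem exists_frame_along (Ω : SU3Structure E) {p : I → Z} (hp : Continuous p)
    (h01 : p 0 = p 1) : ∃ ε : ∀ t, Fin 3 → E (p t), (∀ t, Ω.IsBasis (ε t)) ∧
      Continuous (fun t => toTotal (ε t)) ∧ toTotal (ε 0) = toTotal (ε 1) := by
  obtain ⟨N₀, hN₀, e₀, he₀⟩ := Ω.exists_isSU3Frame (p 0)
  obtain ⟨s, -, hsc, hsb⟩ := exists_section_unitInterval (F := fun t => Fin 3 → E (p t))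
    (fun t => toTotal) (fun t v => Ω.IsBasis v) (fun t₀ => by
      obtain ⟨N, hN, e, he⟩ := Ω.exists_isSU3Frame (p t₀)
      refine ⟨p ⁻¹' N, hp.continuousAt hN, fun a ha v hv => ?_⟩
      obtain ⟨m, hm⟩ := (he.isBasis ha).exists_frameMul hv
      exact ⟨fun t => frameMul (e (p t)) (m : M3), hm.symm, continuousOn_pi.2 fun j =>
        he.continuousOn_frameMul hp.continuousOn (fun _ h => h) continuousOn_const j,
        fun t ht => (he.isBasis ht).frameMul m⟩)
    (e₀ (p 0)) (he₀.isBasis (mem_of_mem_nhds hN₀))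
  obtain ⟨w, hw, hw0⟩ := (hsb 0).transport h01
  obtain ⟨m, rfl⟩ := (hsb 1).exists_frameMul hw
  let c : Path (1 : SU3) m := PathConnectedSpace.somePath 1 m
  refine ⟨fun t => frameMul (s t) (c t : M3), fun t => (hsb t).frameMul _,
    continuous_toTotal_frameMul Ω hp hsc (continuous_subtype_val.comp c.continuous), ?_⟩
  change toTotal (frameMul (s 0) (c 0 : M3)) = toTotal (frameMul (s 1) (c 1 : M3))
  rw [c.source, c.target, hw0]
  change toTotal (frameMul (s 0) 1) = _
  rw [frameMul_one]

/-- A bundle with structure group `SU(3)` over a closed one-manifold is trivial, because `SU(3)` is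
connected. -/
theorem SU3Structure.exists_global_frame [ChartedSpace ℝ Z] [T2Space Z] [CompactSpace Z]
    (Ω : SU3Structure E) : ∃ e : ∀ z, Fin 3 → E z, IsSU3Frame Ω Set.univ e := by
  obtain ⟨p, hp, hr⟩ := exists_circleParams Z
  choose ε hεb hεc hε01 using fun Γ => exists_frame_along Ω (hp Γ).continuous (hp Γ).closed
  have hz : ∀ z : Z, ∃ t, p z t = z := fun z => by
    have : z ∈ Set.range (p z) := (hr z).symm ▸ mem_connectedComponent
    exact this
  choose t ht using hz
  choose e heb het using fun z : Z => (hεb z (t z)).transport (ht z)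
  have key : ∀ Γ s, toTotal (e (p Γ s)) = toTotal (ε Γ s) := by
    intro Γ s
    rw [het]
    -- only the two ends of a parametrization define the same point, and there the frames agree
    have h1 : ∀ Γ', Γ' = Γ → ∀ t', p Γ' t' = p Γ s → toTotal (ε Γ' t') = toTotal (ε Γ s) := by
      intro Γ' hΓ t' ht'
      subst hΓ
      rcases (hp _).eq_or _ _ ht' with h | ⟨h, h'⟩ | ⟨h, h'⟩
      · rw [h]
      · rw [h, h', hε01]
      · rw [h, h', hε01]
    exact h1 _ (coe_circleParam hr Γ s) _ (ht _)
  have hcont : Continuous fun z => toTotal (e z) := by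
    have h2 := continuous_of_circleParams hp hr (K := Unit) (F := fun q => toTotal (e q.1))
      fun Γ => by
        simp only [key]
        exact (hεc Γ).comp continuous_fst
    exact h2.comp (continuous_id.prodMk (continuous_const (y := ())))
  exact ⟨e, fun i => ((continuous_apply i).comp hcont).continuousOn, fun z _ => (heb z).1,
    fun z _ => (heb z).2⟩

end Triviality

/-! ### Continuous orthonormalization -/

/-- A triangular matrix whose columns are orthogonal for the symmetric form `G`. -/
def orthMat (G : MR) : MR :=
  !![1, -G 0 1, G 0 1 * G 1 2 - G 0 2 * G 1 1; 0, G 0 0, G 0 1 * G 0 2 - G 0 0 * G 1 2;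
    0, 0, G 0 0 * G 1 1 - G 0 1 * G 0 1]

/-- The squared lengths of the columns of `orthMat G`. -/
def orthLen (G : MR) : Fin 3 → ℝ :=
  ![G 0 0, G 0 0 * (G 0 0 * G 1 1 - G 0 1 * G 0 1), (G 0 0 * G 1 1 - G 0 1 * G 0 1) * G.det]

theorem orthMat_conj {G : MR} (hG : Gᵀ = G) :
    (orthMat G)ᵀ * G * orthMat G = diagonal (orthLen G) := by
  have hs : ∀ i j, G i j = G j i := fun i j => by conv_lhs => rw [← hG, transpose_apply]
  have hdet := det_fin_three G
  have h10 := hs 1 0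
  have h20 := hs 2 0
  have h21 := hs 2 1
  rw [h10, h20, h21] at hdet
  ext i j
  fin_cases i <;> fin_cases j <;>
    simp [mul_apply, Fin.sum_univ_three, orthMat, orthLen, h10, h20, h21, hdet] <;> ring

theorem orthLen_pos {G : MR} (hG : Gᵀ = G) (hpos : ∀ x, x ≠ 0 → 0 < x ⬝ᵥ G *ᵥ x) (j : Fin 3) :
    0 < orthLen G j := by
  have key : ∀ j, (fun i => orthMat G i j) ≠ 0 → 0 < orthLen G j := fun j hj => by
    have h1 := hpos _ hj
    have h2 := congrFun (congrFun (orthMat_conj hG) j) j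
    rw [diagonal_apply_eq] at h2
    rw [← h2, mul_assoc]
    exact h1
  have h0 : 0 < orthLen G 0 := key 0 fun h => by simpa [orthMat] using congrFun h 0
  have h1 : 0 < orthLen G 1 := key 1 fun h => h0.ne' (by simpa [orthMat, orthLen] using congrFun h 1)
  have h2 : 0 < orthLen G 2 := key 2 fun h => by
    have h3 : G 0 0 * G 1 1 - G 0 1 * G 0 1 = 0 := by simpa [orthMat] using congrFun h 2
    have h4 : orthLen G 1 = G 0 0 * (G 0 0 * G 1 1 - G 0 1 * G 0 1) := rfl
    rw [h4, h3, mul_zero] at h1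
    exact h1.false
  fin_cases j
  exacts [h0, h1, h2]

/-- The Gram-Schmidt process: a triangular matrix with columns that are orthonormal for `G`. -/
noncomputable def gsMat (G : MR) : MR := orthMat G * diagonal fun j => (√(orthLen G j))⁻¹

theorem gsMat_conj {G : MR} (hG : Gᵀ = G) (hpos : ∀ x, x ≠ 0 → 0 < x ⬝ᵥ G *ᵥ x) :
    (gsMat G)ᵀ * G * gsMat G = 1 := by
  have h1 : (gsMat G)ᵀ * G * gsMat G = (diagonal fun j => (√(orthLen G j))⁻¹) *
      ((orthMat G)ᵀ * G * orthMat G) * diagonal fun j => (√(orthLen G j))⁻¹ := by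
    rw [gsMat, transpose_mul, diagonal_transpose]
    simp only [mul_assoc]
  rw [h1, orthMat_conj hG, diagonal_mul_diagonal, diagonal_mul_diagonal, ← diagonal_one]
  congr 1
  ext j
  have h2 := Real.sqrt_pos.2 (orthLen_pos hG hpos j)
  have h3 := Real.mul_self_sqrt (orthLen_pos hG hpos j).le
  field_simp
  rw [sq, h3]

theorem gsMat_apply_zero (G : MR) : gsMat G 1 0 = 0 ∧ gsMat G 2 0 = 0 := by
  simp [gsMat, mul_diagonal, orthMat]

theorem continuousOn_gsMat :
    ContinuousOn gsMat {G | Gᵀ = G ∧ ∀ x, x ≠ 0 → 0 < x ⬝ᵥ G *ᵥ x} := by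
  have he : ∀ i j, Continuous fun G : MR => G i j := fun i j => continuous_id.matrix_elem i j
  have hm : Continuous orthMat := by
    refine continuous_matrix fun i j => ?_
    fin_cases i <;> fin_cases j <;> simp [orthMat] <;> fun_prop
  have hd : Continuous fun G : MR => G.det := Continuous.matrix_det continuous_id
  have hl : ∀ j, Continuous fun G => orthLen G j := fun j => by
    fin_cases j <;> simp [orthLen] <;> fun_prop
  have hr : ContinuousOn (fun G => diagonal fun j => (√(orthLen G j))⁻¹ : MR → MR)
      {G | Gᵀ = G ∧ ∀ x, x ≠ 0 → 0 < x ⬝ᵥ G *ᵥ x} :=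
    (Continuous.matrix_diagonal continuous_id).comp_continuousOn (continuousOn_pi.2 fun j =>
      ((Real.continuous_sqrt.comp (hl j)).continuousOn).inv₀ fun G hG =>
        (Real.sqrt_pos.2 (orthLen_pos hG.1 hG.2 j)).ne')
  exact hm.continuousOn.mul hr

open scoped ComplexOrder in
theorem gram_pos {A : M3} (hA : A.det ≠ 0) {G : MR} (hG : star A * A = cx G) :
    Gᵀ = G ∧ ∀ x, x ≠ 0 → 0 < x ⬝ᵥ G *ᵥ x := by
  constructor
  · apply cx_injective
    rw [← star_cx, ← hG, star_mul, star_star]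
  · intro x hx
    have h1 : A *ᵥ rv x ≠ 0 := fun h =>
      hx (rv_injective ((eq_zero_of_mulVec_eq_zero hA h).trans rv_zero.symm))
    have h2 : star (A *ᵥ rv x) ⬝ᵥ (A *ᵥ rv x) = ((x ⬝ᵥ G *ᵥ x : ℝ) : ℂ) := by
      rw [star_mulVec, ← dotProduct_mulVec, mulVec_mulVec, ← star_eq_conjTranspose, hG,
        cx_mulVec_rv]
      simp [dotProduct, rv]
    have h3 := dotProduct_star_self_pos_iff.2 h1
    rw [h2] at h3
    exact_mod_cast h3

theorem continuous_reMat : Continuous reMat :=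
  continuous_matrix fun i j => Complex.continuous_re.comp (continuous_id.matrix_elem i j)

theorem continuous_imMat : Continuous imMat :=
  continuous_matrix fun i j => Complex.continuous_im.comp (continuous_id.matrix_elem i j)

theorem reMat_cx (S : MR) : reMat (cx S) = S := rfl

/-- If the columns of `A` span special Lagrangian subspaces, then their orthonormalizations are
matrices in `SU(3)` that depend continuously on `A`. -/
theorem exists_continuousOn_SU3 {B : Type*} [TopologicalSpace B] {U : Set B} {A : B → M3}
    (hA : ContinuousOn A U) (hG : ∀ b ∈ U, ∃ G : MR, star (A b) * A b = cx G)
    (hd : ∀ b ∈ U, (A b).det ≠ 0) (him : ∀ b ∈ U, (A b).det.im = 0) :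
    ∃ g : B → SU3, ContinuousOn g U ∧ ∀ b ∈ U, ∃ Q : MR, Q.det ≠ 0 ∧
      (g b : M3) = A b * cx Q ∧ Q 1 0 = 0 ∧ Q 2 0 = 0 := by
  classical
  let G : B → MR := fun b => reMat (star (A b) * A b)
  have hGA : ∀ b ∈ U, star (A b) * A b = cx (G b) := fun b hb => by
    obtain ⟨G', hG'⟩ := hG b hb
    change _ = cx (reMat (star (A b) * A b))
    rw [hG', reMat_cx]
  have hGc : ContinuousOn G U := continuous_reMat.comp_continuousOn (hA.star.mul hA)
  -- Gram-Schmidt orthonormalization of the columns; the determinant is `1` or `-1`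
  let X : B → M3 := fun b => A b * cx (gsMat (G b))
  have hXc : ContinuousOn X U := hA.mul (continuous_cx.comp_continuousOn
    (continuousOn_gsMat.comp hGc fun b hb => gram_pos (hd b hb) (hGA b hb)))
  have hXu : ∀ b ∈ U, star (X b) * X b = 1 := fun b hb => by
    obtain ⟨h1, h2⟩ := gram_pos (hd b hb) (hGA b hb)
    change star (A b * cx (gsMat (G b))) * (A b * cx (gsMat (G b))) = 1
    rw [star_mul, mul_assoc, ← mul_assoc (star (A b)), hGA b hb, star_cx, ← map_mul, ← map_mul,
      ← mul_assoc, gsMat_conj h1 h2, map_one]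
  have hdet : ∀ b ∈ U, ∃ r : ℝ, (X b).det = r ∧ r * r = 1 := fun b hb => by
    have h1 : (X b).det.im = 0 := by
      change (A b * cx (gsMat (G b))).det.im = 0
      rw [det_mul, det_cx, Complex.mul_im, him b hb]
      simp
    have h2 : (X b).det = ((X b).det.re : ℂ) := Complex.ext rfl (by rw [h1, Complex.ofReal_im])
    refine ⟨(X b).det.re, h2, ?_⟩
    have h3 := congrArg det (hXu b hb)
    rw [det_mul, star_eq_conjTranspose, det_conjTranspose, det_one, h2, Complex.star_def,
      Complex.conj_ofReal] at h3
    exact_mod_cast h3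
  -- the sign of the determinant is corrected in the third column, which keeps the first one
  let Y : B → M3 := fun b => X b * cx (diagonal ![1, 1, (X b).det.re])
  have hYdet : ∀ b ∈ U, (X b).det.re * (X b).det.re = 1 := fun b hb => by
    obtain ⟨r, hr, hrr⟩ := hdet b hb
    rw [hr]
    exact hrr
  have hYc : ContinuousOn Y U := by
    refine hXc.mul (continuous_cx.comp_continuousOn
      ((Continuous.matrix_diagonal continuous_id).comp_continuousOn (continuousOn_pi.2 fun j => ?_)))
    have h1 : ContinuousOn (fun b => (X b).det.re) U := Complex.continuous_re.comp_continuousOn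
      ((Continuous.matrix_det continuous_id).comp_continuousOn hXc)
    fin_cases j
    exacts [continuousOn_const, continuousOn_const, h1]
  have hY : ∀ b ∈ U, Y b ∈ specialUnitaryGroup (Fin 3) ℂ := fun b hb => by
    refine mem_specialUnitaryGroup_iff.2 ⟨mem_unitaryGroup_iff'.2 ?_, ?_⟩
    · change star (X b * cx (diagonal ![1, 1, (X b).det.re])) *
        (X b * cx (diagonal ![1, 1, (X b).det.re])) = 1
      rw [star_mul, mul_assoc, ← mul_assoc (star (X b)), hXu b hb, one_mul, star_cx, ← map_mul,
        diagonal_transpose, diagonal_mul_diagonal, ← map_one cx, ← diagonal_one]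
      congr 2
      ext j
      fin_cases j
      exacts [one_mul _, one_mul _, hYdet b hb]
    · change (X b * cx (diagonal ![1, 1, (X b).det.re])).det = 1
      obtain ⟨r, hr, hrr⟩ := hdet b hb
      rw [det_mul, det_cx, det_diagonal, Fin.prod_univ_three, hr]
      simpa using (by exact_mod_cast hrr : (r : ℂ) * r = 1)
  refine ⟨fun b => if h : Y b ∈ specialUnitaryGroup (Fin 3) ℂ then ⟨Y b, h⟩ else 1, ?_, ?_⟩
  · rw [Topology.IsInducing.subtypeVal.continuousOn_iff]
    refine hYc.congr fun b hb => ?_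
    simp only [Function.comp_apply, dif_pos (hY b hb)]
  · intro b hb
    refine ⟨gsMat (G b) * diagonal ![1, 1, (X b).det.re], ?_, ?_, ?_⟩
    · obtain ⟨h1, h2⟩ := gram_pos (hd b hb) (hGA b hb)
      have h3 : (gsMat (G b)).det ≠ 0 := fun h => by
        have := congrArg det (gsMat_conj h1 h2)
        rw [det_mul, h, mul_zero, det_one] at this
        exact zero_ne_one this
      rw [det_mul, det_diagonal, Fin.prod_univ_three]
      refine mul_ne_zero h3 ?_
      have := hYdet b hb
      intro h4
      have h5 : (X b).det.re = 0 := by simpa using h4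
      rw [h5, mul_zero] at this
      exact zero_ne_one this
    · simp only [dif_pos (hY b hb), map_mul, ← mul_assoc]
      rfl
    · simp [mul_diagonal, gsMat_apply_zero]

/-! ### Special Lagrangian subbundles as maps to symmetric unitary matrices -/

section Phase

variable {W : Type*} [NormedAddCommGroup W] [InnerProductSpace ℂ W]

theorem det_ne_zero_of_isSpecialLagrangian {Ω : W [⋀^Fin 3]→ₗ[ℂ] ℂ} {e : Fin 3 → W}
    (he : Orthonormal ℂ e) (hΩ : Ω e = 1) {A : M3} (hA : LinearIndependent ℝ (frameMul e A))
    (h : IsSpecialLagrangian Ω (Sp e A)) : A.det ≠ 0 := by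
  obtain ⟨⟨G, hG⟩, -⟩ := h.exists_gram he hΩ
  have key : ∀ x, G *ᵥ x = 0 → x = 0 := fun x hx => by
    have h1 : star (A *ᵥ rv x) ⬝ᵥ (A *ᵥ rv x) = 0 := by
      rw [star_mulVec, ← dotProduct_mulVec, mulVec_mulVec, ← star_eq_conjTranspose, hG,
        cx_mulVec_rv, hx, rv_zero, dotProduct_zero]
    have h2 : A *ᵥ rv x = 0 := by
      open scoped ComplexOrder in exact dotProduct_star_self_eq_zero.1 h1
    have h3 : ∑ j, x j • frameMul e A j = 0 := by
      have h4 : comb (frameMul e A) (rv x) = 0 := by rw [comb_frameMul, h2, map_zero]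
      rw [comb_apply] at h4
      rw [← h4]
      exact Finset.sum_congr rfl fun j _ => (Complex.coe_smul (x j) (frameMul e A j)).symm
    exact funext (Fintype.linearIndependent_iff.1 hA x h3)
  intro hd
  have h5 : G.det = 0 := by
    have h6 := congrArg det hG
    rw [det_mul, hd, mul_zero, det_cx] at h6
    exact_mod_cast h6.symm
  obtain ⟨x, hx, hGx⟩ := exists_mulVec_eq_zero_iff.2 h5
  exact hx (key x hGx)

theorem exists_orthogonal_of_Sp_eq {e : Fin 3 → W} (he : Orthonormal ℂ e) {A A' : M3}
    (hA : star A * A = 1) (hA' : star A' * A' = 1) (h : Sp e A' ≤ Sp e A) :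
    ∃ Q : MR, A' = A * cx Q ∧ Qᵀ * Q = 1 := by
  obtain ⟨Q, rfl⟩ := eq_mul_cx_of_Sp_eq he h
  refine ⟨Q, rfl, cx_injective ?_⟩
  rw [map_mul, map_one, ← star_cx, ← hA', star_mul, mul_assoc, ← mul_assoc (star A), hA, one_mul]

theorem cx_transpose (Q : MR) : (cx Q)ᵀ = cx Qᵀ := rfl

open Classical in
/-- The symmetric unitary matrix `u uᵀ` of the special Lagrangian subspace `u ℝ³`. -/
noncomputable def phase (e : Fin 3 → W) (V : Submodule ℝ W) : M3 :=
  if h : ∃ u : SU3, V = Sp e (u : M3) then (h.choose : M3) * (h.choose : M3)ᵀ else 0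

theorem phase_Sp {e : Fin 3 → W} (he : Orthonormal ℂ e) (u : SU3) :
    phase e (Sp e (u : M3)) = (u : M3) * (u : M3)ᵀ := by
  have h : ∃ u' : SU3, Sp e (u : M3) = Sp e (u' : M3) := ⟨u, rfl⟩
  rw [phase, dif_pos h]
  obtain ⟨Q, hQ, hQQ⟩ := exists_orthogonal_of_Sp_eq he u.star_mul_self h.choose.star_mul_self
    h.choose_spec.ge
  rw [hQ, transpose_mul, cx_transpose, mul_assoc, ← mul_assoc (cx Q), ← map_mul,
    mul_eq_one_comm.1 hQQ, map_one, one_mul]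

end Phase

theorem IsSubbundle.comp_continuous {Z : Type*} {E : Z → Type*}
    [TopologicalSpace (TotalSpace (EuclideanSpace ℂ (Fin 3)) E)]
    [∀ z, NormedAddCommGroup (E z)] [∀ z, InnerProductSpace ℂ (E z)] {B B' : Type*}
    [TopologicalSpace B] [TopologicalSpace B'] {f : B → Z} {V : ∀ b, Submodule ℝ (E (f b))} {k : ℕ}
    (hV : IsSubbundle f k V) {φ : B' → B} (hφ : Continuous φ) :
    IsSubbundle (fun b => f (φ b)) k fun b => V (φ b) := by
  intro b₀
  obtain ⟨U, hU, s, hs, hb⟩ := hV (φ b₀)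
  exact ⟨φ ⁻¹' U, hφ.continuousAt hU, fun i b => s i (φ b),
    fun i => (hs i).comp hφ.continuousOn fun _ h => h, fun b hbU => hb _ hbU⟩

section Families

variable {Z : Type*} [TopologicalSpace Z] {E : Z → Type*}
  [TopologicalSpace (TotalSpace (EuclideanSpace ℂ (Fin 3)) E)]
  [∀ z, NormedAddCommGroup (E z)] [∀ z, InnerProductSpace ℂ (E z)]
  {B : Type*} [TopologicalSpace B]

/-- Continuous families of special Lagrangian subspaces. -/
def IsSLFamily (Ω : SU3Structure E) (f : B → Z) (V : ∀ b, Submodule ℝ (E (f b))) : Prop :=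
  IsSubbundle f 3 V ∧ ∀ b, IsSpecialLagrangian (Ω.vol (f b)) (V b)

variable {Ω : SU3Structure E} {e : ∀ z, Fin 3 → E z} {f : B → Z}
  {V : ∀ b, Submodule ℝ (E (f b))}

/-- Every continuous lift `A` of a family of special Lagrangian subspaces can be replaced by one in
`SU(3)`, without changing the line spanned by the first column. -/
theorem IsSLFamily.exists_orthonormalization (he : IsSU3Frame Ω Set.univ e)
    (hV : ∀ b, IsSpecialLagrangian (Ω.vol (f b)) (V b)) {U : Set B} {A : B → M3}
    (hA : ContinuousOn A U) (hAV : ∀ b ∈ U, (A b).det ≠ 0 ∧ V b = Sp (e (f b)) (A b)) :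
    ∃ g : B → SU3, ContinuousOn g U ∧ ∀ b ∈ U, V b = Sp (e (f b)) (g b : M3) ∧
      ∃ Q : MR, Q.det ≠ 0 ∧ (g b : M3) = A b * cx Q ∧ Q 1 0 = 0 ∧ Q 2 0 = 0 := by
  have h1 : ∀ b ∈ U, (∃ G : MR, star (A b) * A b = cx G) ∧ (A b).det.im = 0 := fun b hb =>
    IsSpecialLagrangian.exists_gram (he.orthonormal _ trivial) (he.vol _ trivial)
      ((hAV b hb).2 ▸ hV b)
  obtain ⟨g, hg, hgQ⟩ := exists_continuousOn_SU3 hA (fun b hb => (h1 b hb).1)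
    (fun b hb => (hAV b hb).1) fun b hb => (h1 b hb).2
  refine ⟨g, hg, fun b hb => ?_⟩
  obtain ⟨Q, hQ, hgA, hQ0⟩ := hgQ b hb
  exact ⟨by rw [hgA, Sp_mul_cx _ _ hQ, (hAV b hb).2], Q, hQ, hgA, hQ0⟩

variable [FiberBundle (EuclideanSpace ℂ (Fin 3)) E] [VectorBundle ℂ (EuclideanSpace ℂ (Fin 3)) E]

theorem isSubbundle_of_local (he : IsSU3Frame Ω Set.univ e) (hf : Continuous f)
    (h : ∀ b₀, ∃ U ∈ 𝓝 b₀, ∃ A : B → M3, ContinuousOn A U ∧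
      ∀ b ∈ U, (A b).det ≠ 0 ∧ V b = Sp (e (f b)) (A b)) : IsSubbundle f 3 V := by
  intro b₀
  obtain ⟨U, hU, A, hA, hb⟩ := h b₀
  exact ⟨U, hU, fun j b => frameMul (e (f b)) (A b) j,
    fun j => he.continuousOn_frameMul hf.continuousOn (fun _ _ => trivial) hA j,
    fun b hbU => ⟨linearIndependent_frameMul (he.orthonormal _ trivial) (hb b hbU).1,
      (hb b hbU).2⟩⟩

theorem IsSLFamily.exists_local_matrix (he : IsSU3Frame Ω Set.univ e) (hf : Continuous f)
    (hV : IsSLFamily Ω f V) (b₀ : B) : ∃ U ∈ 𝓝 b₀, ∃ A : B → M3, ContinuousOn A U ∧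
      ∀ b ∈ U, (A b).det ≠ 0 ∧ V b = Sp (e (f b)) (A b) := by
  obtain ⟨U, hU, s, hs, hb⟩ := hV.1 b₀
  choose A hA using fun b => exists_frameMul (he.orthonormal (f b) trivial) (finrank_fibre E _)
    fun j => s j b
  refine ⟨U, hU, A, ?_, fun b hbU => ?_⟩
  · refine he.continuousOn_matrix hf.continuousOn (fun _ _ => trivial) fun j => ?_
    refine (hs j).congr fun b _ => ?_
    rw [← hA b]
  · have h1 : V b = Sp (e (f b)) (A b) := by
      rw [Sp, ← hA b]
      exact (hb b hbU).2
    refine ⟨?_, h1⟩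
    refine det_ne_zero_of_isSpecialLagrangian (he.orthonormal _ trivial) (he.vol _ trivial) ?_
      (h1 ▸ hV.2 b)
    rw [← hA b]
    exact (hb b hbU).1

theorem IsSLFamily.exists_local_SU3 (he : IsSU3Frame Ω Set.univ e) (hf : Continuous f)
    (hV : IsSLFamily Ω f V) (b₀ : B) : ∃ U ∈ 𝓝 b₀, ∃ g : B → SU3, ContinuousOn g U ∧
      ∀ b ∈ U, V b = Sp (e (f b)) (g b : M3) := by
  obtain ⟨U, hU, A, hA, hAV⟩ := hV.exists_local_matrix he hf b₀
  obtain ⟨g, hg, hgV⟩ := IsSLFamily.exists_orthonormalization he hV.2 hA hAV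
  exact ⟨U, hU, g, hg, fun b hb => (hgV b hb).1⟩

theorem IsSLFamily.exists_SU3 (he : IsSU3Frame Ω Set.univ e) (hf : Continuous f)
    (hV : IsSLFamily Ω f V) (b : B) : ∃ u : SU3, V b = Sp (e (f b)) (u : M3) := by
  obtain ⟨U, hU, g, -, hg⟩ := hV.exists_local_SU3 he hf b
  exact ⟨g b, hg b (mem_of_mem_nhds hU)⟩

/-- Special Lagrangian subspaces form a continuous family if and only if their phases do.  In one
direction, `(u₀ + u uᵀ u₀*) / 2 = u Re (u⁻¹ u₀)` is a basis of `u ℝ³` if `u ℝ³` is close to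
`u₀ ℝ³`. -/
theorem isSLFamily_iff (he : IsSU3Frame Ω Set.univ e) (hf : Continuous f) : IsSLFamily Ω f V ↔
    (∀ b, ∃ u : SU3, V b = Sp (e (f b)) (u : M3)) ∧
      Continuous fun b => phase (e (f b)) (V b) := by
  constructor
  · intro hV
    refine ⟨hV.exists_SU3 he hf, continuous_iff_continuousAt.2 fun b₀ => ?_⟩
    obtain ⟨U, hU, g, hg, hgV⟩ := hV.exists_local_SU3 he hf b₀
    have hg' : ContinuousOn (fun b => (g b : M3)) U :=
      continuous_subtype_val.comp_continuousOn hg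
    have h1 : ContinuousOn (fun b => phase (e (f b)) (V b)) U :=
      (hg'.mul ((Continuous.matrix_transpose continuous_id).comp_continuousOn hg')).congr
        fun b hb => by
          rw [hgV b hb, phase_Sp (he.orthonormal _ trivial)]
          rfl
    exact h1.continuousAt hU
  · rintro ⟨hu, hc⟩
    choose u hu using hu
    refine ⟨isSubbundle_of_local he hf fun b₀ => ?_, fun b => by
      rw [hu b]
      exact isSpecialLagrangian_SU3 (he.orthonormal _ trivial) (he.vol _ trivial) _⟩
    -- the orthogonal projections of the columns of `u b₀` to `u b ℝ³`
    let X : B → M3 := fun b => (1 / 2 : ℂ) •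
      ((u b₀ : M3) + phase (e (f b)) (V b) * (star (u b₀ : M3))ᵀ)
    have hX : Continuous X := by
      have h1 : Continuous fun b => (u b₀ : M3) + phase (e (f b)) (V b) * (star (u b₀ : M3))ᵀ :=
        continuous_const.add (hc.mul continuous_const)
      exact h1.const_smul (1 / 2 : ℂ)
    have hXu : ∀ b, X b = (u b : M3) * cx (reMat (star (u b : M3) * (u b₀ : M3))) := fun b => by
      have h1 : cx (reMat (star (u b : M3) * (u b₀ : M3))) = (1 / 2 : ℂ) •
          (star (u b : M3) * (u b₀ : M3) + (star (star (u b : M3) * (u b₀ : M3)))ᵀ) := by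
        ext i j
        change (((star (u b : M3) * (u b₀ : M3)) i j).re : ℂ) =
          1 / 2 * ((star (u b : M3) * (u b₀ : M3)) i j +
            star ((star (u b : M3) * (u b₀ : M3)) i j))
        rw [Complex.re_eq_add_conj]
        rw [Complex.star_def]
        ring
      rw [h1, mul_smul_comm, mul_add, ← mul_assoc, (u b).mul_star_self, one_mul]
      change (1 / 2 : ℂ) • ((u b₀ : M3) + phase (e (f b)) (V b) * (star (u b₀ : M3))ᵀ) = _
      have h2 : phase (e (f b)) (V b) = (u b : M3) * (u b : M3)ᵀ := by
        conv_lhs => rw [hu b]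
        exact phase_Sp (he.orthonormal _ trivial) _
      rw [h2, star_mul, star_star, transpose_mul, mul_assoc]
    have h0 : (X b₀).det ≠ 0 := by
      rw [hXu, (u b₀).star_mul_self]
      have : reMat 1 = 1 := by rw [← map_one cx, reMat_cx]
      rw [this, map_one, mul_one, (u b₀).det_eq]
      exact one_ne_zero
    have hdet : Continuous fun b => (X b).det := Continuous.matrix_det hX
    refine ⟨{b | (X b).det ≠ 0}, hdet.continuousAt.eventually_ne h0, X, hX.continuousOn,
      fun b hb => ⟨hb, ?_⟩⟩
    have hb' : (X b).det ≠ 0 := hb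
    rw [hXu, det_mul, (u b).det_eq, one_mul, det_cx] at hb'
    rw [hXu, Sp_mul_cx _ _ (by exact_mod_cast hb'), hu b]

end Families

/-! ### Adapted bases of normalized pairs -/

section AdaptedFrames

attribute [local instance] InnerProductSpace.complexToReal

variable {W : Type*} [NormedAddCommGroup W] [InnerProductSpace ℂ W]

/-- A unitary basis `ε` that is an orthonormal basis of `V` whose first vector is a negative
eigenvector of `B_{V,V'}`; the matrix of `B_{V,V'}` is `S`. -/
structure IsAdaptedFrame (V V' : Submodule ℝ W) (ε : Fin 3 → W) (S : MR) : Prop where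
  orthonormal : Orthonormal ℂ ε
  fst : V = Sp ε 1
  snd : V' = Sp ε (gmat S)
  adapted : Adapted S

theorem IsAdaptedFrame.oneNegTwoPos {V V' : Submodule ℝ W} {ε : Fin 3 → W} {S : MR}
    (h : IsAdaptedFrame V V' ε S) : OneNegTwoPos V V' := by
  rw [h.fst, h.snd, oneNegTwoPos_graph_iff h.orthonormal h.adapted.posGraph.symm]
  exact h.adapted.matOneNeg

theorem Adapted.exists_mulVec {S : MR} (hS : Adapted S) :
    ∃ l : ℝ, l < 0 ∧ S *ᵥ Pi.single 0 1 = l • Pi.single 0 1 := by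
  obtain ⟨a, b, c, d, rfl, ha, -⟩ := hS
  refine ⟨-a, by linarith, ?_⟩
  ext i
  fin_cases i <;> simp [blockMat]

theorem IsAdaptedFrame.negEigenspace_eq {V V' : Submodule ℝ W} {ε : Fin 3 → W} {S : MR}
    (h : IsAdaptedFrame V V' ε S) : negEigenspace V V' = Submodule.span ℝ {ε 0} := by
  obtain ⟨l, hl, hSl⟩ := h.adapted.exists_mulVec
  rw [h.fst, h.snd, negEigenspace_graph h.orthonormal h.adapted.posGraph.symm h.adapted.matOneNeg
    (x := Pi.single 0 1) (by simp) hl hSl]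
  congr 2
  simp [comb_apply, rv, Pi.single_apply]

theorem IsAdaptedFrame.distinguishedLine_eq {V V' : Submodule ℝ W} {ε : Fin 3 → W} {S : MR}
    (h : IsAdaptedFrame V V' ε S) : distinguishedLine V V' = Submodule.span ℝ {ε 0} := by
  rw [distinguishedLine, if_pos h.oneNegTwoPos, h.negEigenspace_eq]

/-- Different orthonormal bases of `V` lead to conjugate matrices of `B_{V,V'}`. -/
theorem exists_conj_of_graph_eq {ε ε' : Fin 3 → W} (hε : Orthonormal ℂ ε) (hε' : Orthonormal ℂ ε')
    {S S' : MR} (h1 : Sp ε 1 = Sp ε' 1) (h2 : Sp ε (gmat S) = Sp ε' (gmat S')) :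
    ∃ Q : MR, ε' = frameMul ε (cx Q) ∧ Q * Qᵀ = 1 ∧ S = Q * S' * Qᵀ := by
  have h3 : ∀ j, ∃ x, ε' j = comb ε (rv x) := fun j => mem_Sp_one.1 (by
    rw [h1]
    exact mem_Sp_one.2 ⟨Pi.single j 1, by simp [comb_apply, rv, Pi.single_apply]⟩)
  choose x hx using h3
  let Q : MR := Matrix.of fun i j => x j i
  have hQ : ε' = frameMul ε (cx Q) := funext hx
  have hQQ : Qᵀ * Q = 1 := by
    ext i j
    rw [one_apply, ← Complex.ofReal_inj]
    have h4 := orthonormal_iff_ite.1 hε' i j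
    rw [hx, hx, inner_comb hε] at h4
    have h5 : star (rv (x i)) ⬝ᵥ rv (x j) = (((Qᵀ * Q) i j : ℝ) : ℂ) := by
      simp [dotProduct, rv, mul_apply, Q]
    rw [← h5, h4]
    split_ifs <;> simp
  have hQQ' := mul_eq_one_comm.1 hQQ
  have hQd : (Qᵀ).det ≠ 0 := by
    intro h
    have h4 := congrArg det hQQ
    rw [det_mul, h, zero_mul, det_one] at h4
    exact zero_ne_one h4
  refine ⟨Q, hQ, hQQ', gmat_slope_injective hε 1 ?_⟩
  change Sp ε (1 * gmat S) = Sp ε (1 * gmat (Q * S' * Qᵀ))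
  rw [one_mul, one_mul, h2, gmat_conj hQQ', Sp_mul_cx _ _ hQd, hQ, Sp_frameMul]

/-- Adapted frames are unique up to the group `O(1) × O(2)` of matrices commuting with `proj0`: the
first vectors span the same line, the negative eigenspace. -/
theorem IsAdaptedFrame.unique {V V' : Submodule ℝ W} {ε ε' : Fin 3 → W} {S S' : MR}
    (h : IsAdaptedFrame V V' ε S) (h' : IsAdaptedFrame V V' ε' S') :
    ∃ Q : MR, ε' = frameMul ε (cx Q) ∧ Q * Qᵀ = 1 ∧ S = Q * S' * Qᵀ ∧ Q * proj0 = proj0 * Q := by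
  obtain ⟨Q, hQ, hQQ, hS⟩ := exists_conj_of_graph_eq h.orthonormal h'.orthonormal
    (h.fst.symm.trans h'.fst) (h.snd.symm.trans h'.snd)
  refine ⟨Q, hQ, hQQ, hS, ?_⟩
  have hQQ' := mul_eq_one_comm.1 hQQ
  obtain ⟨X, c, hX, hXS, hc⟩ := h.adapted.matOneNeg
  obtain ⟨l, hl, hSl⟩ := h.adapted.exists_mulVec
  obtain ⟨l', hl', hSl'⟩ := h'.adapted.exists_mulVec
  have h1 : S *ᵥ (Q *ᵥ Pi.single 0 1) = l' • (Q *ᵥ Pi.single 0 1) := by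
    rw [hS, mulVec_mulVec, mul_assoc, hQQ', mul_one, ← mulVec_mulVec, hSl', mulVec_smul]
  rw [hXS] at hSl h1
  obtain ⟨a, ha⟩ := MatOneNeg.eigenvector hX hc.2.1 hc.2.2 hl hSl
  obtain ⟨b, hb⟩ := MatOneNeg.eigenvector hX hc.2.1 hc.2.2 hl' h1
  have ha0 : a ≠ 0 := by
    rintro rfl
    have := congrFun ha 0
    simp at this
  have hcol : ∀ i, Q i 0 = b / a * (Pi.single 0 1 : Fin 3 → ℝ) i := fun i => by
    rw [ha]
    have := congrFun hb i
    rw [mulVec_single_one] at this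
    rw [Pi.smul_apply, smul_eq_mul, ← mul_assoc, div_mul_cancel₀ _ ha0]
    exact this
  have h10 : Q 1 0 = 0 := by rw [hcol]; simp
  have h20 : Q 2 0 = 0 := by rw [hcol]; simp
  have e00 := congrFun (congrFun hQQ' 0) 0
  have e01 := congrFun (congrFun hQQ' 0) 1
  have e02 := congrFun (congrFun hQQ' 0) 2
  simp [mul_apply, Fin.sum_univ_three, h10, h20] at e00 e01 e02
  have h00 : Q 0 0 ≠ 0 := by
    intro h
    rw [h, mul_zero] at e00
    exact zero_ne_one e00
  have h01 := e01.resolve_left h00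
  have h02 := e02.resolve_left h00
  ext i j
  fin_cases i <;> fin_cases j <;>
    simp [mul_apply, Fin.sum_univ_three, proj0, blockMat, h10, h20, h01, h02]

open Classical in
/-- The subspace obtained from `V'` by applying `Φ` to the matrix of `B_{V,V'}`. -/
noncomputable def deformSpace (Φ : MR → MR) (V V' : Submodule ℝ W) : Submodule ℝ W :=
  if h : ∃ q : (Fin 3 → W) × MR, IsAdaptedFrame V V' q.1 q.2 then
    Sp h.choose.1 (gmat (Φ h.choose.2)) else ⊥

theorem IsAdaptedFrame.deformSpace_eq {V V' : Submodule ℝ W} {ε : Fin 3 → W} {S : MR}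
    (h : IsAdaptedFrame V V' ε S) {Φ : I → MR → MR} (hΦ : IsDeformation Φ) (s : I) :
    deformSpace (Φ s) V V' = Sp ε (gmat (Φ s S)) := by
  have h1 : ∃ q : (Fin 3 → W) × MR, IsAdaptedFrame V V' q.1 q.2 := ⟨(ε, S), h⟩
  rw [deformSpace, dif_pos h1]
  obtain ⟨Q, hQ, hQQ, hS, hp⟩ := h.unique h1.choose_spec
  have hQd : (Qᵀ).det ≠ 0 := by
    intro h
    have h4 := congrArg det hQQ
    rw [det_mul, h, mul_zero, det_one] at h4
    exact zero_ne_one h4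
  rw [hQ, hS, hΦ.conj s _ hQQ hp, gmat_conj hQQ, Sp_mul_cx _ _ hQd, Sp_frameMul]

theorem IsAdaptedFrame.deform {V V' : Submodule ℝ W} {ε : Fin 3 → W} {S : MR}
    (h : IsAdaptedFrame V V' ε S) {Φ : I → MR → MR} (hΦ : IsDeformation Φ) {s : I}
    (hs : Adapted (Φ s S)) : IsAdaptedFrame V (deformSpace (Φ s) V V') ε (Φ s S) :=
  ⟨h.orthonormal, h.fst, h.deformSpace_eq hΦ s, hs⟩

theorem exists_isAdaptedFrame {ε : Fin 3 → W} (hε : Orthonormal ℂ ε) {S : MR} (hS : PosGraph S)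
    (hd : S.det < 0) :
    ∃ q : (Fin 3 → W) × MR, IsAdaptedFrame (Sp ε 1) (Sp ε (gmat S)) q.1 q.2 := by
  obtain ⟨X, c, hX, hXS, h0, h1, h2⟩ := hS.matOneNeg hd
  have hX' := mul_eq_one_comm.1 hX
  have hXd : X.det ≠ 0 := by
    intro h
    have h4 := congrArg det hX
    rw [det_mul, h, mul_zero, det_one] at h4
    exact zero_ne_one h4
  have hdiag : diagonal c = Xᵀ * S * Xᵀᵀ := by
    rw [hXS, transpose_transpose, mul_assoc, mul_assoc, mul_assoc, hX, mul_one, ← mul_assoc, hX,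
      one_mul]
  refine ⟨(frameMul ε (cx X), diagonal c), orthonormal_frameMul hε ?_, ?_, ?_, ?_⟩
  · rw [star_cx, ← map_mul, hX, map_one]
  · change _ = Sp (frameMul ε (cx X)) 1
    rw [Sp_frameMul, mul_one, ← one_mul (cx X), Sp_mul_cx _ _ hXd]
  · change _ = Sp (frameMul ε (cx X)) (gmat (diagonal c))
    rw [Sp_frameMul, hXS, gmat_conj hX', Sp_mul_cx _ _ (by rwa [det_transpose])]
  · have hp : PosGraph (diagonal c) := by
      rw [hdiag]
      exact hS.conj (by rwa [transpose_transpose])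
    refine hp.adapted ?_ (by simp) (by simp) (by simpa using h0)
    rw [det_diagonal, Fin.prod_univ_three]
    exact mul_neg_of_neg_of_pos (mul_neg_of_neg_of_pos h0 h1) h2

theorem exists_isAdaptedFrame_reversed {ε : Fin 3 → W} (hε : Orthonormal ℂ ε) {S : MR}
    (hS : PosGraph S) (hd : 0 < S.det) :
    ∃ q : (Fin 3 → W) × MR, IsAdaptedFrame (Sp ε (gmat S)) (Sp ε 1) q.1 q.2 := by
  obtain ⟨ε', S', hε', h1, h2, hS', hd'⟩ := exists_reversed_posGraph hε hS
  rw [h1, h2]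
  exact exists_isAdaptedFrame hε' hS' (hd'.2 hd)

theorem IsAdaptedFrame.transverse {V V' : Submodule ℝ W} {ε : Fin 3 → W} {S : MR}
    (h : IsAdaptedFrame V V' ε S) : V ⊓ V' = ⊥ ∧ V.map J ⊓ V' = ⊥ := by
  have h1 := Sp_inf_graph h.orthonormal 1 h.adapted.posGraph.det_ne
  have h2 := J_Sp_inf_graph h.orthonormal 1 S
  change Sp ε 1 ⊓ Sp ε (1 * gmat S) = ⊥ at h1
  change (Sp ε 1).map J ⊓ Sp ε (1 * gmat S) = ⊥ at h2
  rw [one_mul] at h1 h2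
  rw [h.fst, h.snd]
  exact ⟨h1, h2⟩

end AdaptedFrames

/-! ### Pairs of special Lagrangian subbundles in coordinates -/

theorem det_gmat_ne_zero {S : MR} (hS : Sᵀ = S) : (gmat S).det ≠ 0 := by
  obtain ⟨X, c, hX, rfl⟩ := exists_diagonalization hS
  rw [det_gmat_conj (mul_eq_one_comm.1 hX), gmat_diagonal, det_diagonal]
  refine Finset.prod_ne_zero_iff.2 fun j _ h => ?_
  have := congrArg Complex.re h
  simp at this

theorem continuousOn_slope {B : Type*} [TopologicalSpace B] {U : Set B} {g A : B → M3}
    (hg : ContinuousOn g U) (hA : ContinuousOn A U)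
    (hd : ∀ b ∈ U, (reMat (star (g b) * A b)).det ≠ 0) :
    ContinuousOn (fun b => slope (g b) (A b)) U := by
  have h1 : ContinuousOn (fun b => reMat (star (g b) * A b)) U :=
    continuous_reMat.comp_continuousOn (hg.star.mul hA)
  have h2 : ContinuousOn (fun b => imMat (star (g b) * A b)) U :=
    continuous_imMat.comp_continuousOn (hg.star.mul hA)
  have h3 : ContinuousOn (fun b => (reMat (star (g b) * A b)).det) U :=
    (Continuous.matrix_det continuous_id).comp_continuousOn h1
  have h4 : ContinuousOn (fun b => (reMat (star (g b) * A b)).adjugate) U :=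
    (Continuous.matrix_adjugate continuous_id).comp_continuousOn h1
  have h5 : ContinuousOn (fun b => (reMat (star (g b) * A b))⁻¹) U := by
    refine ((h3.inv₀ hd).smul h4).congr fun b _ => ?_
    rw [inv_def, Ring.inverse_eq_inv']
    rfl
  exact h2.mul h5

section Pairs

variable {Z : Type*} [TopologicalSpace Z] {E : Z → Type*}
  [TopologicalSpace (TotalSpace (EuclideanSpace ℂ (Fin 3)) E)]
  [∀ z, NormedAddCommGroup (E z)] [∀ z, InnerProductSpace ℂ (E z)]
  [FiberBundle (EuclideanSpace ℂ (Fin 3)) E] [VectorBundle ℂ (EuclideanSpace ℂ (Fin 3)) E]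
  {Ω : SU3Structure E} {e : ∀ z, Fin 3 → E z} {B : Type*} [TopologicalSpace B] {f : B → Z}
  {V V' : ∀ b, Submodule ℝ (E (f b))}

/-- Locally, the first family has a continuous orthonormal frame, and the second one is the graph of
`J S` for a continuous matrix `S`. -/
theorem exists_local_graph (he : IsSU3Frame Ω Set.univ e) (hf : Continuous f)
    (hV : IsSLFamily Ω f V) (hV' : IsSLFamily Ω f V') (hJ : ∀ b, (V b).map J ⊓ V' b = ⊥) (b₀ : B) :
    ∃ U ∈ 𝓝 b₀, ∃ (g : B → SU3) (S : B → MR), ContinuousOn g U ∧ ContinuousOn S U ∧ ∀ b ∈ U,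
      V b = Sp (e (f b)) (g b : M3) ∧ V' b = Sp (e (f b)) ((g b : M3) * gmat (S b)) ∧
        (S b)ᵀ = S b ∧ (gmat (S b)).det.im = 0 := by
  obtain ⟨U, hU, g, hg, hgV⟩ := hV.exists_local_SU3 he hf b₀
  obtain ⟨U', hU', A, hA, hAV⟩ := hV'.exists_local_matrix he hf b₀
  have key : ∀ b ∈ U ∩ U', _ := fun b hb => slope_spec (he.orthonormal (f b) trivial)
    (he.vol (f b) trivial) (g b) (hAV b hb.2).1 ((hAV b hb.2).2 ▸ hV'.2 b)
    (by rw [← hgV b hb.1, ← (hAV b hb.2).2]; exact hJ b)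
  refine ⟨U ∩ U', Filter.inter_mem hU hU', g, fun b => slope (g b) (A b),
    hg.mono Set.inter_subset_left, ?_, fun b hb => ⟨hgV b hb.1, ?_, (key b hb).2.2.1,
      (key b hb).2.2.2⟩⟩
  · exact continuousOn_slope
      (continuous_subtype_val.comp_continuousOn (hg.mono Set.inter_subset_left))
      (hA.mono Set.inter_subset_right) fun b hb => (key b hb).1
  · rw [(hAV b hb.2).2]
    exact (key b hb).2.1

/-- In a continuous family of subspaces that starts at `V` and stays transverse to `J V`, all
subspaces are graphs of `J S` with `0 < re (det (1 + i S))`. -/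
theorem re_det_pos_of_path (he : IsSU3Frame Ω Set.univ e) {z : Z} {V₀ : Submodule ℝ (E z)}
    {F : I → Submodule ℝ (E z)} (hF : IsSLFamily Ω (fun _ : I => z) F) (hF0 : F 0 = V₀)
    (hJ : ∀ t, 0 < t → V₀.map J ⊓ F t = ⊥) {g : SU3} (hg : V₀ = Sp (e z) (g : M3)) :
    ∃ S : MR, F 1 = Sp (e z) ((g : M3) * gmat S) ∧ Sᵀ = S ∧ (gmat S).det.im = 0 ∧
      0 < (gmat S).det.re := by
  have ho := he.orthonormal z trivial
  -- for `t = 0` the subspace is `V₀` itself, which is transverse to `J V₀`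
  have hJ' : ∀ t, (Sp (e z) (g : M3)).map J ⊓ F t = ⊥ := fun t => by
    rcases eq_or_lt_of_le (unitInterval.nonneg' : 0 ≤ t) with h | h
    · have h1 := J_Sp_inf_graph ho g (0 : MR)
      rw [← h, hF0, hg]
      rw [gmat, map_zero, smul_zero, add_zero, mul_one] at h1
      exact h1
    · rw [← hg]
      exact hJ t h
  have key : ∀ t, ∃ S : MR, F t = Sp (e z) ((g : M3) * gmat S) ∧ Sᵀ = S ∧
      (gmat S).det.im = 0 := fun t => by
    obtain ⟨U, hU, A, -, hAV⟩ := hF.exists_local_matrix he continuous_const t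
    have hAt := hAV t (mem_of_mem_nhds hU)
    obtain ⟨-, h2, h3⟩ := slope_spec ho (he.vol z trivial) g hAt.1 (hAt.2 ▸ hF.2 t)
      (hAt.2 ▸ hJ' t)
    exact ⟨_, hAt.2.trans h2, h3⟩
  choose S hS hsym him using key
  have hSc : Continuous S := by
    rw [continuous_iff_continuousAt]
    intro t₀
    obtain ⟨U, hU, A, hA, hAV⟩ := hF.exists_local_matrix he continuous_const t₀
    have h1 : ∀ t ∈ U, _ := fun t ht => slope_spec ho (he.vol z trivial) g (hAV t ht).1
      ((hAV t ht).2 ▸ hF.2 t) ((hAV t ht).2 ▸ hJ' t)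
    have h2 : ContinuousOn S U := by
      refine (continuousOn_slope continuousOn_const hA fun t ht => (h1 t ht).1).congr fun t ht => ?_
      refine gmat_slope_injective ho g ?_
      rw [← hS t, (hAV t ht).2]
      exact (h1 t ht).2.1
    exact h2.continuousAt hU
  have hdc : Continuous fun t => (gmat (S t)).det.re :=
    Complex.continuous_re.comp (Continuous.matrix_det (continuous_gmat.comp hSc))
  have hne : ∀ t, (gmat (S t)).det.re ≠ 0 := fun t h =>
    det_gmat_ne_zero (hsym t) (Complex.ext h (him t))
  have h0 : S 0 = 0 := by
    refine gmat_slope_injective ho g ?_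
    rw [← hS 0, hF0, hg, gmat, map_zero, smul_zero, add_zero, mul_one]
  have h00 : 0 < (gmat (S 0)).det.re := by
    rw [h0, gmat, map_zero, smul_zero, add_zero, det_one]
    exact one_pos
  refine ⟨S 1, hS 1, hsym 1, him 1, ?_⟩
  -- a continuous real function that does not vanish and is `1` at `0` stays positive
  by_contra hcon
  obtain ⟨t, ht⟩ := mem_range_of_exists_le_of_exists_ge hdc ⟨1, not_lt.1 hcon⟩ ⟨0, h00.le⟩
  exact hne t ht

/-- The matrix of `B_{V,V'}` for a close graphical pair. -/
theorem IsCloseGraphicalPair.exists_posGraph {V V' : ∀ z, Submodule ℝ (E z)}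
    (he : IsSU3Frame Ω Set.univ e) (h : IsCloseGraphicalPair Ω V V') (z : Z) :
    ∃ (ε : Fin 3 → E z) (S : MR), Orthonormal ℂ ε ∧ V z = Sp ε 1 ∧ V' z = Sp ε (gmat S) ∧
      PosGraph S := by
  obtain ⟨⟨hV, hV', hVV', hJ⟩, F, ⟨hF, hF0, hF1⟩, hFg⟩ := h
  obtain ⟨g, hg⟩ := IsSLFamily.exists_SU3 (V := V) he continuous_id hV z
  have hFz : IsSLFamily Ω (fun _ : I => z) fun t => F (z, t) := by
    refine ⟨hF.comp_continuous (continuous_const.prodMk continuous_id), fun t => ?_⟩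
    rcases eq_or_lt_of_le (unitInterval.nonneg' : 0 ≤ t) with h | h
    · subst h
      change IsSpecialLagrangian (Ω.vol z) (F (z, 0))
      rw [hF0]
      exact hV.2 z
    · exact (hFg t h).2.1.2 z
  obtain ⟨S, hS, hsym, him, hre⟩ := re_det_pos_of_path he hFz (hF0 z)
    (fun t ht => (hFg t ht).2.2.2 z) hg
  rw [hF1] at hS
  have ho := he.orthonormal z trivial
  refine ⟨frameMul (e z) (g : M3), S, orthonormal_frameMul ho g.star_mul_self, ?_, ?_,
    hsym, him, hre, graph_det_ne_zero ho g ?_⟩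
  · rw [Sp_frameMul, mul_one]
    exact hg
  · rw [Sp_frameMul]
    exact hS
  · rw [← hS]
    exact hg ▸ hVV' z

/-- Normalized pairs have continuous adapted frames. -/
theorem exists_local_adapted (he : IsSU3Frame Ω Set.univ e) (hf : Continuous f)
    (hV : IsSLFamily Ω f V) (hV' : IsSLFamily Ω f V')
    (h : ∀ b, ∃ q : (Fin 3 → E (f b)) × MR, IsAdaptedFrame (V b) (V' b) q.1 q.2) (b₀ : B) :
    ∃ U ∈ 𝓝 b₀, ∃ (g : B → SU3) (S : B → MR), ContinuousOn g U ∧ ContinuousOn S U ∧ ∀ b ∈ U,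
      IsAdaptedFrame (V b) (V' b) (frameMul (e (f b)) (g b : M3)) (S b) := by
  have ho := fun b => he.orthonormal (f b) trivial
  have hJ : ∀ b, (V b).map J ⊓ V' b = ⊥ := fun b => by
    obtain ⟨⟨ε, T⟩, hq⟩ := h b
    rw [hq.fst, hq.snd]
    have := J_Sp_inf_graph hq.orthonormal 1 T
    change (Sp ε 1).map J ⊓ Sp ε (1 * gmat T) = ⊥ at this
    rwa [one_mul] at this
  obtain ⟨U, hU, g, S, hg, hS, hgS⟩ := exists_local_graph he hf hV hV' hJ b₀
  have hgr : ∀ b ∈ U, V b = Sp (frameMul (e (f b)) (g b : M3)) 1 ∧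
      V' b = Sp (frameMul (e (f b)) (g b : M3)) (gmat (S b)) := fun b hb => by
    rw [Sp_frameMul, Sp_frameMul, mul_one]
    exact ⟨(hgS b hb).1, (hgS b hb).2.1⟩
  have hog : ∀ b, Orthonormal ℂ (frameMul (e (f b)) (g b : M3)) := fun b =>
    orthonormal_frameMul (ho b) (g b).star_mul_self
  have hneg : ∀ b ∈ U, MatOneNeg (S b) := fun b hb => by
    obtain ⟨q, hq⟩ := h b
    rw [← oneNegTwoPos_graph_iff (hog b) (hgS b hb).2.2.1, ← (hgr b hb).1, ← (hgr b hb).2]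
    exact hq.oneNegTwoPos
  obtain ⟨U', hU', hU'U, x, hx, hxS⟩ := exists_continuousOn_eigenvector hU hS hneg
  obtain ⟨X, c, hX, hXS, hc⟩ := hneg b₀ (mem_of_mem_nhds hU)
  obtain ⟨hx0, l₀, hl₀, hSx₀⟩ := hxS b₀ (mem_of_mem_nhds hU')
  rw [hXS] at hSx₀
  obtain ⟨a, ha⟩ := MatOneNeg.eigenvector hX hc.2.1 hc.2.2 hl₀ hSx₀
  have ha0 : a ≠ 0 := by
    rintro rfl
    exact hx0 (by rw [ha, zero_smul])
  -- a basis of `ℝ³` whose first vector is the negative eigenvector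
  let Y : B → MR := fun b => Matrix.of fun i j => if j = 0 then x b i else X i j
  have hYc : ContinuousOn Y U' := by
    refine continuousOn_pi.2 fun i => continuousOn_pi.2 fun j => ?_
    by_cases hj : j = 0
    · have h1 : ContinuousOn (fun b => x b i) U' := (continuous_apply i).comp_continuousOn hx
      simpa [Y, hj] using h1
    · simpa [Y, hj] using continuousOn_const
  have hYd : (Y b₀).det ≠ 0 := by
    have h1 : Y b₀ = X * diagonal ![a, 1, 1] := by
      ext i j
      rw [mul_diagonal]
      fin_cases j <;> simp [Y, ha, mul_comm]
    rw [h1, det_mul, det_diagonal, Fin.prod_univ_three]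
    refine mul_ne_zero (fun h2 => ?_) (by simpa using ha0)
    have h3 := congrArg det hX
    rw [det_mul, h2, mul_zero, det_one] at h3
    exact zero_ne_one h3
  have hYdc : ContinuousOn (fun b => (Y b).det) U' :=
    (Continuous.matrix_det continuous_id).comp_continuousOn hYc
  have hev : ∀ᶠ b in 𝓝 b₀, b ∈ U' ∧ (Y b).det ≠ 0 :=
    Filter.Eventually.and hU' ((hYdc.continuousAt hU').eventually_ne hYd)
  let A : B → M3 := fun b => (g b : M3) * cx (Y b)
  set N := {b | b ∈ U' ∧ (Y b).det ≠ 0} with hN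
  have hNU : N ⊆ U := fun b hb => hU'U hb.1
  have hgc : ContinuousOn (fun b => (g b : M3)) N :=
    continuous_subtype_val.comp_continuousOn (hg.mono hNU)
  have hAc : ContinuousOn A N :=
    hgc.mul (continuous_cx.comp_continuousOn (hYc.mono fun b hb => hb.1))
  obtain ⟨g', hg', hgV'⟩ := IsSLFamily.exists_orthonormalization he hV.2 hAc fun b hb => by
    constructor
    · change ((g b : M3) * cx (Y b)).det ≠ 0
      rw [det_mul, (g b).det_eq, one_mul, det_cx]
      exact_mod_cast hb.2
    · change _ = Sp _ ((g b : M3) * cx (Y b))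
      rw [Sp_mul_cx _ _ hb.2]
      exact (hgS b (hNU hb)).1
  have hgc' : ContinuousOn (fun b => (g' b : M3)) N := continuous_subtype_val.comp_continuousOn hg'
  let K : B → MR := fun b => reMat (star (g b : M3) * (g' b : M3))
  have hKc : ContinuousOn K N := continuous_reMat.comp_continuousOn (hgc.star.mul hgc')
  refine ⟨N, hev, g', fun b => (K b)ᵀ * S b * K b, hg', ?_, fun b hb => ?_⟩
  · exact (((Continuous.matrix_transpose continuous_id).comp_continuousOn hKc).mul
      (hS.mono hNU)).mul hKc
  obtain ⟨hVg', Q, hQd, hgQ, hQ1, hQ2⟩ := hgV' b hb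
  obtain ⟨hxb, l, hl, hSl⟩ := hxS b hb.1
  have hK : cx (K b) = star (g b : M3) * (g' b : M3) := by
    change cx (reMat (star (g b : M3) * (g' b : M3))) = _
    rw [hgQ]
    change cx (reMat (star (g b : M3) * ((g b : M3) * cx (Y b) * cx Q))) =
      star (g b : M3) * ((g b : M3) * cx (Y b) * cx Q)
    rw [← mul_assoc, ← mul_assoc, (g b).star_mul_self, one_mul, ← map_mul, reMat_cx]
  have hKY : K b = Y b * Q := by
    apply cx_injective
    rw [hK, hgQ]
    change star (g b : M3) * ((g b : M3) * cx (Y b) * cx Q) = _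
    rw [← mul_assoc, ← mul_assoc, (g b).star_mul_self, one_mul, ← map_mul]
  have hgK : (g' b : M3) = (g b : M3) * cx (K b) := by
    rw [hK, ← mul_assoc, (g b).mul_star_self, one_mul]
  have hKK : (K b)ᵀ * K b = 1 := by
    apply cx_injective
    rw [map_mul, ← star_cx, hK, star_mul, star_star, mul_assoc, ← mul_assoc (g b : M3),
      (g b).mul_star_self, one_mul, (g' b).star_mul_self, map_one]
  have hKK' := mul_eq_one_comm.1 hKK
  have hKKt : (K b)ᵀ * (K b)ᵀᵀ = 1 := by rwa [transpose_transpose]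
  have hKd : (K b).det ≠ 0 := by
    intro h2
    have h3 := congrArg det hKK
    rw [det_mul, h2, mul_zero, det_one] at h3
    exact zero_ne_one h3
  have hV'g' : V' b = Sp (frameMul (e (f b)) (g' b : M3)) (gmat ((K b)ᵀ * S b * K b)) := by
    have h1 : gmat ((K b)ᵀ * S b * K b) = cx (K b)ᵀ * gmat (S b) * cx (K b) := by
      have := gmat_conj hKKt (S b)
      rwa [transpose_transpose] at this
    rw [Sp_frameMul, h1, hgK, mul_assoc (g b : M3), ← mul_assoc (cx (K b)), ← mul_assoc (cx (K b)),
      ← map_mul, hKK', map_one, one_mul, ← mul_assoc, Sp_mul_cx _ _ hKd]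
    exact (hgS b (hNU hb)).2.1
  have hog' : Orthonormal ℂ (frameMul (e (f b)) (g' b : M3)) :=
    orthonormal_frameMul (ho b) (g' b).star_mul_self
  have hVg'' : V b = Sp (frameMul (e (f b)) (g' b : M3)) 1 := by
    rw [Sp_frameMul, mul_one]
    exact hVg'
  refine ⟨hog', hVg'', hV'g', ?_⟩
  -- the first column of `K b` is an eigenvector
  have hcol : (fun i => K b i 0) = Q 0 0 • x b := by
    ext i
    rw [hKY, mul_apply, Fin.sum_univ_three, hQ1, hQ2]
    simp [Y, mul_comm]
  have hmul : ((K b)ᵀ * S b * K b) *ᵥ Pi.single 0 1 = l • Pi.single 0 1 := by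
    have h1 : K b *ᵥ Pi.single 0 1 = Q 0 0 • x b := by
      rw [mulVec_single_one]
      exact hcol
    rw [← mulVec_mulVec, ← mulVec_mulVec, h1, mulVec_smul, hSl, smul_comm, ← h1, mulVec_smul,
      mulVec_mulVec, hKK, one_mulVec]
  have hcoef : ∀ i, ((K b)ᵀ * S b * K b) i 0 = l * (Pi.single 0 1 : Fin 3 → ℝ) i := fun i => by
    have := congrFun hmul i
    rwa [mulVec_single_one] at this
  obtain ⟨⟨ε, T⟩, hq⟩ := h b
  obtain ⟨R, -, hRR, hRS⟩ := exists_conj_of_graph_eq hog' hq.orthonormal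
    (hVg''.symm.trans hq.fst) (hV'g'.symm.trans hq.snd)
  have hpos : PosGraph ((K b)ᵀ * S b * K b) := by
    rw [hRS]
    exact hq.adapted.posGraph.conj hRR
  refine hpos.adapted ?_ (by rw [hcoef]; simp) (by rw [hcoef]; simp) (by rw [hcoef]; simpa using hl)
  rw [hRS, det_conj hRR]
  exact hq.adapted.det_neg

/-- Deformations of the matrix of `B_{V,V'}` give continuous families of special Lagrangian
subbundles. -/
theorem isSLFamily_deformSpace (he : IsSU3Frame Ω Set.univ e) (hf : Continuous f)
    (hV : IsSLFamily Ω f V) (hV' : IsSLFamily Ω f V')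
    (h : ∀ b, ∃ q : (Fin 3 → E (f b)) × MR, IsAdaptedFrame (V b) (V' b) q.1 q.2)
    {Φ : I → MR → MR} (hΦ : IsDeformation Φ) :
    IsSLFamily Ω (fun q : B × I => f q.1) fun q => deformSpace (Φ q.2) (V q.1) (V' q.1) := by
  constructor
  · refine isSubbundle_of_local he (hf.comp continuous_fst) ?_
    rintro ⟨b₀, s₀⟩
    obtain ⟨U, hU, g, S, hg, hS, hgS⟩ := exists_local_adapted he hf hV hV' h b₀
    refine ⟨U ×ˢ Set.univ, prod_mem_nhds hU Filter.univ_mem,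
      fun q => (g q.1 : M3) * gmat (Φ q.2 (S q.1)), ?_, ?_⟩
    · have h1 : ContinuousOn (fun q : B × I => (g q.1 : M3)) (U ×ˢ Set.univ) :=
        (continuous_subtype_val.comp_continuousOn hg).comp continuous_fst.continuousOn
          fun q hq => hq.1
      have h2 : ContinuousOn (fun q : B × I => (q.2, S q.1)) (U ×ˢ Set.univ) :=
        continuous_snd.continuousOn.prodMk
          (hS.comp continuous_fst.continuousOn fun q hq => hq.1)
      exact h1.mul (continuous_gmat.comp_continuousOn
        (hΦ.continuousOn.comp h2 fun q hq => (hgS q.1 hq.1).adapted))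
    · rintro ⟨b, s⟩ ⟨hb, -⟩
      refine ⟨?_, ?_⟩
      · rw [det_mul, (g b).det_eq, one_mul]
        refine det_gmat_ne_zero ?_
        rcases hΦ.adapted_or s (hgS b hb).adapted with h1 | h1
        · exact h1.posGraph.symm
        · rw [h1, transpose_zero]
      · change deformSpace (Φ s) (V b) (V' b) = _
        rw [(hgS b hb).deformSpace_eq hΦ, Sp_frameMul]
  · rintro ⟨b, s⟩
    obtain ⟨U, hU, g, S, -, -, hgS⟩ := exists_local_adapted he hf hV hV' h b
    have hb := hgS b (mem_of_mem_nhds hU)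
    change IsSpecialLagrangian _ (deformSpace (Φ s) (V b) (V' b))
    rw [hb.deformSpace_eq hΦ, Sp_frameMul]
    rcases hΦ.adapted_or s hb.adapted with h1 | h1
    · exact isSpecialLagrangian_graph (he.orthonormal _ trivial) (he.vol _ trivial) _
        h1.posGraph.symm h1.posGraph.im_det
    · rw [h1]
      exact isSpecialLagrangian_graph (he.orthonormal _ trivial) (he.vol _ trivial) _
        transpose_zero (by simp [gmat])

/-- Pairs with the eigenvalue signs of a normalized pair are close. -/
theorem isCloseGraphicalPair_of_adapted {V V' : ∀ z, Submodule ℝ (E z)}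
    (he : IsSU3Frame Ω Set.univ e) (hV : IsSLSubbundle Ω V) (hV' : IsSLSubbundle Ω V')
    (h : ∀ z, ∃ q : (Fin 3 → E z) × MR, IsAdaptedFrame (V z) (V' z) q.1 q.2) :
    IsCloseGraphicalPair Ω V V' := by
  have hfam := isSLFamily_deformSpace (V := V) (V' := V') he continuous_id hV hV' h
    isDeformation_shrink
  refine ⟨⟨hV, hV', fun z => ?_, fun z => ?_⟩,
    fun q => deformSpace (shrink q.2) (V q.1) (V' q.1), ⟨hfam.1, fun z => ?_, fun z => ?_⟩,
    fun t ht => ⟨hV, ⟨?_, fun z => hfam.2 (z, t)⟩, fun z => ?_, fun z => ?_⟩⟩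
  · obtain ⟨q, hq⟩ := h z
    exact hq.transverse.1
  · obtain ⟨q, hq⟩ := h z
    exact hq.transverse.2
  · obtain ⟨q, hq⟩ := h z
    change deformSpace (shrink 0) (V z) (V' z) = V z
    have h0 : shrink 0 q.2 = 0 := hq.adapted.deform_zero_zero
    rw [hq.deformSpace_eq isDeformation_shrink, h0, hq.fst, gmat, map_zero, smul_zero, add_zero]
  · obtain ⟨q, hq⟩ := h z
    change deformSpace (shrink 1) (V z) (V' z) = V' z
    have h1 : shrink 1 q.2 = q.2 := hq.adapted.deform_one_zero
    rw [hq.deformSpace_eq isDeformation_shrink, h1, hq.snd]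
  · exact hfam.1.comp_continuous (φ := fun z => (z, t)) (continuous_id.prodMk continuous_const)
  · obtain ⟨q, hq⟩ := h z
    exact (hq.deform isDeformation_shrink (adapted_shrink hq.adapted ht)).transverse.1
  · obtain ⟨q, hq⟩ := h z
    exact (hq.deform isDeformation_shrink (adapted_shrink hq.adapted ht)).transverse.2

end Pairs

/-! ### Real orthogonal matrices that preserve a coordinate line -/

/-- The rotation of the last two coordinates. -/
noncomputable def rotMat (θ : ℝ) : MR :=
  !![1, 0, 0; 0, Real.cos θ, -Real.sin θ; 0, Real.sin θ, Real.cos θ]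

theorem rotMat_mul_transpose (θ : ℝ) : rotMat θ * (rotMat θ)ᵀ = 1 := by
  have h := Real.cos_sq_add_sin_sq θ
  ext i j
  fin_cases i <;> fin_cases j <;> simp [rotMat, mul_apply, Fin.sum_univ_three] <;> linarith

theorem rotMat_mul_proj0 (θ : ℝ) : rotMat θ * proj0 = proj0 * rotMat θ := by
  ext i j
  fin_cases i <;> fin_cases j <;> simp [rotMat, proj0, blockMat, mul_apply, Fin.sum_univ_three]

theorem det_rotMat (θ : ℝ) : (rotMat θ).det = 1 := by
  have h := Real.cos_sq_add_sin_sq θ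
  rw [det_fin_three]
  simp [rotMat]
  linarith

theorem rotMat_zero : rotMat 0 = 1 := by
  ext i j
  fin_cases i <;> fin_cases j <;> simp [rotMat]

theorem continuous_rotMat : Continuous rotMat := by
  refine continuous_matrix fun i j => ?_
  fin_cases i <;> fin_cases j <;> simp [rotMat] <;> fun_prop

/-- A real orthogonal matrix as an element of `SU(3)`. -/
noncomputable def realSU3 (Q : MR) (hQ : Q * Qᵀ = 1) (hd : Q.det = 1) : SU3 :=
  ⟨cx Q, mem_specialUnitaryGroup_iff.2 ⟨mem_unitaryGroup_iff.2 (by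
    rw [star_cx, ← map_mul, hQ, map_one]), by rw [det_cx, hd, Complex.ofReal_one]⟩⟩

/-- The rotation of the last two coordinates as an element of `SU(3)`. -/
noncomputable def rotSU3 (θ : ℝ) : SU3 := realSU3 _ (rotMat_mul_transpose θ) (det_rotMat θ)

theorem continuous_rotSU3 : Continuous rotSU3 :=
  (continuous_cx.comp continuous_rotMat).subtype_mk _

/-- Matrices that commute with `proj0` are block matrices. -/
theorem apply_eq_zero_of_commute_proj0 {Q : MR} (hp : Q * proj0 = proj0 * Q) :
    Q 0 1 = 0 ∧ Q 0 2 = 0 ∧ Q 1 0 = 0 ∧ Q 2 0 = 0 := by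
  have h := fun i j => congrFun (congrFun hp i) j
  have h01 := h 0 1
  have h02 := h 0 2
  have h10 := h 1 0
  have h20 := h 2 0
  simp [proj0, blockMat, mul_apply, Fin.sum_univ_three] at h01 h02 h10 h20
  exact ⟨h01.symm, h02.symm, h10, h20⟩

theorem exists_eq_rotMat {Q : MR} (hQ : Q * Qᵀ = 1) (hd : Q.det = 1)
    (hp : Q * proj0 = proj0 * Q) (h00 : Q 0 0 = 1) : ∃ θ, Q = rotMat θ := by
  obtain ⟨h01, h02, h10, h20⟩ := apply_eq_zero_of_commute_proj0 hp
  have h11 := congrFun (congrFun hQ 1) 1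
  have h22 := congrFun (congrFun hQ 2) 2
  rw [det_fin_three] at hd
  simp [mul_apply, Fin.sum_univ_three, h10, h20] at h11 h22
  simp [h00, h01, h02, h10, h20] at hd
  have e1 : (Q 1 1 - Q 2 2) ^ 2 + (Q 1 2 + Q 2 1) ^ 2 = 0 := by linarith
  have e2 : Q 1 1 - Q 2 2 = 0 := by nlinarith [sq_nonneg (Q 1 1 - Q 2 2), sq_nonneg (Q 1 2 + Q 2 1)]
  have e3 : Q 1 2 + Q 2 1 = 0 := by nlinarith [sq_nonneg (Q 1 1 - Q 2 2), sq_nonneg (Q 1 2 + Q 2 1)]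
  have e4 : Q 2 2 = Q 1 1 := by linarith
  have e5 : Q 1 2 = -Q 2 1 := by linarith
  have hn : ‖(⟨Q 1 1, Q 2 1⟩ : ℂ)‖ = 1 := by
    rw [Complex.norm_def, Complex.normSq_mk, Real.sqrt_eq_one]
    rw [e4] at h22
    linarith
  obtain ⟨θ, hθ⟩ := (Complex.norm_eq_one_iff _).1 hn
  have hc : Real.cos θ = Q 1 1 := by
    rw [← Complex.exp_ofReal_mul_I_re, hθ]
  have hs : Real.sin θ = Q 2 1 := by
    rw [← Complex.exp_ofReal_mul_I_im, hθ]
  refine ⟨θ, ?_⟩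
  ext i j
  fin_cases i <;> fin_cases j <;> simp [rotMat, h00, h01, h02, h10, h20, e4, e5, hc, hs]

theorem mul_proj0_apply (M : MR) (i : Fin 3) : (M * proj0) i 0 = M i 0 := by
  simp [mul_apply, Fin.sum_univ_three, proj0, blockMat]

theorem Adapted.conj {S Q : MR} (hS : Adapted S) (hQ : Q * Qᵀ = 1) (hp : Q * proj0 = proj0 * Q) :
    Adapted (Qᵀ * S * Q) := by
  have hQ' := mul_eq_one_comm.1 hQ
  have hQt : Qᵀ * Qᵀᵀ = 1 := by rwa [transpose_transpose]
  have h1 := hS.posGraph.conj hQt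
  have h2 := det_conj hQt S
  rw [transpose_transpose] at h1 h2
  have h3 : (Qᵀ * S * Q) * proj0 = S 0 0 • proj0 := by
    have h4 : S * proj0 = S 0 0 • proj0 := by
      obtain ⟨a, b, c, d, rfl, -⟩ := hS
      ext i j
      fin_cases i <;> fin_cases j <;> simp [blockMat, proj0]
    rw [mul_assoc, hp, mul_assoc, ← mul_assoc S, h4, smul_mul_assoc, ← hp, mul_smul_comm,
      ← mul_assoc, hQ', one_mul]
  have h5 : ∀ i, (Qᵀ * S * Q) i 0 = S 0 0 * proj0 i 0 := fun i => by
    have h6 := congrFun (congrFun h3 i) 0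
    rw [Matrix.smul_apply, smul_eq_mul] at h6
    rw [← h6, mul_proj0_apply]
  have h00 : S 0 0 < 0 := by
    obtain ⟨a, b, c, d, rfl, ha, -⟩ := hS
    simpa [blockMat] using ha
  refine h1.adapted (h2 ▸ hS.det_neg) ?_ ?_ ?_
  · rw [h5]
    simp [proj0, blockMat]
  · rw [h5]
    simp [proj0, blockMat]
  · rw [h5]
    simpa [proj0, blockMat] using h00

theorem IsAdaptedFrame.frameMul {W : Type*} [NormedAddCommGroup W] [InnerProductSpace ℂ W]
    {V V' : Submodule ℝ W} {ε : Fin 3 → W} {S Q : MR} (h : IsAdaptedFrame V V' ε S)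
    (hQ : Q * Qᵀ = 1) (hp : Q * proj0 = proj0 * Q) :
    IsAdaptedFrame V V' (frameMul ε (cx Q)) (Qᵀ * S * Q) := by
  have hQ' := mul_eq_one_comm.1 hQ
  have hQd : Q.det ≠ 0 := by
    intro h2
    have h3 := congrArg det hQ
    rw [det_mul, h2, zero_mul, det_one] at h3
    exact zero_ne_one h3
  have hQt : Qᵀ * Qᵀᵀ = 1 := by rwa [transpose_transpose]
  refine ⟨orthonormal_frameMul h.orthonormal ?_, ?_, ?_, h.adapted.conj hQ hp⟩
  · rw [star_cx, ← map_mul, hQ', map_one]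
  · rw [Sp_frameMul, mul_one, ← one_mul (cx Q), Sp_mul_cx _ _ hQd]
    exact h.fst
  · have h1 := gmat_conj hQt S
    rw [transpose_transpose] at h1
    rw [Sp_frameMul, h1, ← mul_assoc, ← mul_assoc, ← map_mul, hQ, map_one, one_mul,
      Sp_mul_cx _ _ hQd]
    exact h.snd

theorem frameMul_injective {W : Type*} [NormedAddCommGroup W] [InnerProductSpace ℂ W]
    {ε : Fin 3 → W} (hε : Orthonormal ℂ ε) : Function.Injective (frameMul ε) := fun A B h => by
  ext i j
  have h1 : comb ε (fun i => A i j) = comb ε fun i => B i j := congrFun h j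
  exact congrFun (comb_injective hε h1) i

/-! ### Lifts of normalized pairs along circles -/

/-- The diagonal matrix with entries `-1, -1, 1` if `δ = 1`, the identity if `δ = 0`. -/
def twistMat (δ : ZMod 2) : MR := if δ = 1 then diagonal ![-1, -1, 1] else 1

theorem twistMat_mul_self (δ : ZMod 2) : twistMat δ * (twistMat δ)ᵀ = 1 := by
  rw [twistMat]
  split_ifs
  · rw [diagonal_transpose, diagonal_mul_diagonal, ← diagonal_one]
    congr 1
    ext i
    fin_cases i <;> simp
  · rw [transpose_one, mul_one]

theorem det_twistMat (δ : ZMod 2) : (twistMat δ).det = 1 := by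
  rw [twistMat]
  split_ifs
  · rw [det_diagonal, Fin.prod_univ_three]
    simp
  · exact det_one

theorem twistMat_diagonal (δ : ZMod 2) : ∃ c : Fin 3 → ℝ, twistMat δ = diagonal c := by
  rw [twistMat]
  split_ifs
  · exact ⟨_, rfl⟩
  · exact ⟨1, diagonal_one.symm⟩

theorem twistMat_mul_proj0 (δ : ZMod 2) : twistMat δ * proj0 = proj0 * twistMat δ := by
  have h : proj0 = diagonal ![1, 0, 0] := by
    ext i j
    fin_cases i <;> fin_cases j <;> simp [proj0, blockMat]
  obtain ⟨c, hc⟩ := twistMat_diagonal δ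
  rw [hc, h, diagonal_mul_diagonal, diagonal_mul_diagonal]
  simp_rw [mul_comm]

/-- The monodromy of a lift along a circle. -/
noncomputable def twist (δ : ZMod 2) : SU3 := realSU3 _ (twistMat_mul_self δ) (det_twistMat δ)

section CircleLift

variable {Z : Type*} [TopologicalSpace Z] {E : Z → Type*}
  [TopologicalSpace (TotalSpace (EuclideanSpace ℂ (Fin 3)) E)]
  [∀ z, NormedAddCommGroup (E z)] [∀ z, InnerProductSpace ℂ (E z)]
  [FiberBundle (EuclideanSpace ℂ (Fin 3)) E] [VectorBundle ℂ (EuclideanSpace ℂ (Fin 3)) E]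
  {Ω : SU3Structure E} {e : ∀ z, Fin 3 → E z}

/-- The adapted frames of a pair along a circle form a principal bundle whose structure group
`S(O(1) × O(2))` has two components, which are distinguished by `twist`. -/
theorem exists_circle_lift (he : IsSU3Frame Ω Set.univ e) {V V' : ∀ z, Submodule ℝ (E z)}
    (hV : IsSLSubbundle Ω V) (hV' : IsSLSubbundle Ω V')
    (h : ∀ z, ∃ q : (Fin 3 → E z) × MR, IsAdaptedFrame (V z) (V' z) q.1 q.2) {p : I → Z}
    (hp : IsCircleParam p) : ∃ (u : I → SU3) (δ : ZMod 2), Continuous u ∧ u 1 = u 0 * twist δ ∧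
      ∀ t, ∃ S, IsAdaptedFrame (V (p t)) (V' (p t)) (frameMul (e (p t)) (u t : M3)) S := by
  have ho := fun z => he.orthonormal z trivial
  let G : ∀ z : Z, SU3 → Prop := fun z v =>
    ∃ S, IsAdaptedFrame (V z) (V' z) (frameMul (e z) (v : M3)) S
  have hG : ∀ z v (w : SU3) (Q : MR), G z v → Q * Qᵀ = 1 → Q * proj0 = proj0 * Q →
      (w : M3) = (v : M3) * cx Q → G z w := by
    rintro z v w Q ⟨S, hS⟩ hQ hQp hw
    refine ⟨Qᵀ * S * Q, ?_⟩
    rw [hw, ← frameMul_frameMul]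
    exact hS.frameMul hQ hQp
  have huniq : ∀ z v (w : SU3), G z v → G z w →
      ∃ Q : MR, (w : M3) = (v : M3) * cx Q ∧ Q * Qᵀ = 1 ∧ Q * proj0 = proj0 * Q := by
    rintro z v w ⟨S, hS⟩ ⟨S', hS'⟩
    obtain ⟨Q, hQ, hQQ, -, hQp⟩ := hS.unique hS'
    rw [frameMul_frameMul] at hQ
    exact ⟨Q, frameMul_injective (ho z) hQ, hQQ, hQp⟩
  have hloc := fun t₀ => exists_local_adapted (V := fun t => V (p t)) (V' := fun t => V' (p t)) he
    hp.continuous ⟨hV.1.comp_continuous hp.continuous, fun t => hV.2 _⟩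
    ⟨hV'.1.comp_continuous hp.continuous, fun t => hV'.2 _⟩ (fun t => h (p t)) t₀
  obtain ⟨U₀, hU₀, g₀, S₀, -, -, hg₀⟩ := hloc 0
  -- an adapted frame along the circle; its ends differ by a matrix `Q` in `S(O(1) × O(2))`
  obtain ⟨s, -, hsc, hsG⟩ := exists_section_unitInterval (F := fun _ => SU3) (fun _ v => v)
    (fun t v => G (p t) v) (fun t₀ => by
      obtain ⟨U, hU, g, S, hg, -, hgS⟩ := hloc t₀
      refine ⟨U, hU, fun a ha v hv => ?_⟩
      obtain ⟨Q, hQ, hQQ, hQp⟩ := huniq _ (g a) v ⟨_, hgS a ha⟩ hv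
      refine ⟨fun t => g t * ((g a)⁻¹ * v), by simp, hg.mul continuousOn_const, fun t ht => ?_⟩
      refine hG _ (g t) _ Q ⟨_, hgS t ht⟩ hQQ hQp ?_
      have h1 : (((g a)⁻¹ * v : SU3) : M3) = cx Q := by
        change ((g a)⁻¹ : SU3).1 * (v : M3) = _
        rw [hQ, ← mul_assoc, SU3.coe_inv, (g a).star_mul_self, one_mul]
      change (g t : M3) * (((g a)⁻¹ * v : SU3) : M3) = _
      rw [h1]) (g₀ 0) ⟨_, hg₀ 0 (mem_of_mem_nhds hU₀)⟩
  have h1 : G (p 0) (s 1) := by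
    have := hsG 1
    rwa [← hp.closed] at this
  obtain ⟨Q, hQ, hQQ, hQp⟩ := huniq _ _ _ (hsG 0) h1
  have hQd : Q.det = 1 := by
    have h2 := congrArg det hQ
    rw [det_mul, (s 0).det_eq, (s 1).det_eq, one_mul, det_cx] at h2
    exact_mod_cast h2.symm
  obtain ⟨h01, h02, h10, h20⟩ := apply_eq_zero_of_commute_proj0 hQp
  have hQ00 : Q 0 0 = 1 ∨ Q 0 0 = -1 := by
    have h2 := congrFun (congrFun hQQ 0) 0
    simp [mul_apply, Fin.sum_univ_three, h01, h02] at h2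
    exact mul_self_eq_one_iff.1 h2
  obtain ⟨δ, hδ⟩ : ∃ δ : ZMod 2, Q 0 0 * twistMat δ 0 0 = 1 := by
    rcases hQ00 with h2 | h2
    · exact ⟨0, by simp [h2, twistMat]⟩
    · exact ⟨1, by simp [h2, twistMat]⟩
  have hQQ' := mul_eq_one_comm.1 hQQ
  have hT := twistMat_mul_self δ
  have hpt : proj0ᵀ = proj0 := by
    ext i j
    fin_cases i <;> fin_cases j <;> rfl
  have hQtp : Qᵀ * proj0 = proj0 * Qᵀ := by
    have h2 := congrArg transpose hQp
    rw [transpose_mul, transpose_mul, hpt] at h2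
    exact h2.symm
  -- up to `twist δ`, the matrix `Q` is a rotation of the last two coordinates
  obtain ⟨θ, hθ⟩ := exists_eq_rotMat (Q := Qᵀ * twistMat δ) (by
      rw [transpose_mul, transpose_transpose, mul_assoc, ← mul_assoc (twistMat δ), hT, one_mul,
        hQQ'])
    (by rw [det_mul, det_transpose, hQd, det_twistMat, one_mul])
    (by rw [mul_assoc, twistMat_mul_proj0, ← mul_assoc, hQtp, mul_assoc])
    (by
      obtain ⟨c, hc⟩ := twistMat_diagonal δ
      rw [hc] at hδ ⊢
      rw [mul_diagonal, transpose_apply]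
      simpa using hδ)
  -- undo this rotation gradually along the circle
  refine ⟨fun t => s t * rotSU3 (θ * t), δ, ?_, ?_, fun t => ?_⟩
  · exact hsc.mul (continuous_rotSU3.comp (continuous_const.mul continuous_subtype_val))
  · apply Subtype.ext
    change (s 1 : M3) * cx (rotMat (θ * (1 : ℝ))) =
      (s 0 : M3) * cx (rotMat (θ * (0 : ℝ))) * cx (twistMat δ)
    rw [mul_one, mul_zero, rotMat_zero, map_one, mul_one, ← hθ, hQ, mul_assoc, ← map_mul,
      ← mul_assoc, hQQ, one_mul]
  · exact hG _ (s t) _ (rotMat (θ * t)) (hsG t) (rotMat_mul_transpose _) (rotMat_mul_proj0 _) rfl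

end CircleLift

/-! ### Families of pairs from lifts along circles -/

/-- The unitary part of `1 + i stdMat`. -/
noncomputable def stdUnitary : SU3 :=
  ⟨diagonal ![(3 - 4 * Complex.I) / 5, (2 + Complex.I) / (√5 : ℝ), (2 + Complex.I) / (√5 : ℝ)], by
    have h5 : ((√5 : ℝ) : ℂ) * ((√5 : ℝ) : ℂ) = 5 := by
      rw [← Complex.ofReal_mul, Real.mul_self_sqrt (by norm_num)]
      norm_num
    have h50 : ((√5 : ℝ) : ℂ) ≠ 0 := fun h => by
      rw [h, mul_zero] at h5
      norm_num at h5
    have hI := Complex.I_sq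
    refine ⟨mem_unitaryGroup_iff.2 ?_, ?_⟩
    · rw [star_eq_conjTranspose, diagonal_conjTranspose, diagonal_mul_diagonal, ← diagonal_one]
      congr 1
      ext i
      fin_cases i
      · simp
        linear_combination (-16 / 25) * hI
      · simp
        rw [div_mul_div_comm, h5]
        linear_combination (-1 / 5) * hI
      · simp
        rw [div_mul_div_comm, h5]
        linear_combination (-1 / 5) * hI
    · change (diagonal _ : M3).det = 1
      rw [det_diagonal, Fin.prod_univ_three]
      simp
      rw [mul_assoc, div_mul_div_comm (2 + Complex.I), h5]
      linear_combination (-13 / 25 - 4 / 25 * Complex.I) * hI⟩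

theorem gmat_stdMat : ∃ R : MR, R.det ≠ 0 ∧ gmat stdMat = (stdUnitary : M3) * cx R := by
  have h5 : ((√5 : ℝ) : ℂ) ≠ 0 := by
    exact_mod_cast (Real.sqrt_pos.2 (by norm_num : (0 : ℝ) < 5)).ne'
  refine ⟨diagonal ![5 / 3, √5 / 2, √5 / 2], ?_, ?_⟩
  · rw [det_diagonal, Fin.prod_univ_three]
    simp
  · have h1 : stdMat = diagonal ![-(4 / 3), 1 / 2, 1 / 2] := by
      ext i j
      fin_cases i <;> fin_cases j <;> simp [stdMat, blockMat]
    rw [h1, gmat_diagonal, cx_diagonal]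
    change _ = diagonal _ * diagonal _
    rw [diagonal_mul_diagonal]
    congr 1
    ext i
    fin_cases i
    · simp
      ring
    · simp
      field_simp
    · simp
      field_simp

theorem twist_mul_stdUnitary (δ : ZMod 2) : twist δ * stdUnitary = stdUnitary * twist δ := by
  apply Subtype.ext
  obtain ⟨c, hc⟩ := twistMat_diagonal δ
  change cx (twistMat δ) * diagonal _ = diagonal _ * cx (twistMat δ)
  rw [hc, cx_diagonal, diagonal_mul_diagonal, diagonal_mul_diagonal]
  simp_rw [mul_comm]

theorem Sp_mul_twist {W : Type*} [NormedAddCommGroup W] [InnerProductSpace ℂ W] (ε : Fin 3 → W)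
    (u : SU3) (δ : ZMod 2) : Sp ε ((u * twist δ : SU3) : M3) = Sp ε (u : M3) :=
  Sp_mul_cx ε _ (by rw [det_twistMat]; exact one_ne_zero)

section CircleFamilies

variable {Z : Type*} [TopologicalSpace Z] [ChartedSpace ℝ Z] [T2Space Z] {E : Z → Type*}
  [TopologicalSpace (TotalSpace (EuclideanSpace ℂ (Fin 3)) E)]
  [∀ z, NormedAddCommGroup (E z)] [∀ z, InnerProductSpace ℂ (E z)]
  [FiberBundle (EuclideanSpace ℂ (Fin 3)) E] [VectorBundle ℂ (EuclideanSpace ℂ (Fin 3)) E]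
  {Ω : SU3Structure E} {e : ∀ z, Fin 3 → E z} {p : ConnectedComponents Z → I → Z}

theorem exists_circleParam_eq {Z : Type*} [TopologicalSpace Z] {p : ConnectedComponents Z → I → Z}
    (hr : ∀ z : Z, Set.range (p z) = connectedComponent z) (z : Z) : ∃ t, p z t = z := by
  have : z ∈ Set.range (p z) := (hr z).symm ▸ mem_connectedComponent
  exact this

/-- Lifts to `SU(3)` along all circles that close up to `twist` define families of special Lagrangian
subspaces, as `twist` is a real matrix. -/
theorem exists_circleFamily (he : IsSU3Frame Ω Set.univ e) (hp : ∀ Γ, IsCircleParam (p Γ))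
    (hr : ∀ z : Z, Set.range (p z) = connectedComponent z) {K : Type*} [TopologicalSpace K]
    [CompactSpace K] [T2Space K] {w : ConnectedComponents Z → I × K → SU3}
    (hw : ∀ Γ, Continuous (w Γ)) {δ : ConnectedComponents Z → ZMod 2}
    (hδ : ∀ Γ k, w Γ (1, k) = w Γ (0, k) * twist (δ Γ)) :
    ∃ V : ∀ q : Z × K, Submodule ℝ (E q.1), IsSLFamily Ω (fun q : Z × K => q.1) V ∧
      ∀ Γ t k, V (p Γ t, k) = Sp (e (p Γ t)) (w Γ (t, k) : M3) := by
  choose τ hτ using exists_circleParam_eq hr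
  let V : ∀ q : Z × K, Submodule ℝ (E q.1) := fun q => Sp (e q.1) (w q.1 (τ q.1, q.2) : M3)
  have key : ∀ Γ t k, V (p Γ t, k) = Sp (e (p Γ t)) (w Γ (t, k) : M3) := by
    intro Γ t k
    have h1 : ∀ Γ', Γ' = Γ → ∀ t', p Γ' t' = p Γ t →
        Sp (e (p Γ t)) (w Γ' (t', k) : M3) = Sp (e (p Γ t)) (w Γ (t, k) : M3) := by
      intro Γ' hΓ t' ht'
      subst hΓ
      rcases (hp _).eq_or _ _ ht' with h | ⟨h, h'⟩ | ⟨h, h'⟩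
      · rw [h]
      · rw [h, h', hδ, Sp_mul_twist]
      · rw [h, h', hδ, Sp_mul_twist]
    exact h1 _ (coe_circleParam hr Γ t) _ (hτ _)
  refine ⟨V, (isSLFamily_iff he continuous_fst).2 ⟨fun q => ⟨_, rfl⟩, ?_⟩, key⟩
  refine continuous_of_circleParams hp hr fun Γ => ?_
  have h2 : ∀ q : I × K, phase (e (p Γ q.1)) (V (p Γ q.1, q.2)) =
      (w Γ q : M3) * (w Γ q : M3)ᵀ := fun q => by
    rw [key, phase_Sp (he.orthonormal _ trivial)]
  have h3 : Continuous fun q => (w Γ q : M3) := continuous_subtype_val.comp (hw Γ)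
  refine (h3.mul (Continuous.matrix_transpose h3)).congr fun q => ?_
  exact (h2 q).symm

/-- A family of lifts that close up along all circles defines a family of normalized pairs. -/
theorem exists_circlePairFamily (he : IsSU3Frame Ω Set.univ e) (hp : ∀ Γ, IsCircleParam (p Γ))
    (hr : ∀ z : Z, Set.range (p z) = connectedComponent z) {K : Type*} [TopologicalSpace K]
    [CompactSpace K] [T2Space K] {w : ConnectedComponents Z → I × K → SU3}
    (hw : ∀ Γ, Continuous (w Γ)) {δ : ConnectedComponents Z → ZMod 2}
    (hδ : ∀ Γ k, w Γ (1, k) = w Γ (0, k) * twist (δ Γ)) :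
    ∃ V V' : ∀ q : Z × K, Submodule ℝ (E q.1), IsSLFamily Ω (fun q : Z × K => q.1) V ∧
      IsSLFamily Ω (fun q : Z × K => q.1) V' ∧ (∀ Γ t k, IsAdaptedFrame (V (p Γ t, k))
        (V' (p Γ t, k)) (frameMul (e (p Γ t)) (w Γ (t, k) : M3)) stdMat) ∧
      ∀ k, IsCloseGraphicalPair Ω (fun z => V (z, k)) fun z => V' (z, k) := by
  obtain ⟨V, hV, hVw⟩ := exists_circleFamily (Ω := Ω) he hp hr hw hδ
  obtain ⟨V', hV', hVw'⟩ := exists_circleFamily (Ω := Ω) he hp hr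
    (w := fun Γ q => w Γ q * stdUnitary) (fun Γ => (hw Γ).mul continuous_const) (δ := δ)
    fun Γ k => by rw [hδ, mul_assoc, twist_mul_stdUnitary, mul_assoc]
  have hA : ∀ Γ t k, IsAdaptedFrame (V (p Γ t, k)) (V' (p Γ t, k))
      (frameMul (e (p Γ t)) (w Γ (t, k) : M3)) stdMat := fun Γ t k => by
    refine ⟨orthonormal_frameMul (he.orthonormal _ trivial) (w Γ (t, k)).star_mul_self, ?_, ?_,
      adapted_stdMat⟩
    · rw [hVw, Sp_frameMul, mul_one]
    · obtain ⟨R, hR, hRs⟩ := gmat_stdMat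
      rw [hVw', Sp_frameMul, hRs, ← mul_assoc, Sp_mul_cx _ _ hR]
      rfl
  refine ⟨V, V', hV, hV', hA, fun k => isCloseGraphicalPair_of_adapted he
    ⟨hV.1.comp_continuous (φ := fun z => (z, k)) (continuous_id.prodMk continuous_const),
      fun z => hV.2 (z, k)⟩
    ⟨hV'.1.comp_continuous (φ := fun z => (z, k)) (continuous_id.prodMk continuous_const),
      fun z => hV'.2 (z, k)⟩ fun z => ?_⟩
  obtain ⟨t, ht⟩ := exists_circleParam_eq hr z
  have := hA z t k
  rw [ht] at this
  exact ⟨(_, _), this⟩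

/-! ### Homotopies of pairs -/

theorem CloseGraphicalPair.Homotopic.symm {Z : Type*} [TopologicalSpace Z] {E : Z → Type*}
    [TopologicalSpace (TotalSpace (EuclideanSpace ℂ (Fin 3)) E)]
    [∀ z, NormedAddCommGroup (E z)] [∀ z, InnerProductSpace ℂ (E z)] {Ω : SU3Structure E}
    {P Q : CloseGraphicalPair Ω} (h : P.Homotopic Q) : Q.Homotopic P := by
  obtain ⟨F, F', ⟨hF, hF0, hF1⟩, ⟨hF', hF0', hF1'⟩, hc⟩ := h
  have hφ : Continuous fun q : Z × I => (q.1, unitInterval.symm q.2) :=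
    continuous_fst.prodMk (unitInterval.continuous_symm.comp continuous_snd)
  refine ⟨fun q => F (q.1, unitInterval.symm q.2), fun q => F' (q.1, unitInterval.symm q.2),
    ⟨hF.comp_continuous hφ, fun z => ?_, fun z => ?_⟩,
    ⟨hF'.comp_continuous hφ, fun z => ?_, fun z => ?_⟩,
    fun t => hc (unitInterval.symm t)⟩
  · change F (z, unitInterval.symm 0) = _
    rw [unitInterval.symm_zero, hF1 z]
  · change F (z, unitInterval.symm 1) = _
    rw [unitInterval.symm_one, hF0 z]
  · change F' (z, unitInterval.symm 0) = _
    rw [unitInterval.symm_zero, hF1' z]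
  · change F' (z, unitInterval.symm 1) = _
    rw [unitInterval.symm_one, hF0' z]

/-- The first half of the unit interval, stretched to the unit interval. -/
noncomputable def stretchFst (t : I) : I := Set.projIcc 0 1 zero_le_one (2 * (t : ℝ))

/-- The second half of the unit interval, stretched to the unit interval. -/
noncomputable def stretchSnd (t : I) : I := Set.projIcc 0 1 zero_le_one (2 * (t : ℝ) - 1)

theorem continuous_stretchFst : Continuous stretchFst :=
  continuous_projIcc.comp (continuous_const.mul continuous_subtype_val)

theorem continuous_stretchSnd : Continuous stretchSnd :=
  continuous_projIcc.comp ((continuous_const.mul continuous_subtype_val).sub continuous_const)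

/-- Families of special Lagrangian subspaces can be concatenated, because continuity can be tested on
the phases. -/
theorem IsSLFamily.concat {Z : Type*} [TopologicalSpace Z] {E : Z → Type*}
    [TopologicalSpace (TotalSpace (EuclideanSpace ℂ (Fin 3)) E)]
    [∀ z, NormedAddCommGroup (E z)] [∀ z, InnerProductSpace ℂ (E z)]
    [FiberBundle (EuclideanSpace ℂ (Fin 3)) E] [VectorBundle ℂ (EuclideanSpace ℂ (Fin 3)) E]
    {Ω : SU3Structure E} {e : ∀ z, Fin 3 → E z} (he : IsSU3Frame Ω Set.univ e)
    {F G : ∀ q : Z × I, Submodule ℝ (E q.1)} (hF : IsSLFamily Ω (fun q : Z × I => q.1) F)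
    (hG : IsSLFamily Ω (fun q : Z × I => q.1) G) (hFG : ∀ z, F (z, 1) = G (z, 0)) :
    IsSLFamily Ω (fun q : Z × I => q.1) fun q =>
      if (q.2 : ℝ) ≤ 1 / 2 then F (q.1, stretchFst q.2) else G (q.1, stretchSnd q.2) := by
  rw [isSLFamily_iff he continuous_fst] at hF hG ⊢
  constructor
  · intro q
    split_ifs
    exacts [hF.1 (q.1, stretchFst q.2), hG.1 (q.1, stretchSnd q.2)]
  · have h1 : Continuous fun q : Z × I => phase (e q.1) (F (q.1, stretchFst q.2)) :=
      hF.2.comp (continuous_fst.prodMk (continuous_stretchFst.comp continuous_snd))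
    have h2 : Continuous fun q : Z × I => phase (e q.1) (G (q.1, stretchSnd q.2)) :=
      hG.2.comp (continuous_fst.prodMk (continuous_stretchSnd.comp continuous_snd))
    have h5 := h1.if_le h2 (f := fun q : Z × I => (q.2 : ℝ)) (g := fun _ => 1 / 2)
      (continuous_subtype_val.comp continuous_snd) continuous_const fun q hq => by
        have h3 : stretchFst q.2 = 1 := by
          rw [stretchFst, hq]
          norm_num
        have h4 : stretchSnd q.2 = 0 := by
          rw [stretchSnd, hq]
          norm_num
        rw [h3, h4, hFG]
    exact h5.congr fun q => by split_ifs <;> rfl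

theorem CloseGraphicalPair.Homotopic.trans {Z : Type*} [TopologicalSpace Z] {E : Z → Type*}
    [TopologicalSpace (TotalSpace (EuclideanSpace ℂ (Fin 3)) E)]
    [∀ z, NormedAddCommGroup (E z)] [∀ z, InnerProductSpace ℂ (E z)]
    [FiberBundle (EuclideanSpace ℂ (Fin 3)) E] [VectorBundle ℂ (EuclideanSpace ℂ (Fin 3)) E]
    {Ω : SU3Structure E} {e : ∀ z, Fin 3 → E z} (he : IsSU3Frame Ω Set.univ e)
    {P Q R : CloseGraphicalPair Ω} (h : P.Homotopic Q) (h' : Q.Homotopic R) : P.Homotopic R := by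
  obtain ⟨F, F', ⟨hF, hF0, hF1⟩, ⟨hF', hF0', hF1'⟩, hFc⟩ := h
  obtain ⟨G, G', ⟨hG, hG0, hG1⟩, ⟨hG', hG0', hG1'⟩, hGc⟩ := h'
  have h0 : stretchFst 0 = 0 := by simp [stretchFst]
  have h1 : stretchSnd 1 = 1 := by
    rw [stretchSnd, Set.Icc.coe_one]
    norm_num
  have hle : ((0 : I) : ℝ) ≤ 1 / 2 := by simp
  have hnle : ¬ ((1 : I) : ℝ) ≤ 1 / 2 := by
    rw [Set.Icc.coe_one]
    norm_num
  refine ⟨_, _, ⟨(IsSLFamily.concat (F := F) (G := G) he ⟨hF, fun q => (hFc q.2).1.1.2 q.1⟩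
      ⟨hG, fun q => (hGc q.2).1.1.2 q.1⟩ fun z => (hF1 z).trans (hG0 z).symm).1,
      fun z => ?_, fun z => ?_⟩,
    ⟨(IsSLFamily.concat (F := F') (G := G') he ⟨hF', fun q => (hFc q.2).1.2.1.2 q.1⟩
      ⟨hG', fun q => (hGc q.2).1.2.1.2 q.1⟩ fun z => (hF1' z).trans (hG0' z).symm).1,
      fun z => ?_, fun z => ?_⟩, fun t => ?_⟩
  · change (if ((0 : I) : ℝ) ≤ 1 / 2 then F (z, stretchFst 0) else G (z, stretchSnd 0)) = _
    rw [if_pos hle, h0, hF0]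
  · change (if ((1 : I) : ℝ) ≤ 1 / 2 then F (z, stretchFst 1) else G (z, stretchSnd 1)) = _
    rw [if_neg hnle, h1, hG1]
  · change (if ((0 : I) : ℝ) ≤ 1 / 2 then F' (z, stretchFst 0) else G' (z, stretchSnd 0)) = _
    rw [if_pos hle, h0, hF0']
  · change (if ((1 : I) : ℝ) ≤ 1 / 2 then F' (z, stretchFst 1) else G' (z, stretchSnd 1)) = _
    rw [if_neg hnle, h1, hG1']
  · by_cases ht : (t : ℝ) ≤ 1 / 2
    · simp only [if_pos ht]
      exact hFc (stretchFst t)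
    · simp only [if_neg ht]
      exact hGc (stretchSnd t)

/-- Every normalized pair is homotopic to one for which `B_{V,V'}` has constant eigenvalues. -/
theorem exists_standardization {Z : Type*} [TopologicalSpace Z] {E : Z → Type*}
    [TopologicalSpace (TotalSpace (EuclideanSpace ℂ (Fin 3)) E)]
    [∀ z, NormedAddCommGroup (E z)] [∀ z, InnerProductSpace ℂ (E z)]
    [FiberBundle (EuclideanSpace ℂ (Fin 3)) E] [VectorBundle ℂ (EuclideanSpace ℂ (Fin 3)) E]
    {Ω : SU3Structure E} {e : ∀ z, Fin 3 → E z} (he : IsSU3Frame Ω Set.univ e)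
    (P : CloseGraphicalPair Ω)
    (h : ∀ z, ∃ q : (Fin 3 → E z) × MR, IsAdaptedFrame (P.fst z) (P.snd z) q.1 q.2) :
    ∃ Q : CloseGraphicalPair Ω, P.Homotopic Q ∧ ∀ (z : Z) (ε : Fin 3 → E z) (S : MR),
      IsAdaptedFrame (P.fst z) (P.snd z) ε S →
        IsAdaptedFrame (Q.fst z) (Q.snd z) ε stdMat := by
  have hV := P.isClose.1.1
  have hV' := P.isClose.1.2.1
  have hfam := isSLFamily_deformSpace (V := P.fst) (V' := P.snd) he continuous_id hV hV' h
    isDeformation_standardize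
  have hclose : ∀ s, IsCloseGraphicalPair Ω P.fst
      fun z => deformSpace (standardize s) (P.fst z) (P.snd z) := fun s => by
    refine isCloseGraphicalPair_of_adapted he hV ⟨hfam.1.comp_continuous (φ := fun z => (z, s))
      (continuous_id.prodMk continuous_const), fun z => hfam.2 (z, s)⟩ fun z => ?_
    obtain ⟨q, hq⟩ := h z
    exact ⟨(q.1, standardize s q.2), hq.deform isDeformation_standardize (adapted_standardize hq.adapted s)⟩
  refine ⟨⟨P.fst, _, hclose 1⟩, ⟨fun q => P.fst q.1,
    fun q => deformSpace (standardize q.2) (P.fst q.1) (P.snd q.1),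
    ⟨hV.1.comp_continuous continuous_fst, fun _ => rfl, fun _ => rfl⟩,
    ⟨hfam.1, fun z => ?_, fun z => rfl⟩, hclose⟩, fun z ε S hS => ?_⟩
  · obtain ⟨q, hq⟩ := h z
    change deformSpace (standardize 0) (P.fst z) (P.snd z) = P.snd z
    rw [hq.deformSpace_eq isDeformation_standardize, standardize_zero hq.adapted, hq.snd]
  · have h1 := hS.deform isDeformation_standardize (adapted_standardize hS.adapted 1)
    rwa [standardize_one hS.adapted] at h1

end CircleFamilies

/-! ### Normalized pairs with the same monodromy -/

section Matching

variable {Z : Type*} [TopologicalSpace Z] [ChartedSpace ℝ Z] [T2Space Z] {E : Z → Type*}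
  [TopologicalSpace (TotalSpace (EuclideanSpace ℂ (Fin 3)) E)]
  [∀ z, NormedAddCommGroup (E z)] [∀ z, InnerProductSpace ℂ (E z)]
  [FiberBundle (EuclideanSpace ℂ (Fin 3)) E] [VectorBundle ℂ (EuclideanSpace ℂ (Fin 3)) E]
  {Ω : SU3Structure E} {e : ∀ z, Fin 3 → E z} {p : ConnectedComponents Z → I → Z}

/-- As `SU(3)` is simply connected, lifts with the same monodromy are homotopic through lifts with
this monodromy. -/
theorem exists_homotopy_of_twist {u v : I → SU3} (hu : Continuous u) (hv : Continuous v)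
    {δ : ZMod 2} (hu1 : u 1 = u 0 * twist δ) (hv1 : v 1 = v 0 * twist δ) :
    ∃ w : I × I → SU3, Continuous w ∧ (∀ t, w (t, 0) = u t) ∧ (∀ t, w (t, 1) = v t) ∧
      ∀ s, w (1, s) = w (0, s) * twist δ := by
  have hpath : ∀ {u : I → SU3}, Continuous u → u 1 = u 0 * twist δ →
      ∃ γ : Path (1 : SU3) (twist δ), ∀ t, γ t = (u 0)⁻¹ * u t := fun {u} hu hu1 =>
    ⟨⟨⟨fun t => (u 0)⁻¹ * u t, continuous_const.mul hu⟩, inv_mul_cancel _,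
      by change (u 0)⁻¹ * u 1 = _; rw [hu1, inv_mul_cancel_left]⟩, fun _ => rfl⟩
  obtain ⟨γ, hγ⟩ := hpath hu hu1
  obtain ⟨γ', hγ'⟩ := hpath hv hv1
  -- `u 0 * γ` and `v 0 * γ'` are translates of homotopic paths from `1` to `twist δ`
  obtain ⟨H⟩ := SimplyConnectedSpace.paths_homotopic γ γ'
  let c : Path (u 0) (v 0) := PathConnectedSpace.somePath _ _
  refine ⟨fun q => c q.2 * H (q.2, q.1), (c.continuous.comp continuous_snd).mul
    (H.continuous.comp continuous_swap), fun t => ?_, fun t => ?_, fun s => ?_⟩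
  · change c 0 * H (0, t) = _
    rw [c.source, H.apply_zero]
    change u 0 * γ t = _
    rw [hγ, mul_inv_cancel_left]
  · change c 1 * H (1, t) = _
    rw [c.target, H.apply_one]
    change v 0 * γ' t = _
    rw [hγ', mul_inv_cancel_left]
  · change c s * H (s, 1) = c s * H (s, 0) * _
    rw [H.target, H.source, mul_one]

/-- Normalized pairs whose lifts have the same monodromy around all components are homotopic. -/
theorem homotopic_of_twist (he : IsSU3Frame Ω Set.univ e) (hp : ∀ Γ, IsCircleParam (p Γ))
    (hr : ∀ z : Z, Set.range (p z) = connectedComponent z) (P Q : CloseGraphicalPair Ω)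
    (hP : ∀ z, ∃ q : (Fin 3 → E z) × MR, IsAdaptedFrame (P.fst z) (P.snd z) q.1 q.2)
    (hQ : ∀ z, ∃ q : (Fin 3 → E z) × MR, IsAdaptedFrame (Q.fst z) (Q.snd z) q.1 q.2)
    {u v : ConnectedComponents Z → I → SU3} {δ : ConnectedComponents Z → ZMod 2}
    (hu : ∀ Γ, Continuous (u Γ)) (hu1 : ∀ Γ, u Γ 1 = u Γ 0 * twist (δ Γ))
    (huP : ∀ Γ t, ∃ S, IsAdaptedFrame (P.fst (p Γ t)) (P.snd (p Γ t))
      (frameMul (e (p Γ t)) (u Γ t : M3)) S)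
    (hv : ∀ Γ, Continuous (v Γ)) (hv1 : ∀ Γ, v Γ 1 = v Γ 0 * twist (δ Γ))
    (hvQ : ∀ Γ t, ∃ S, IsAdaptedFrame (Q.fst (p Γ t)) (Q.snd (p Γ t))
      (frameMul (e (p Γ t)) (v Γ t : M3)) S) : P.Homotopic Q := by
  obtain ⟨P', hPP', hP'⟩ := exists_standardization he P hP
  obtain ⟨Q', hQQ', hQ'⟩ := exists_standardization he Q hQ
  choose w hw hw0 hw1 hwδ using fun Γ =>
    exists_homotopy_of_twist (hu Γ) (hv Γ) (hu1 Γ) (hv1 Γ)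
  obtain ⟨V, V', hV, hV', hA, hc⟩ := exists_circlePairFamily (Ω := Ω) he hp hr hw hwδ
  have key0 : ∀ z, V (z, 0) = P'.fst z ∧ V' (z, 0) = P'.snd z := fun z => by
    obtain ⟨t, ht⟩ := exists_circleParam_eq hr z
    obtain ⟨S, hS⟩ := huP z t
    have h1 := hA z t 0
    have h2 := hP' _ _ _ hS
    rw [hw0] at h1
    rw [← ht]
    exact ⟨h1.fst.trans h2.fst.symm, h1.snd.trans h2.snd.symm⟩
  have key1 : ∀ z, V (z, 1) = Q'.fst z ∧ V' (z, 1) = Q'.snd z := fun z => by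
    obtain ⟨t, ht⟩ := exists_circleParam_eq hr z
    obtain ⟨S, hS⟩ := hvQ z t
    have h1 := hA z t 1
    have h2 := hQ' _ _ _ hS
    rw [hw1] at h1
    rw [← ht]
    exact ⟨h1.fst.trans h2.fst.symm, h1.snd.trans h2.snd.symm⟩
  have hPQ : P'.Homotopic Q' := ⟨V, V', ⟨hV.1, fun z => (key0 z).1, fun z => (key1 z).1⟩,
    ⟨hV'.1, fun z => (key0 z).2, fun z => (key1 z).2⟩, hc⟩
  exact (hPP'.trans he hPQ).trans he hQQ'.symm

end Matching

/-! ### Reordering -/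

section PosPairs

variable {W : Type*} [NormedAddCommGroup W] [InnerProductSpace ℂ W]

/-- In a suitable unitary basis, `V` is spanned by the basis vectors, and `V'` is the graph of a
matrix satisfying the inequality `PosGraph` that characterizes close pairs. -/
def IsPosPair (V V' : Submodule ℝ W) : Prop :=
  ∃ (ε : Fin 3 → W) (S : MR), Orthonormal ℂ ε ∧ V = Sp ε 1 ∧ V' = Sp ε (gmat S) ∧ PosGraph S

theorem IsPosPair.cases {V V' : Submodule ℝ W} (h : IsPosPair V V') :
    (OneNegTwoPos V V' ∧ ¬ OneNegTwoPos V' V ∧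
      ∃ q : (Fin 3 → W) × MR, IsAdaptedFrame V V' q.1 q.2) ∨
    (¬ OneNegTwoPos V V' ∧ OneNegTwoPos V' V ∧
      ∃ q : (Fin 3 → W) × MR, IsAdaptedFrame V' V q.1 q.2) := by
  obtain ⟨ε, S, hε, rfl, rfl, hS⟩ := h
  rw [oneNegTwoPos_iff_det_neg hε hS, oneNegTwoPos_reversed_iff hε hS]
  rcases hS.det_ne.lt_or_gt with hd | hd
  · exact Or.inl ⟨hd, hd.le.not_gt, exists_isAdaptedFrame hε hS hd⟩
  · exact Or.inr ⟨hd.le.not_gt, hd, exists_isAdaptedFrame_reversed hε hS hd⟩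

theorem IsPosPair.distinguishedLine_comm {V V' : Submodule ℝ W} (h : IsPosPair V V') :
    distinguishedLine V V' = distinguishedLine V' V := by
  rcases h.cases with ⟨h1, h2, -⟩ | ⟨h1, h2, -⟩
  · rw [distinguishedLine, distinguishedLine, if_pos h1, if_neg h2]
  · rw [distinguishedLine, distinguishedLine, if_neg h1, if_pos h2]

theorem IsPosPair.exists_isAdaptedFrame {V V' : Submodule ℝ W} (h : IsPosPair V V')
    (hn : OneNegTwoPos V V') : ∃ q : (Fin 3 → W) × MR, IsAdaptedFrame V V' q.1 q.2 := by
  rcases h.cases with ⟨-, -, h⟩ | ⟨h1, -⟩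
  exacts [h, absurd hn h1]

theorem IsPosPair.posGraph {V V' : Submodule ℝ W} (h : IsPosPair V V') {ε : Fin 3 → W} {S : MR}
    (hε : Orthonormal ℂ ε) (h1 : V = Sp ε 1) (h2 : V' = Sp ε (gmat S)) : PosGraph S := by
  obtain ⟨ε', S', hε', h1', h2', hS'⟩ := h
  obtain ⟨Q, -, hQ, rfl⟩ := exists_conj_of_graph_eq hε hε' (h1.symm.trans h1') (h2.symm.trans h2')
  exact hS'.conj hQ

theorem IsPosPair.J_inf_eq_bot {V V' : Submodule ℝ W} (h : IsPosPair V V') : V.map J ⊓ V' = ⊥ := by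
  obtain ⟨ε, S, hε, rfl, rfl, -⟩ := h
  have h2 := J_Sp_inf_graph hε 1 S
  change (Sp ε 1).map J ⊓ Sp ε (1 * gmat S) = ⊥ at h2
  rwa [one_mul] at h2

end PosPairs

section Reordering

variable {Z : Type*} {E : Z → Type*}
  [TopologicalSpace (TotalSpace (EuclideanSpace ℂ (Fin 3)) E)]
  [∀ z, NormedAddCommGroup (E z)] [∀ z, InnerProductSpace ℂ (E z)]
  {B : Type*} [TopologicalSpace B] {f : B → Z}

theorem isSubbundle_of_eventuallyEq {k : ℕ} {V : ∀ b, Submodule ℝ (E (f b))}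
    (h : ∀ b₀, ∃ W : ∀ b, Submodule ℝ (E (f b)), IsSubbundle f k W ∧ ∀ᶠ b in 𝓝 b₀, V b = W b) :
    IsSubbundle f k V := by
  intro b₀
  obtain ⟨W, hW, hVW⟩ := h b₀
  obtain ⟨U, hU, s, hs, hUW⟩ := hW b₀
  exact ⟨U ∩ {b | V b = W b}, Filter.inter_mem hU hVW, s,
    fun i => (hs i).mono Set.inter_subset_left, fun b hb => ⟨(hUW b hb.1).1,
      (show V b = W b from hb.2).trans (hUW b hb.1).2⟩⟩

variable [TopologicalSpace Z]

open Classical in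
theorem IsSLFamily.ite {Ω : SU3Structure E} {V W : ∀ b, Submodule ℝ (E (f b))} {R : Set B}
    (hR : IsClopen R) (hV : IsSLFamily Ω f V) (hW : IsSLFamily Ω f W) :
    IsSLFamily Ω f fun b => if b ∈ R then V b else W b := by
  refine ⟨isSubbundle_of_eventuallyEq fun b₀ => ?_, fun b => ?_⟩
  · by_cases hb : b₀ ∈ R
    · refine ⟨V, hV.1, ?_⟩
      filter_upwards [hR.isOpen.mem_nhds hb] with b hb
      exact if_pos hb
    · refine ⟨W, hW.1, ?_⟩
      filter_upwards [hR.compl.isOpen.mem_nhds hb] with b hb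
      exact if_neg hb
  · change IsSpecialLagrangian _ (if b ∈ R then V b else W b)
    split_ifs
    exacts [hV.2 b, hW.2 b]

variable [FiberBundle (EuclideanSpace ℂ (Fin 3)) E] [VectorBundle ℂ (EuclideanSpace ℂ (Fin 3)) E]
  {Ω : SU3Structure E} {e : ∀ z, Fin 3 → E z} {V V' : ∀ b, Submodule ℝ (E (f b))}

/-- The signs of the eigenvalues are determined by the sign of `det S`, which never vanishes. -/
theorem isClopen_oneNegTwoPos (he : IsSU3Frame Ω Set.univ e) (hf : Continuous f)
    (hV : IsSLFamily Ω f V) (hV' : IsSLFamily Ω f V') (h : ∀ b, IsPosPair (V b) (V' b)) :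
    IsClopen {b | OneNegTwoPos (V b) (V' b)} := by
  have key : ∀ b₀, ∃ (S : B → MR), ContinuousAt (fun b => (S b).det) b₀ ∧ (S b₀).det ≠ 0 ∧
      (∀ᶠ b in 𝓝 b₀, OneNegTwoPos (V b) (V' b) ↔ (S b).det < 0) := fun b₀ => by
    obtain ⟨U, hU, g, S, -, hS, hgS⟩ :=
      exists_local_graph he hf hV hV' (fun b => (h b).J_inf_eq_bot) b₀
    have hp : ∀ b ∈ U, PosGraph (S b) ∧ (OneNegTwoPos (V b) (V' b) ↔ (S b).det < 0) :=
      fun b hb => by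
        have ho := orthonormal_frameMul (he.orthonormal (f b) trivial) (g b).star_mul_self
        have h1 : V b = Sp (frameMul (e (f b)) (g b : M3)) 1 := by
          rw [Sp_frameMul, mul_one]
          exact (hgS b hb).1
        have h2 : V' b = Sp (frameMul (e (f b)) (g b : M3)) (gmat (S b)) := by
          rw [Sp_frameMul]
          exact (hgS b hb).2.1
        have h3 := (h b).posGraph ho h1 h2
        exact ⟨h3, by rw [h1, h2, oneNegTwoPos_iff_det_neg ho h3]⟩
    refine ⟨S, ?_, (hp b₀ (mem_of_mem_nhds hU)).1.det_ne, ?_⟩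
    · exact (Continuous.matrix_det continuous_id).continuousAt.comp (hS.continuousAt hU)
    · filter_upwards [hU] with b hb using (hp b hb).2
  constructor
  · rw [← isOpen_compl_iff, isOpen_iff_mem_nhds]
    intro b₀ hb₀
    obtain ⟨S, hS, hS0, hev⟩ := key b₀
    have hpos : 0 < (S b₀).det :=
      (not_lt.1 fun hlt => hb₀ (hev.self_of_nhds.2 hlt)).lt_of_ne' hS0
    filter_upwards [hev, hS.eventually (lt_mem_nhds hpos)] with b h1 h2 h3
    exact h2.not_gt (h1.1 h3)
  · rw [isOpen_iff_mem_nhds]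
    intro b₀ hb₀
    obtain ⟨S, hS, hS0, hev⟩ := key b₀
    filter_upwards [hev, hS.eventually (gt_mem_nhds (hev.self_of_nhds.1 hb₀))] with b h1 h2
    exact h1.2 h2

/-- Every family of positive pairs can be reordered, over an open and closed set, to become
normalized. -/
theorem exists_reordering (he : IsSU3Frame Ω Set.univ e) (hf : Continuous f)
    (hV : IsSLFamily Ω f V) (hV' : IsSLFamily Ω f V') (h : ∀ b, IsPosPair (V b) (V' b)) :
    ∃ (R : Set B) (W W' : ∀ b, Submodule ℝ (E (f b))), IsClopen R ∧ IsSLFamily Ω f W ∧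
      IsSLFamily Ω f W' ∧ (∀ b ∈ R, W b = V' b ∧ W' b = V b) ∧
      (∀ b ∉ R, W b = V b ∧ W' b = V' b) ∧
      ∀ b, ∃ q : (Fin 3 → E (f b)) × MR, IsAdaptedFrame (W b) (W' b) q.1 q.2 := by
  classical
  have hR := (isClopen_oneNegTwoPos he hf hV hV' h).compl
  set R := {b | OneNegTwoPos (V b) (V' b)}ᶜ with hRdef
  refine ⟨R, _, _, hR, hV'.ite hR hV, hV.ite hR hV', fun b hb => ⟨if_pos hb, if_pos hb⟩,
    fun b hb => ⟨if_neg hb, if_neg hb⟩, fun b => ?_⟩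
  by_cases hb : b ∈ R
  · simp only [if_pos hb]
    rcases (h b).cases with ⟨h1, -⟩ | ⟨-, -, h1⟩
    exacts [absurd h1 hb, h1]
  · simp only [if_neg hb]
    exact (h b).exists_isAdaptedFrame (not_not.1 hb)

/-- Near each point, the distinguished line is spanned by the first vector of a continuous unitary
frame. -/
theorem exists_local_distinguishedLine (he : IsSU3Frame Ω Set.univ e) (hf : Continuous f)
    (hV : IsSLFamily Ω f V) (hV' : IsSLFamily Ω f V') (h : ∀ b, IsPosPair (V b) (V' b)) (b₀ : B) :
    ∃ U ∈ 𝓝 b₀, ∃ g : B → SU3, ContinuousOn g U ∧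
      ∀ b ∈ U, distinguishedLine (V b) (V' b) =
        Submodule.span ℝ {frameMul (e (f b)) (g b : M3) 0} := by
  obtain ⟨R, W, W', -, hW, hW', hR, hR', hq⟩ := exists_reordering he hf hV hV' h
  obtain ⟨U, hU, g, S, hg, -, hgS⟩ := exists_local_adapted he hf hW hW' hq b₀
  refine ⟨U, hU, g, hg, fun b hb => ?_⟩
  rw [← (hgS b hb).distinguishedLine_eq]
  by_cases hbR : b ∈ R
  · rw [(hR b hbR).1, (hR b hbR).2, (h b).distinguishedLine_comm]
  · rw [(hR' b hbR).1, (hR' b hbR).2]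

end Reordering

/-! ### Monodromy of families of lines -/

section Lines

/-- The real inner product of `ℂ³`. -/
def realDot (v w : Fin 3 → ℂ) : ℝ := ∑ i, ((v i).re * (w i).re + (v i).im * (w i).im)

theorem continuous_realDot : Continuous fun q : (Fin 3 → ℂ) × (Fin 3 → ℂ) => realDot q.1 q.2 := by
  unfold realDot
  fun_prop

theorem realDot_comm (v w : Fin 3 → ℂ) : realDot v w = realDot w v :=
  Finset.sum_congr rfl fun i _ => by ring

theorem realDot_smul_left (r : ℝ) (v w : Fin 3 → ℂ) : realDot (r • v) w = r * realDot v w := by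
  rw [realDot, realDot, Finset.mul_sum]
  refine Finset.sum_congr rfl fun i _ => ?_
  simp only [Pi.smul_apply, Complex.smul_re, Complex.smul_im, smul_eq_mul]
  ring

theorem realDot_smul_right (r : ℝ) (v w : Fin 3 → ℂ) : realDot v (r • w) = r * realDot v w := by
  rw [realDot_comm, realDot_smul_left, realDot_comm]

theorem realDot_self_pos {v : Fin 3 → ℂ} (hv : v ≠ 0) : 0 < realDot v v := by
  obtain ⟨i, hi⟩ := Function.ne_iff.1 hv
  refine Finset.sum_pos' (fun j _ => add_nonneg (mul_self_nonneg _) (mul_self_nonneg _))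
    ⟨i, Finset.mem_univ i, ?_⟩
  have h := Complex.normSq_pos.2 hi
  rwa [Complex.normSq_apply] at h

/-- The orthogonal projection onto the real line spanned by `l`. -/
noncomputable def realProj (l a : Fin 3 → ℂ) : Fin 3 → ℂ := (realDot l a / realDot l l) • l

theorem realProj_smul_left {r : ℝ} (hr : r ≠ 0) (l a : Fin 3 → ℂ) :
    realProj (r • l) a = realProj l a := by
  rw [realProj, realProj, realDot_smul_left, realDot_smul_left, realDot_smul_right, smul_smul,
    mul_div_mul_left _ _ hr, div_mul_eq_mul_div, mul_comm (realDot l a), mul_div_mul_left _ _ hr]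

theorem realProj_smul_right (r : ℝ) (l a : Fin 3 → ℂ) :
    realProj l (r • a) = r • realProj l a := by
  rw [realProj, realProj, realDot_smul_right, smul_smul, mul_div_assoc]

theorem realProj_ne_zero {l a : Fin 3 → ℂ} (hl : l ≠ 0) (h : realDot l a ≠ 0) :
    realProj l a ≠ 0 :=
  smul_ne_zero (div_ne_zero h (realDot_self_pos hl).ne') hl

variable {Z : Type*} {E : Z → Type*}
  [∀ z, NormedAddCommGroup (E z)] [∀ z, InnerProductSpace ℂ (E z)]
  {e : ∀ z, Fin 3 → E z} {B : Type*} [TopologicalSpace B] {f : B → Z}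

/-- The real line spanned by the vector with coefficients `l`. -/
noncomputable def lineOf {W : Type*} [NormedAddCommGroup W] [InnerProductSpace ℂ W]
    (ε : Fin 3 → W) (l : Fin 3 → ℂ) : Submodule ℝ W := Submodule.span ℝ {comb ε l}

theorem comb_mem_lineOf {W : Type*} [NormedAddCommGroup W] [InnerProductSpace ℂ W]
    {ε : Fin 3 → W} (hε : Orthonormal ℂ ε) {l a : Fin 3 → ℂ} :
    comb ε a ∈ lineOf ε l ↔ ∃ r : ℝ, r • l = a := by
  rw [lineOf, Submodule.mem_span_singleton]
  refine exists_congr fun r => ?_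
  rw [← Complex.coe_smul, ← map_smul, (comb_injective hε).eq_iff, Complex.coe_smul]

/-- In coordinates, the family of real lines `L` is locally spanned by a continuous nonvanishing
section. -/
def IsLineFamily (e : ∀ z, Fin 3 → E z) (f : B → Z) (L : ∀ b, Submodule ℝ (E (f b))) : Prop :=
  ∀ b₀, ∃ U ∈ 𝓝 b₀, ∃ l : B → Fin 3 → ℂ, ContinuousOn l U ∧
    ∀ b ∈ U, l b ≠ 0 ∧ L b = lineOf (e (f b)) (l b)

theorem IsLineFamily.comp_continuous {L : ∀ b, Submodule ℝ (E (f b))} (hL : IsLineFamily e f L)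
    {B' : Type*} [TopologicalSpace B'] {φ : B' → B} (hφ : Continuous φ) :
    IsLineFamily e (fun b => f (φ b)) fun b => L (φ b) := by
  intro b₀
  obtain ⟨U, hU, l, hl, hUl⟩ := hL (φ b₀)
  exact ⟨φ ⁻¹' U, hφ.continuousAt hU, fun b => l (φ b), hl.comp hφ.continuousOn fun _ h => h,
    fun b hb => hUl _ hb⟩

theorem IsLineFamily.exists_eq {L : ∀ b, Submodule ℝ (E (f b))} (hL : IsLineFamily e f L) (b : B) :
    ∃ l : Fin 3 → ℂ, l ≠ 0 ∧ L b = lineOf (e (f b)) l := by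
  obtain ⟨U, hU, l, -, hUl⟩ := hL b
  exact ⟨l b, hUl b (mem_of_mem_nhds hU)⟩

variable [TopologicalSpace Z] [TopologicalSpace (TotalSpace (EuclideanSpace ℂ (Fin 3)) E)]
  [FiberBundle (EuclideanSpace ℂ (Fin 3)) E] [VectorBundle ℂ (EuclideanSpace ℂ (Fin 3)) E]
  {Ω : SU3Structure E}

theorem IsLineFamily.isSubbundle (he : IsSU3Frame Ω Set.univ e) (hf : Continuous f)
    {L : ∀ b, Submodule ℝ (E (f b))} (hL : IsLineFamily e f L) : IsSubbundle f 1 L := by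
  intro b₀
  obtain ⟨U, hU, l, hl, hUl⟩ := hL b₀
  refine ⟨U, hU, fun _ b => comb (e (f b)) (l b),
    fun _ => he.continuousOn_comb hf.continuousOn (fun _ _ => trivial) hl, fun b hb => ⟨?_, ?_⟩⟩
  · rw [linearIndependent_unique_iff]
    exact (map_ne_zero_iff _ (comb_injective (he.orthonormal _ trivial))).2 (hUl b hb).1
  · rw [Set.range_const]
    exact (hUl b hb).2

theorem isLineFamily_distinguishedLine (he : IsSU3Frame Ω Set.univ e) (hf : Continuous f)
    {V V' : ∀ b, Submodule ℝ (E (f b))} (hV : IsSLFamily Ω f V) (hV' : IsSLFamily Ω f V')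
    (h : ∀ b, IsPosPair (V b) (V' b)) :
    IsLineFamily e f fun b => distinguishedLine (V b) (V' b) := by
  intro b₀
  obtain ⟨U, hU, g, hg, hgL⟩ := exists_local_distinguishedLine he hf hV hV' h b₀
  refine ⟨U, hU, fun b i => (g b : M3) i 0, ?_, fun b hb => ⟨fun h0 => ?_, hgL b hb⟩⟩
  · exact continuousOn_pi.2 fun i => (continuous_id.matrix_elem i 0).comp_continuousOn
      (continuous_subtype_val.comp_continuousOn hg)
  · have h1 : (g b : M3).det = 0 := det_eq_zero_of_column_eq_zero 0 fun i => congrFun h0 i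
    rw [(g b).det_eq] at h1
    exact one_ne_zero h1

/-- The monodromy of a family of lines, in coordinates. -/
theorem reversesOrientation_iff (he : IsSU3Frame Ω Set.univ e) {L : ∀ z, Submodule ℝ (E z)} {z : Z}
    (γ : Path z z) : ReversesOrientation L γ ↔ ∃ a : I → Fin 3 → ℂ, Continuous a ∧
      (∀ t, comb (e (γ t)) (a t) ∈ L (γ t) ∧ a t ≠ 0) ∧ ∃ c : ℝ, c < 0 ∧ a 1 = c • a 0 := by
  have hend : ∀ (x y : Z) (hxy : x = y) (v w : Fin 3 → ℂ),
      (⟨x, comb (e x) v⟩ : TotalSpace (EuclideanSpace ℂ (Fin 3)) E) = ⟨y, comb (e y) w⟩ ↔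
        v = w := by
    rintro x _ rfl v w
    refine ⟨fun h => ?_, fun h => by rw [h]⟩
    exact comb_injective (he.orthonormal x trivial) (TotalSpace.mk_injective x h)
  have hγ : γ 1 = γ 0 := by rw [γ.target, γ.source]
  have hsm : ∀ (c : ℝ) (v : Fin 3 → ℂ), c • comb (e (γ 0)) v = comb (e (γ 0)) (c • v) :=
    fun c v => by rw [← Complex.coe_smul, ← map_smul, Complex.coe_smul]
  constructor
  · rintro ⟨s, hs, hsL, c, hc, hsc⟩
    choose a ha using fun t =>
      exists_comb (he.orthonormal (γ t) trivial) (finrank_fibre E (γ t)) (s t)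
    obtain rfl : s = fun t => comb (e (γ t)) (a t) := funext ha
    refine ⟨a, ?_, fun t => ⟨(hsL t).1, fun h0 => (hsL t).2 ?_⟩, c, hc, ?_⟩
    · exact continuousOn_univ.1 (he.continuousOn_coeff γ.continuous.continuousOn
        (fun _ _ => trivial) hs.continuousOn)
    · change comb _ (a t) = 0
      rw [h0, map_zero]
    · rw [hsm] at hsc
      exact (hend _ _ hγ _ _).1 hsc
  · rintro ⟨a, ha, haL, c, hc, hac⟩
    refine ⟨fun t => comb (e (γ t)) (a t), ?_, fun t => ⟨(haL t).1, ?_⟩, c, hc, ?_⟩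
    · exact continuousOn_univ.1 (he.continuousOn_comb γ.continuous.continuousOn
        (fun _ _ => trivial) ha.continuousOn)
    · exact (map_ne_zero_iff _ (comb_injective (he.orthonormal _ trivial))).2 (haL t).2
    · rw [hsm]
      exact (hend _ _ hγ _ _).2 hac

/-- If the lines of two families are nowhere orthogonal, then orthogonal projection identifies the
families, so they have the same monodromy. -/
theorem ReversesOrientation.of_not_orthogonal (he : IsSU3Frame Ω Set.univ e)
    {L L' : ∀ z, Submodule ℝ (E z)} (hL' : IsLineFamily e (fun z => z) L')
    (h : ∀ z v v', v ≠ 0 → v' ≠ 0 → comb (e z) v ∈ L z → comb (e z) v' ∈ L' z → realDot v v' ≠ 0)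
    {z : Z} {γ : Path z z} (hγ : ReversesOrientation L γ) : ReversesOrientation L' γ := by
  rw [reversesOrientation_iff he] at hγ ⊢
  obtain ⟨a, ha, haL, c, hc, hac⟩ := hγ
  choose l hl hlL using hL'.exists_eq
  have ho := fun z => he.orthonormal z trivial
  have hself : ∀ z, comb (e z) (l z) ∈ L' z := fun z => by
    rw [hlL, comb_mem_lineOf (ho z)]
    exact ⟨1, one_smul _ _⟩
  have h01 : γ 1 = γ 0 := by rw [γ.target, γ.source]
  -- the projection of `a` to `L'` does not depend on the choice of spanning vectors `l`
  refine ⟨fun t => realProj (l (γ t)) (a t), continuous_iff_continuousAt.2 fun t₀ => ?_,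
    fun t => ⟨?_, ?_⟩, c, hc, ?_⟩
  · obtain ⟨U, hU, m, hm, hmL⟩ := hL'.comp_continuous γ.continuous t₀
    have hmc := hm.continuousAt hU
    have hcont : ContinuousAt (fun t => realProj (m t) (a t)) t₀ := by
      refine ContinuousAt.fun_smul (ContinuousAt.div₀ ?_ ?_
        (realDot_self_pos (hmL t₀ (mem_of_mem_nhds hU)).1).ne') hmc
      · exact continuous_realDot.continuousAt.comp (hmc.prodMk ha.continuousAt)
      · exact continuous_realDot.continuousAt.comp (hmc.prodMk hmc)
    refine hcont.congr ?_
    filter_upwards [hU] with t ht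
    have h1 := hself (γ t)
    rw [show L' (γ t) = _ from (hmL t ht).2, comb_mem_lineOf (ho _)] at h1
    obtain ⟨r, hr⟩ := h1
    have hr0 : r ≠ 0 := by
      rintro rfl
      exact hl (γ t) (by rw [← hr, zero_smul])
    rw [← hr, realProj_smul_left hr0]
  · rw [hlL, comb_mem_lineOf (ho _)]
    exact ⟨_, rfl⟩
  · refine realProj_ne_zero (hl _) ?_
    rw [realDot_comm]
    exact h _ _ _ (haL t).2 (hl _) (haL t).1 (hself _)
  · change realProj (l (γ 1)) (a 1) = _
    rw [h01, hac, realProj_smul_right]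

/-- The monodromy of a family of lines over a compact base does not change under homotopies. -/
theorem reversesOrientation_homotopy [CompactSpace Z] (he : IsSU3Frame Ω Set.univ e)
    {L : ∀ q : Z × I, Submodule ℝ (E q.1)} (hL : IsLineFamily e (fun q : Z × I => q.1) L) {z : Z}
    (γ : Path z z) : ReversesOrientation (fun z => L (z, 0)) γ ↔
      ReversesOrientation (fun z => L (z, 1)) γ := by
  have hslice : ∀ s, IsLineFamily e (fun z => z) fun z => L (z, s) := fun s =>
    hL.comp_continuous (φ := fun z => (z, s)) (continuous_id.prodMk continuous_const)
  have hloc : IsLocallyConstant fun s => ReversesOrientation (fun z => L (z, s)) γ := by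
    rw [IsLocallyConstant.iff_eventually_eq]
    intro s₀
    -- by compactness, the lines at time `s` close to `s₀` are nowhere orthogonal to those at time `s₀`
    have hev : ∀ᶠ s in 𝓝 s₀, ∀ z ∈ (Set.univ : Set Z), ∀ v v' : Fin 3 → ℂ, v ≠ 0 → v' ≠ 0 →
        comb (e z) v ∈ L (z, s₀) → comb (e z) v' ∈ L (z, s) → realDot v v' ≠ 0 := by
      refine isCompact_univ.eventually_forall_of_forall_eventually fun z₀ _ => ?_
      obtain ⟨U, hU, l, hl, hlL⟩ := hL (z₀, s₀)
      have h1 : ContinuousAt (fun q : I × Z => l (q.2, q.1)) (s₀, z₀) :=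
        (hl.continuousAt hU).comp (f := fun q : I × Z => (q.2, q.1))
          continuous_swap.continuousAt
      have h2 : Continuous fun q : I × Z => (q.2, s₀) := continuous_snd.prodMk continuous_const
      have h3 : ContinuousAt (fun q : I × Z => l (q.2, s₀)) (s₀, z₀) :=
        (hl.continuousAt hU).comp (f := fun q : I × Z => (q.2, s₀)) h2.continuousAt
      have h4 : ContinuousAt (fun q : I × Z => realDot (l (q.2, s₀)) (l (q.2, q.1))) (s₀, z₀) :=
        continuous_realDot.continuousAt.comp (h3.prodMk h1)
      have hl0 := (hlL _ (mem_of_mem_nhds hU)).1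
      filter_upwards [h4.eventually_ne (realDot_self_pos hl0).ne',
        (continuous_swap.tendsto (s₀, z₀)).eventually hU,
        (h2.tendsto (s₀, z₀)).eventually hU] with q hq hq1 hq2 v v' hv hv' hvL hvL'
      have ho := he.orthonormal q.2 trivial
      rw [(hlL _ hq2).2, comb_mem_lineOf ho] at hvL
      have hvL'' : comb (e q.2) v' ∈ lineOf (e q.2) (l (q.2, q.1)) := (hlL _ hq1).2 ▸ hvL'
      rw [comb_mem_lineOf ho] at hvL''
      obtain ⟨r, rfl⟩ := hvL
      obtain ⟨r', rfl⟩ := hvL''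
      rw [realDot_smul_left, realDot_smul_right]
      exact mul_ne_zero (fun h => hv (by rw [h, zero_smul]))
        (mul_ne_zero (fun h => hv' (by rw [h, zero_smul])) hq)
    filter_upwards [hev] with s hs
    refine propext ⟨fun h => ?_, fun h => ?_⟩
    · refine h.of_not_orthogonal he (hslice s₀) fun z v v' hv hv' hvL hvL' => ?_
      rw [realDot_comm]
      exact hs z trivial v' v hv' hv hvL' hvL
    · exact h.of_not_orthogonal he (hslice s) fun z => hs z trivial
  exact iff_of_eq (hloc.apply_eq_of_preconnectedSpace 0 1)

end Lines

/-! ### The invariant `η` -/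

section Eta

variable {Z : Type*} [TopologicalSpace Z] {E : Z → Type*}
  [TopologicalSpace (TotalSpace (EuclideanSpace ℂ (Fin 3)) E)]
  [∀ z, NormedAddCommGroup (E z)] [∀ z, InnerProductSpace ℂ (E z)]
  {Ω : SU3Structure E} {e : ∀ z, Fin 3 → E z}

open Classical in
theorem CloseGraphicalPair.eta_mk (P : CloseGraphicalPair Ω) (z : Z) :
    P.eta (Quotient.mk _ z) = if ∃ (z' : Z) (γ : Path z' z'),
      (Quotient.mk _ z' : ZerothHomotopy Z) = Quotient.mk _ z ∧ ReversesOrientation P.line γ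
      then 1 else 0 := by
  have h : ∀ {z' : Z} (γ : Path z' z'), w1 P.line γ ≠ 0 ↔ ReversesOrientation P.line γ :=
    fun γ => by
      rw [w1]
      split_ifs with h <;> simp [h]
  simp only [eta, w1Component, h]

theorem CloseGraphicalPair.eta_congr {P Q : CloseGraphicalPair Ω}
    (h : ∀ (z : Z) (γ : Path z z), ReversesOrientation P.line γ ↔ ReversesOrientation Q.line γ) :
    P.eta = Q.eta := by
  funext Γ
  obtain ⟨z, rfl⟩ := Quotient.exists_rep Γ
  rw [eta_mk, eta_mk]
  classical
  exact if_congr (exists_congr fun z' => exists_congr fun γ => and_congr_right fun _ => h z' γ)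
    rfl rfl

variable [FiberBundle (EuclideanSpace ℂ (Fin 3)) E] [VectorBundle ℂ (EuclideanSpace ℂ (Fin 3)) E]

theorem CloseGraphicalPair.isPosPair (he : IsSU3Frame Ω Set.univ e) (P : CloseGraphicalPair Ω)
    (z : Z) : IsPosPair (P.fst z) (P.snd z) :=
  P.isClose.exists_posGraph he z

theorem CloseGraphicalPair.IsNormalized.exists_isAdaptedFrame (he : IsSU3Frame Ω Set.univ e)
    {P : CloseGraphicalPair Ω} (h : P.IsNormalized) (z : Z) :
    ∃ q : (Fin 3 → E z) × MR, IsAdaptedFrame (P.fst z) (P.snd z) q.1 q.2 :=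
  (P.isPosPair he z).exists_isAdaptedFrame (h z)

theorem CloseGraphicalPair.exists_normalized (he : IsSU3Frame Ω Set.univ e)
    (P : CloseGraphicalPair Ω) : ∃ Q, P.IsReordering Q ∧ Q.IsNormalized := by
  obtain ⟨R, W, W', hR, hW, hW', hRW, hRW', hq⟩ := exists_reordering (V := P.fst) (V' := P.snd) he
    continuous_id P.isClose.1.1 P.isClose.1.2.1 (P.isPosPair he)
  refine ⟨⟨W, W', isCloseGraphicalPair_of_adapted he hW hW' hq⟩, ⟨R, hR, hRW, hRW'⟩, fun z => ?_⟩
  obtain ⟨q, hq⟩ := hq z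
  exact hq.oneNegTwoPos

theorem CloseGraphicalPair.isLineFamily_line (he : IsSU3Frame Ω Set.univ e)
    (P : CloseGraphicalPair Ω) : IsLineFamily e (fun z => z) P.line :=
  isLineFamily_distinguishedLine he continuous_id P.isClose.1.1 P.isClose.1.2.1 (P.isPosPair he)

theorem CloseGraphicalPair.IsReordering.line_eq (he : IsSU3Frame Ω Set.univ e)
    {P Q : CloseGraphicalPair Ω} (h : P.IsReordering Q) : P.line = Q.line := by
  obtain ⟨S, -, hS, hS'⟩ := h
  funext z
  rw [line, line]
  by_cases hz : z ∈ S
  · rw [(hS z hz).1, (hS z hz).2, (P.isPosPair he z).distinguishedLine_comm]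
  · rw [(hS' z hz).1, (hS' z hz).2]

theorem CloseGraphicalPair.IsReordering.eta_eq (he : IsSU3Frame Ω Set.univ e)
    {P Q : CloseGraphicalPair Ω} (h : P.IsReordering Q) : P.eta = Q.eta :=
  eta_congr fun z γ => by rw [h.line_eq he]

theorem CloseGraphicalPair.Homotopic.eta_eq [CompactSpace Z] (he : IsSU3Frame Ω Set.univ e)
    {P Q : CloseGraphicalPair Ω} (h : P.Homotopic Q) : P.eta = Q.eta := by
  obtain ⟨F, F', ⟨hF, hF0, hF1⟩, ⟨hF', hF0', hF1'⟩, hc⟩ := h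
  have hL := isLineFamily_distinguishedLine (V := F) (V' := F') he continuous_fst
    ⟨hF, fun q => (hc q.2).1.1.2 q.1⟩ ⟨hF', fun q => (hc q.2).1.2.1.2 q.1⟩
    fun q => (hc q.2).exists_posGraph he q.1
  have h0 : P.line = fun z => distinguishedLine (F (z, 0)) (F' (z, 0)) := by
    funext z
    rw [line, hF0, hF0']
  have h1 : Q.line = fun z => distinguishedLine (F (z, 1)) (F' (z, 1)) := by
    funext z
    rw [line, hF1, hF1']
  refine eta_congr fun z γ => ?_
  rw [h0, h1]
  exact reversesOrientation_homotopy he hL γ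

variable {p : ConnectedComponents Z → I → Z}

/-- Path components agree with connected components. -/
theorem zerothHomotopy_mk_eq_iff {Z : Type*} [TopologicalSpace Z]
    {p : ConnectedComponents Z → I → Z} (hp : ∀ Γ, IsCircleParam (p Γ))
    (hr : ∀ z : Z, Set.range (p z) = connectedComponent z) {z z' : Z} :
    (Quotient.mk _ z' : ZerothHomotopy Z) = Quotient.mk _ z ↔
      (z' : ConnectedComponents Z) = z := by
  rw [Quotient.eq]
  constructor
  · intro h
    exact ConnectedComponents.coe_eq_coe'.2 (pathComponent_subset_component z h.symm)
  · intro h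
    obtain ⟨t, ht⟩ := exists_circleParam_eq hr z
    obtain ⟨t', ht'⟩ := exists_circleParam_eq hr z'
    rw [h] at ht'
    rw [← ht, ← ht']
    have : PathConnectedSpace I := isPathConnected_iff_pathConnectedSpace.1
      ((convex_Icc (0 : ℝ) 1).isPathConnected ⟨0, unitInterval.zero_mem⟩)
    exact (PathConnectedSpace.joined t' t).map (hp _).continuous

theorem twist_mul_column (u : SU3) (δ : ZMod 2) (i : Fin 3) :
    ((u * twist δ : SU3) : M3) i 0 = (if δ = 1 then -1 else 1 : ℝ) • (u : M3) i 0 := by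
  change ((u : M3) * cx (twistMat δ)) i 0 = _
  rw [twistMat]
  split_ifs
  · rw [cx_diagonal, mul_diagonal]
    simp
  · rw [map_one, mul_one, one_smul]

/-- A family of lines that is spanned by a continuous function on the base has trivial monodromy: its
inner product with a section of opposite signs at the ends would have a zero. -/
theorem not_reversesOrientation (he : IsSU3Frame Ω Set.univ e) {L : ∀ z, Submodule ℝ (E z)} {z : Z}
    (γ : Path z z) {l : Z → Fin 3 → ℂ} (hl : Continuous l)
    (hL : ∀ t, l (γ t) ≠ 0 ∧ L (γ t) = lineOf (e (γ t)) (l (γ t))) :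
    ¬ ReversesOrientation L γ := by
  rw [reversesOrientation_iff he]
  rintro ⟨a, ha, haL, c, hc, hac⟩
  have hcont : Continuous fun t => realDot (l (γ t)) (a t) :=
    continuous_realDot.comp ((hl.comp γ.continuous).prodMk ha)
  have hne : ∀ t, realDot (l (γ t)) (a t) ≠ 0 := fun t => by
    obtain ⟨h1, h2⟩ := haL t
    rw [(hL t).2, comb_mem_lineOf (he.orthonormal _ trivial)] at h1
    obtain ⟨r, hr⟩ := h1
    rw [← hr, realDot_smul_right]
    exact mul_ne_zero (fun h => h2 (by rw [← hr, h, zero_smul])) (realDot_self_pos (hL t).1).ne'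
  have h1 : realDot (l (γ 1)) (a 1) = c * realDot (l (γ 0)) (a 0) := by
    rw [hac, realDot_smul_right, γ.target, γ.source]
  have hzero : ∃ t, realDot (l (γ t)) (a t) = 0 := by
    rcases (hne 0).lt_or_gt with h | h
    · exact mem_range_of_exists_le_of_exists_ge hcont ⟨0, h.le⟩
        ⟨1, h1 ▸ (mul_pos_of_neg_of_neg hc h).le⟩
    · exact mem_range_of_exists_le_of_exists_ge hcont
        ⟨1, h1 ▸ (mul_neg_of_neg_of_pos hc h).le⟩ ⟨0, h.le⟩
  obtain ⟨t, ht⟩ := hzero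
  exact hne t ht

variable [ChartedSpace ℝ Z] [T2Space Z]

/-- A continuous function on a circle extends to the whole one-manifold. -/
theorem exists_extend_circle (hp : ∀ Γ, IsCircleParam (p Γ))
    (hr : ∀ z : Z, Set.range (p z) = connectedComponent z) (Γ : ConnectedComponents Z)
    {Y : Type*} [TopologicalSpace Y] {a : I → Y} (ha : Continuous a) (h01 : a 1 = a 0) :
    ∃ l : Z → Y, Continuous l ∧ ∀ t, l (p Γ t) = a t := by
  classical
  choose τ hτ using exists_circleParam_eq hr
  let l : Z → Y := fun z => if (z : ConnectedComponents Z) = Γ then a (τ z) else a 0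
  have hl : ∀ t, l (p Γ t) = a t := fun t => by
    have hΓ := coe_circleParam hr Γ t
    have h1 := hτ (p Γ t)
    rw [hΓ] at h1
    change (if _ then _ else _) = _
    rw [if_pos hΓ]
    rcases (hp Γ).eq_or _ _ h1 with h | ⟨h, h'⟩ | ⟨h, h'⟩
    · rw [h]
    · rw [h, h', h01]
    · rw [h, h', h01]
  have hl' : Continuous fun q : Z × Unit => l q.1 := by
    refine continuous_of_circleParams hp hr fun Γ' => ?_
    by_cases hΓ : Γ' = Γ
    · subst hΓ
      exact (ha.comp continuous_fst).congr fun q => (hl q.1).symm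
    · refine (continuous_const (y := a 0)).congr fun q => ?_
      rw [← coe_circleParam hr Γ' q.1] at hΓ
      exact (if_neg hΓ).symm
  exact ⟨l, hl'.comp (continuous_id.prodMk (continuous_const (y := ()))), hl⟩

/-- The value of `η` on a circle is the monodromy of any lift along this circle. -/
theorem CloseGraphicalPair.eta_eq_of_lift (he : IsSU3Frame Ω Set.univ e)
    (hp : ∀ Γ, IsCircleParam (p Γ)) (hr : ∀ z : Z, Set.range (p z) = connectedComponent z)
    (P : CloseGraphicalPair Ω) (z : Z) {u : I → SU3} {δ : ZMod 2} (hu : Continuous u)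
    (hu1 : u 1 = u 0 * twist δ) (huP : ∀ t, ∃ S, IsAdaptedFrame (P.fst (p z t)) (P.snd (p z t))
      (frameMul (e (p z t)) (u t : M3)) S) : P.eta (Quotient.mk _ z) = δ := by
  let a : I → Fin 3 → ℂ := fun t i => (u t : M3) i 0
  have ha : Continuous a := continuous_pi fun i => (continuous_id.matrix_elem i 0).comp
    (continuous_subtype_val.comp hu)
  have ha0 : ∀ t, a t ≠ 0 := fun t h0 => by
    have h1 : (u t : M3).det = 0 := det_eq_zero_of_column_eq_zero 0 fun i => congrFun h0 i
    rw [(u t).det_eq] at h1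
    exact one_ne_zero h1
  have haL : ∀ t, P.line (p z t) = lineOf (e (p z t)) (a t) := fun t => by
    obtain ⟨S, hS⟩ := huP t
    exact hS.distinguishedLine_eq
  have ha1 : a 1 = (if δ = 1 then -1 else 1 : ℝ) • a 0 := by
    funext i
    change (u 1 : M3) i 0 = _
    rw [hu1, twist_mul_column]
    rfl
  rw [eta_mk]
  by_cases hδ : δ = 1
  -- the first column of the lift is a section along the circle that changes its sign
  · rw [if_pos, hδ]
    let γ : Path (p z 0) (p z 0) := ⟨⟨p z, (hp z).continuous⟩, rfl, (hp z).closed.symm⟩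
    refine ⟨p z 0, γ, (zerothHomotopy_mk_eq_iff hp hr).2 (coe_circleParam hr z 0), ?_⟩
    rw [reversesOrientation_iff he]
    refine ⟨a, ha, fun t => ⟨?_, ha0 t⟩, -1, by norm_num, by rw [ha1, if_pos hδ]⟩
    change comb (e (p z t)) (a t) ∈ P.line (p z t)
    rw [haL, comb_mem_lineOf (he.orthonormal _ trivial)]
    exact ⟨1, one_smul _ _⟩
  · rw [if_neg]
    · have h2 : ∀ d : ZMod 2, d ≠ 1 → 0 = d := by decide
      exact h2 δ hδ
    rintro ⟨z', γ, hz', hγ⟩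
    rw [if_neg hδ, one_smul] at ha1
    -- the first column of the lift closes up, so the line has a global section over the circle
    obtain ⟨l, hl, hla⟩ := exists_extend_circle hp hr z ha ha1
    refine not_reversesOrientation he γ hl (fun t => ?_) hγ
    have h1 : γ t ∈ connectedComponent z' := by
      have h2 := (isPreconnected_range γ.continuous).subset_connectedComponent ⟨0, γ.source⟩
      exact h2 (Set.mem_range_self t)
    have h3 : (γ t : ConnectedComponents Z) = z :=
      (ConnectedComponents.coe_eq_coe'.2 h1).trans ((zerothHomotopy_mk_eq_iff hp hr).1 hz')
    obtain ⟨t', ht'⟩ := exists_circleParam_eq hr (γ t)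
    rw [h3] at ht'
    rw [← ht', hla]
    exact ⟨ha0 t', haL t'⟩

theorem CloseGraphicalPair.homotopic_of_eta_eq (he : IsSU3Frame Ω Set.univ e)
    (hp : ∀ Γ, IsCircleParam (p Γ)) (hr : ∀ z : Z, Set.range (p z) = connectedComponent z)
    {P Q : CloseGraphicalPair Ω} (hP : P.IsNormalized) (hQ : Q.IsNormalized)
    (h : P.eta = Q.eta) : P.Homotopic Q := by
  have hP' := hP.exists_isAdaptedFrame he
  have hQ' := hQ.exists_isAdaptedFrame he
  choose u δ hu hu1 huP using fun Γ =>
    exists_circle_lift he P.isClose.1.1 P.isClose.1.2.1 hP' (hp Γ)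
  choose v δ' hv hv1 hvQ using fun Γ =>
    exists_circle_lift he Q.isClose.1.1 Q.isClose.1.2.1 hQ' (hp Γ)
  obtain rfl : δ = δ' := by
    funext Γ
    obtain ⟨z, rfl⟩ := ConnectedComponents.surjective_coe Γ
    rw [← P.eta_eq_of_lift he hp hr z (hu z) (hu1 z) (huP z), h,
      Q.eta_eq_of_lift he hp hr z (hv z) (hv1 z) (hvQ z)]
  exact homotopic_of_twist he hp hr P Q hP' hQ' hu hu1 huP hv hv1 hvQ

theorem CloseGraphicalPair.exists_eta_eq (he : IsSU3Frame Ω Set.univ e)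
    (hp : ∀ Γ, IsCircleParam (p Γ)) (hr : ∀ z : Z, Set.range (p z) = connectedComponent z)
    (η : ZerothHomotopy Z → ZMod 2) : ∃ P : CloseGraphicalPair Ω, P.eta = η := by
  let δ : ConnectedComponents Z → ZMod 2 := fun Γ => η (Quotient.mk _ (p Γ 0))
  let γ : ∀ d : ZMod 2, Path (1 : SU3) (twist d) := fun d => PathConnectedSpace.somePath _ _
  have hγ : ∀ d, γ d 1 = γ d 0 * twist d := fun d => by
    rw [(γ d).target, (γ d).source, one_mul]
  obtain ⟨V, V', -, -, hA, hc⟩ := exists_circlePairFamily (Ω := Ω) (K := Unit) he hp hr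
    (w := fun Γ q => γ (δ Γ) q.1) (fun Γ => (γ (δ Γ)).continuous.comp continuous_fst) (δ := δ)
    fun Γ _ => hγ (δ Γ)
  refine ⟨⟨_, _, hc ()⟩, funext fun Γ => ?_⟩
  obtain ⟨z, rfl⟩ := Quotient.exists_rep Γ
  rw [CloseGraphicalPair.eta_eq_of_lift he hp hr _ z (γ (δ z)).continuous (hγ _)
    fun t => ⟨_, hA z t ()⟩]
  exact congrArg η ((zerothHomotopy_mk_eq_iff hp hr).2 (coe_circleParam hr z 0))

end Eta

end SLPairs

theorem proposition3p15 {Z : Type*} [TopologicalSpace Z] [ChartedSpace ℝ Z] [T2Space Z]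
    [CompactSpace Z] (E : Z → Type*)
    [TopologicalSpace (TotalSpace (EuclideanSpace ℂ (Fin 3)) E)]
    [∀ z, NormedAddCommGroup (E z)] [∀ z, InnerProductSpace ℂ (E z)]
    [FiberBundle (EuclideanSpace ℂ (Fin 3)) E] [VectorBundle ℂ (EuclideanSpace ℂ (Fin 3)) E]
    (Ω : SU3Structure E) :
    (∀ P : CloseGraphicalPair Ω, ∃ Q, P.IsReordering Q ∧ Q.IsNormalized) ∧
    (∀ P : CloseGraphicalPair Ω, IsSubbundle (fun z : Z => z) 1 P.line) ∧
    (∀ P Q : CloseGraphicalPair Ω, P.IsNormalized → Q.IsNormalized →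
      (P.Homotopic Q ↔ P.eta = Q.eta)) ∧
    ∃ hη : ∀ P Q : CloseGraphicalPair Ω, P.Homotopic Q ∨ P.IsReordering Q → P.eta = Q.eta,
      Function.Bijective
        (Quot.lift CloseGraphicalPair.eta hη : CGP Ω → (ZerothHomotopy Z → ZMod 2)) := by
  obtain ⟨e, he⟩ := Ω.exists_global_frame
  obtain ⟨p, hp, hr⟩ := exists_circleParams Z
  refine ⟨fun P => P.exists_normalized he,
    fun P => (P.isLineFamily_line he).isSubbundle he continuous_id,
    fun P Q hP hQ => ⟨fun h => h.eta_eq he, fun h => P.homotopic_of_eta_eq he hp hr hP hQ h⟩,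
    fun P Q h => h.elim (fun h => h.eta_eq he) fun h => h.eta_eq he, ?_, fun η => ?_⟩
  · rintro ⟨P⟩ ⟨Q⟩ hPQ
    change P.eta = Q.eta at hPQ
    obtain ⟨P', hP, hP'⟩ := P.exists_normalized he
    obtain ⟨Q', hQ, hQ'⟩ := Q.exists_normalized he
    have h : P'.Homotopic Q' := CloseGraphicalPair.homotopic_of_eta_eq he hp hr hP' hQ' <| by
      rw [← hP.eta_eq he, hPQ, hQ.eta_eq he]
    have hmk : ∀ {P Q : CloseGraphicalPair Ω}, P.Homotopic Q ∨ P.IsReordering Q →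
        (Quot.mk _ P : CGP Ω) = Quot.mk _ Q := fun h => Quot.sound h
    exact (hmk (Or.inr hP)).trans ((hmk (Or.inl h)).trans (hmk (Or.inr hQ)).symm)
  · obtain ⟨P, hP⟩ := CloseGraphicalPair.exists_eta_eq (Ω := Ω) he hp hr η
    exact ⟨Quot.mk _ P, hP⟩
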